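/- **Theorem (Existence of absolute minimisers in 1D).** Let $\Omega\subseteq\mathbb{R}$ be open and bounded and let $\mathrm H\in C(\Omega\times\mathbb{R}\times\mathbb{R}\times\mathbb{R})$, $\mathrm H=\mathrm H(x,\eta,\mathrm p,\mathrm X)$, satisfy: (i) $\mathrm H\ge -m$ for some $m>0$; (ii) for all $(x,\eta,\mathrm p)\in\Omega\times\mathbb{R}\times\mathbb{R}$ and $c\in\mathbb{R}$ the set $\{\mathrm X:\mathrm H(x,\eta,\mathrm p,\mathrm X)\le c\}$ is convex; (iii) there are $C_1,C_2>0$ and $0\le s,t<1$ with $\mathrm H(x,\eta,\mathrm p,\mathrm X)\ge C_1|\mathrm X|-C_2(1+|\eta|^s+|\mathrm p|^t)$ for a.e. $x\in\Omega$ and all $(\eta,\mathrm p,\mathrm X)$; (iv) for every $R>0$ there are $\ell>1$ and a non-decreasing $\omega_R\in C[0,\infty)$ with $\omega_R(0)=0$ such that $|\mathrm H(x,\eta',\mathrm p',\mathrm X)-\mathrm H(x,\eta'',\mathrm p'',\mathrm X)|\le\omega_R(|\eta'-\eta''|+|\mathrm p'-\mathrm p''|)(1+|\mathrm X|^\ell)$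 for a.e. $x\in\Omega$, all $\eta',\eta'',\mathrm p',\mathrm p''\in(-R,R)$ and all $\mathrm X\in\mathbb{R}$. For open $\mathcal O\subseteq\Omega$ and a fixed $M>m$ put $$\mathrm E_\infty(u,\mathcal O)=\operatorname*{ess\,sup}_{x\in\mathcal O}\mathrm H(x,u,u',u''),\qquad \mathrm E_p(u,\mathcal O)=\Big(\frac1{|\mathcal O|}\int_{\mathcal O}\big(M+\mathrm H(x,u,u',u'')\big)^p\,dx\Big)^{1/p}-M .$$ Here $W^{2,\infty}_0(\mathcal O)=W^{2,\infty}(\mathcal O)\cap W^{2,1}_0(\mathcal O)$ and $W^{2,\infty}_g(\Omega)=g+W^{2,\infty}_0(\Omega)$. Let $g\in W^{2,\infty}(\Omega)$ be such that $\mathrm E_\infty(\psi,\Omega)<\infty$ for at least one $\psi\in W^{2,\infty}_g(\Omega)$, and let $(\varepsilon_p)_{p>1}$ be positive numbers with $\varepsilon_p^{1/p}\to0$ as $p\to\infty$. Then there are approximate minimisers $u_p\in W^{2,\infty}_g(\Omega)$, $p\in(1,\infty)$, satisfying $$\mathrm E_p(u_p,\Omega)\le\varepsilon_p+\inf\{\mathrm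 E_p(v,\Omega):v\in W^{2,\infty}_g(\Omega)\}\qquad(p>1).\tag{$*$}$$ For every family $(u_p)$ satisfying $(*)$ and every sequence $p_j\to\infty$ in $(1,\infty)$: (a) there are a subsequence of $(u_{p_j})$ and a function $u_\infty$ to which it converges weakly in $W^{2,q}(\Omega)$ for all $q\in(1,\infty)$; (b) whenever $u_{p_j}\rightharpoonup u_\infty$ weakly in $W^{2,q}(\Omega)$ for all $q\in(1,\infty)$, the limit $u_\infty$ belongs to $W^{2,\infty}_g(\Omega)$, is a global minimiser, i.e. $\mathrm E_\infty(u_\infty,\Omega)\le\mathrm E_\infty(u_\infty+\phi,\Omega)$ for all $\phi\in W^{2,\infty}_0(\Omega)$, and is an absolute minimiser of $\mathrm E_\infty$ on $\Omega$, i.e. $$\mathrm E_\infty(u_\infty,\Omega')\le\mathrm E_\infty(u_\infty+\phi,\Omega')\qquad\text{for all open }\Omega'\Subset\Omega\text{ and all }\phi\in W^{2,\infty}_0(\Omega').$$ -/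

import Mathlib

open MeasureTheory Filter Topology Set
open scoped ENNReal ContDiff

/-- Smooth functions with compact support contained in `O`. -/
def IsTestFunction (O : Set ℝ) (ψ : ℝ → ℝ) : Prop :=
  ContDiff ℝ ∞ ψ ∧ HasCompactSupport ψ ∧ tsupport ψ ⊆ O

/-- `v` is a weak derivative of `u` in the open set `O`
(both locally integrable in `O`; values outside `O` are irrelevant). -/
def IsWeakDeriv (O : Set ℝ) (u v : ℝ → ℝ) : Prop :=
  LocallyIntegrableOn u O ∧ LocallyIntegrableOn v O ∧
    ∀ ψ : ℝ → ℝ, IsTestFunction O ψ →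
      ∫ x in O, u x * deriv ψ x = - ∫ x in O, v x * ψ x

open Classical in
/-- The weak derivative of `u` in `O` (unique up to null sets of `O`), and `0` if there is none. -/
noncomputable def weakDeriv (O : Set ℝ) (u : ℝ → ℝ) : ℝ → ℝ :=
  if h : ∃ v, IsWeakDeriv O u v then h.choose else 0

/-- The second weak derivative of `u` in `O`. -/
noncomputable def weakDeriv2 (O : Set ℝ) (u : ℝ → ℝ) : ℝ → ℝ :=
  weakDeriv O (weakDeriv O u)

/-- `u ∈ W^{2,q}(O)`. -/
def MemW2 (O : Set ℝ) (q : ℝ≥0∞) (u : ℝ → ℝ) : Prop :=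
  ∃ u₁ u₂ : ℝ → ℝ, IsWeakDeriv O u u₁ ∧ IsWeakDeriv O u₁ u₂ ∧
    MemLp u q (volume.restrict O) ∧ MemLp u₁ q (volume.restrict O) ∧
    MemLp u₂ q (volume.restrict O)

/-- `φ ∈ W^{2,∞}_0(O) = W^{2,∞}(O) ∩ W^{2,1}_0(O)`, where `W^{2,1}_0(O)` is the closure of the
test functions in the norm of `W^{2,1}(O)`. -/
def MemW2InftyZero (O : Set ℝ) (φ : ℝ → ℝ) : Prop :=
  MemW2 O ∞ φ ∧ ∃ ψ : ℕ → ℝ → ℝ, (∀ k, IsTestFunction O (ψ k)) ∧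
    Tendsto (fun k => eLpNorm (fun x => ψ k x - φ x) 1 (volume.restrict O)) atTop (𝓝 0) ∧
    Tendsto (fun k => eLpNorm (fun x => deriv (ψ k) x - weakDeriv O φ x) 1
      (volume.restrict O)) atTop (𝓝 0) ∧
    Tendsto (fun k => eLpNorm (fun x => deriv (deriv (ψ k)) x - weakDeriv2 O φ x) 1
      (volume.restrict O)) atTop (𝓝 0)

/-- The class `W^{2,∞}_g(O) = g + W^{2,∞}_0(O)`. -/
def dirichletClass (O : Set ℝ) (g : ℝ → ℝ) : Set (ℝ → ℝ) :=
  {u | MemW2InftyZero O (fun x => u x - g x)}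

/-- `x ↦ H(x, u(x), u'(x), u''(x))`, with weak derivatives in the open set `O`. -/
noncomputable def alongJet (H : ℝ → ℝ → ℝ → ℝ → ℝ) (u : ℝ → ℝ) (O : Set ℝ) (x : ℝ) : ℝ :=
  H x (u x) (weakDeriv O u x) (weakDeriv2 O u x)

/-- The supremal functional `E_∞(u, O)`, for open `O`, as an extended real number. -/
noncomputable def supEnergy (H : ℝ → ℝ → ℝ → ℝ → ℝ) (u : ℝ → ℝ) (O : Set ℝ) : EReal :=
  essSup (fun x => ((alongJet H u O x : ℝ) : EReal)) (volume.restrict O)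

/-- The approximating functional
`E_p(u, O) = (⨍_O (M + H(x, u, u', u''))^p dx)^{1/p} - M`, as an extended real number
(used for `M + H > 0`). -/
noncomputable def lpEnergy (H : ℝ → ℝ → ℝ → ℝ → ℝ) (M p : ℝ) (u : ℝ → ℝ) (O : Set ℝ) : EReal :=
  ((laverage (volume.restrict O) (fun x => ENNReal.ofReal (M + alongJet H u O x) ^ p) ^ (1 / p) :
    ℝ≥0∞) : EReal) - (M : EReal)

/-- `u` is a global minimiser of `E_∞` on `Ω` in the class `W^{2,∞}_g(Ω)`. -/
def IsGlobalMinimiser (H : ℝ → ℝ → ℝ → ℝ → ℝ) (Ω : Set ℝ) (g u : ℝ → ℝ) : Prop :=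
  u ∈ dirichletClass Ω g ∧
    ∀ φ : ℝ → ℝ, MemW2InftyZero Ω φ → supEnergy H u Ω ≤ supEnergy H (fun x => u x + φ x) Ω

/-- `u` is an absolute minimiser of `E_∞` on `Ω`. -/
def IsAbsoluteMinimiser (H : ℝ → ℝ → ℝ → ℝ → ℝ) (Ω : Set ℝ) (u : ℝ → ℝ) : Prop :=
  MemW2 Ω ∞ u ∧
    ∀ Ω' : Set ℝ, IsOpen Ω' → IsCompact (closure Ω') → closure Ω' ⊆ Ω →
      ∀ φ : ℝ → ℝ, MemW2InftyZero Ω' φ →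
        supEnergy H u Ω' ≤ supEnergy H (fun x => u x + φ x) Ω'

/-- `(u_p)`, `1 < p < ∞`, are approximate minimisers of the functionals `E_p(·, Ω)` in the class
`W^{2,∞}_g(Ω)`, with tolerances `ε_p`. -/
def AreApproxMinimisers (H : ℝ → ℝ → ℝ → ℝ → ℝ) (M : ℝ) (Ω : Set ℝ) (g : ℝ → ℝ)
    (ε : ℝ → ℝ) (u : ℝ → ℝ → ℝ) : Prop :=
  ∀ p : ℝ, 1 < p → u p ∈ dirichletClass Ω g ∧
    lpEnergy H M p (u p) Ω ≤ (ε p : EReal) + ⨅ v ∈ dirichletClass Ω g, lpEnergy H M p v Ω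

/-- `v_j ⇀ w` weakly in `W^{2,q}(Ω)` for every `q ∈ (1,∞)`: the functions and their weak
derivatives up to second order converge weakly in `L^q(Ω)`. -/
def WeaklyConvergesW2 (Ω : Set ℝ) (v : ℕ → ℝ → ℝ) (w : ℝ → ℝ) : Prop :=
  ∀ q q' : ℝ, q.HolderConjugate q' →
    (∀ j, MemW2 Ω (ENNReal.ofReal q) (v j)) ∧ MemW2 Ω (ENNReal.ofReal q) w ∧
    ∀ f : ℝ → ℝ, MemLp f (ENNReal.ofReal q') (volume.restrict Ω) →
      Tendsto (fun j => ∫ x in Ω, v j x * f x) atTop (𝓝 (∫ x in Ω, w x * f x)) ∧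
      Tendsto (fun j => ∫ x in Ω, weakDeriv Ω (v j) x * f x) atTop
        (𝓝 (∫ x in Ω, weakDeriv Ω w x * f x)) ∧
      Tendsto (fun j => ∫ x in Ω, weakDeriv2 Ω (v j) x * f x) atTop
        (𝓝 (∫ x in Ω, weakDeriv2 Ω w x * f x))

/-! ### Test functions and weak derivatives -/

/-! On the line, an element of `W^{2,∞}_g(Ω)` is g plus the double primitive, taken from -∞, of one
bounded function h (`memW2InftyZero_iff`): the second derivative of the `W^{2,∞}_0` part, extended
by zero. The boundary conditions force both primitives to vanish off Ω, and every question about u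
becomes a question about h.

Compactness. Both primitives are bounded by multiples of ‖h‖₁. The sublinear lower-order terms of
the coercivity are therefore absorbed, and an energy bound controls ‖h‖₁
(`JetProblem.exists_estimates`), then ‖h‖_q for each q ≤ p. Weak L² compactness gives a limit. The
first primitives converge pointwise, being pairings of h with fixed bounded functions, and the
second ones by dominated convergence. The admissible h are the bounded members of a subspace, and
its closedness in L² makes it weakly closed.

Semicontinuity. Suppose that for every c' > c the measure of the set where H exceeds c' along the
sequence tends to zero. By Borel-Cantelli, along a subsequence almost every x eventually lies in the
sublevel set. A weak limit lies a.e. between the lower and upper limits of the sequence; these are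
cluster points, so by continuity they lie in the sublevel set of H at the limiting lower-order jet.
That set is convex, so it contains the weak limit (`ae_le_of_weak_convergence`). Coercivity on the
same set bounds the limiting second derivative.

Measure of superlevel sets. By Chebyshev it suffices that the integral of (M+H)^p be negligible
against (M+c')^p. Globally this follows from comparison with one competitor of level c. Locally, let
(a,b) be a component of Ω' and W a competitor whose jet at a and b is that of the limit. The jets of
the approximate minimisers at a and b only converge to it, so W is glued in after subtracting a
Hermite cubic that repairs the mismatch. The cubic tends to zero in C², and uniform continuity of H
on a compact set keeps the level near c. The glued competitor agrees with the approximate minimiser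
outside (a,b), so the contributions to the p-th power integrals cancel there and only (a,b) matters.
The tolerance costs a term of order p ε_p L^p, which is negligible because ε_p^{1/p} → 0
(`lintegral_le_of_lpMean_comparison`, `JetProblem.tendsto_measure_local`). In this way absolute
minimality is inherited from a minimisation problem posed only on Ω. -/

namespace IsTestFunction

variable {O O' : Set ℝ} {ψ θ : ℝ → ℝ}

theorem differentiable (h : IsTestFunction O ψ) : Differentiable ℝ ψ :=
  h.1.differentiable (by simp)

theorem deriv (h : IsTestFunction O ψ) : IsTestFunction O (deriv ψ) :=
  ⟨((contDiff_infty_iff_deriv (𝕜 := ℝ)).1 h.1).2, h.2.1.deriv,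
    (closure_mono (support_deriv_subset (f := ψ))).trans
      ((closure_minimal le_rfl (isClosed_tsupport ψ)).trans h.2.2)⟩

theorem continuous (h : IsTestFunction O ψ) : Continuous ψ := h.1.continuous

theorem eq_zero (h : IsTestFunction O ψ) {x : ℝ} (hx : x ∉ O) : ψ x = 0 :=
  image_eq_zero_of_notMem_tsupport fun hx' => hx (h.2.2 hx')

theorem integrable (h : IsTestFunction O ψ) : Integrable ψ :=
  h.continuous.integrable_of_hasCompactSupport h.2.1

theorem exists_bound (h : IsTestFunction O ψ) : ∃ C : ℝ, ∀ x, |ψ x| ≤ C :=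
  h.2.1.exists_bound_of_continuous h.continuous

theorem mono (h : IsTestFunction O ψ) (hO : O ⊆ O') : IsTestFunction O' ψ :=
  ⟨h.1, h.2.1, h.2.2.trans hO⟩

theorem zero : IsTestFunction O (fun _ => 0) :=
  ⟨contDiff_const, HasCompactSupport.zero, by
    simp [tsupport, Function.support_fun_zero]⟩

theorem add (h : IsTestFunction O ψ) (h' : IsTestFunction O θ) :
    IsTestFunction O (fun x => ψ x + θ x) :=
  ⟨h.1.add h'.1, h.2.1.add h'.2.1, (tsupport_add ψ θ).trans (union_subset h.2.2 h'.2.2)⟩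

theorem const_mul (h : IsTestFunction O ψ) (c : ℝ) : IsTestFunction O (fun x => c * ψ x) :=
  ⟨contDiff_const.mul h.1, h.2.1.mul_left, (tsupport_mul_subset_right (f := fun _ => c)).trans h.2.2⟩

theorem setIntegral_eq (h : IsTestFunction O ψ) (u : ℝ → ℝ) :
    ∫ x in O, u x * ψ x = ∫ x, u x * ψ x :=
  setIntegral_eq_integral_of_forall_compl_eq_zero fun x hx => by simp [h.eq_zero hx]

theorem integrable_mul (h : IsTestFunction O ψ) {u : ℝ → ℝ} (hu : LocallyIntegrableOn u O) :
    Integrable (fun x => u x * ψ x) := by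
  have h1 : IntegrableOn u (tsupport ψ) := hu.integrableOn_compact_subset h.2.2 h.2.1
  have h2 : IntegrableOn (fun x => u x * ψ x) (tsupport ψ) :=
    h1.mul_continuousOn h.continuous.continuousOn h.2.1
  refine (integrableOn_iff_integrable_of_support_subset ?_).1 h2
  intro x hx
  exact subset_tsupport ψ fun h0 => hx (by simp [h0])

end IsTestFunction

namespace IsWeakDeriv

variable {O O' : Set ℝ} {u v u' v' : ℝ → ℝ}

theorem ae_unique (hO : IsOpen O) (h : IsWeakDeriv O u v) (h' : IsWeakDeriv O u v') :
    v =ᵐ[volume.restrict O] v' := by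
  have key := hO.ae_eq_zero_of_integral_contDiff_smul_eq_zero (μ := volume) (f := v - v')
    (h.2.1.sub h'.2.1) (fun ψ h1 h2 h3 => by
      have hψ : IsTestFunction O ψ := ⟨h1, h2, h3⟩
      have e1 := h.2.2 ψ hψ
      rw [h'.2.2 ψ hψ, hψ.setIntegral_eq, hψ.setIntegral_eq] at e1
      have e2 : ∫ x, ψ x • (v - v') x = ∫ x, (v x * ψ x - v' x * ψ x) := by
        congr 1; ext x; simp; ring
      rw [e2, integral_sub (hψ.integrable_mul h.2.1) (hψ.integrable_mul h'.2.1)]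
      linarith)
  rw [EventuallyEq, ae_restrict_iff' hO.measurableSet]
  filter_upwards [key] with x hx hxO
  have := hx hxO
  simp only [Pi.sub_apply] at this
  linarith

theorem congr (h : IsWeakDeriv O u v) (hu : u =ᵐ[volume.restrict O] u')
    (hv : v =ᵐ[volume.restrict O] v') : IsWeakDeriv O u' v' := by
  refine ⟨.congr hu h.1, .congr hv h.2.1, fun ψ hψ => ?_⟩
  have e1 : ∫ x in O, u' x * deriv ψ x = ∫ x in O, u x * deriv ψ x :=
    integral_congr_ae (by filter_upwards [hu] with x hx; rw [hx])
  have e2 : ∫ x in O, v' x * ψ x = ∫ x in O, v x * ψ x :=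
    integral_congr_ae (by filter_upwards [hv] with x hx; rw [hx])
  rw [e1, e2, h.2.2 ψ hψ]

theorem mono (h : IsWeakDeriv O u v) (hO : O' ⊆ O) : IsWeakDeriv O' u v := by
  refine ⟨h.1.mono_set hO, h.2.1.mono_set hO, fun ψ hψ => ?_⟩
  have := h.2.2 ψ (hψ.mono hO)
  rwa [(hψ.mono hO).setIntegral_eq, (hψ.mono hO).deriv.setIntegral_eq, ← hψ.setIntegral_eq,
    ← hψ.deriv.setIntegral_eq] at this

theorem add (h : IsWeakDeriv O u v) (h' : IsWeakDeriv O u' v') :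
    IsWeakDeriv O (fun x => u x + u' x) (fun x => v x + v' x) := by
  refine ⟨h.1.add h'.1, h.2.1.add h'.2.1, fun ψ hψ => ?_⟩
  have e := h.2.2 ψ hψ
  have e' := h'.2.2 ψ hψ
  simp only [add_mul]
  rw [integral_add (hψ.deriv.integrable_mul h.1).integrableOn
      (hψ.deriv.integrable_mul h'.1).integrableOn,
    integral_add (hψ.integrable_mul h.2.1).integrableOn
      (hψ.integrable_mul h'.2.1).integrableOn]
  linarith

theorem weakDeriv_ae_eq (hO : IsOpen O) (h : IsWeakDeriv O u v) :
    weakDeriv O u =ᵐ[volume.restrict O] v := by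
  have hex : ∃ v, IsWeakDeriv O u v := ⟨v, h⟩
  have : weakDeriv O u = hex.choose := by simp [weakDeriv, dif_pos hex]
  rw [this]
  exact ae_unique hO hex.choose_spec h

theorem weakDeriv2_ae_eq (hO : IsOpen O) {w : ℝ → ℝ} (h : IsWeakDeriv O u v)
    (h' : IsWeakDeriv O v w) : weakDeriv2 O u =ᵐ[volume.restrict O] w :=
  (h'.congr (h.weakDeriv_ae_eq hO).symm (ae_eq_refl _)).weakDeriv_ae_eq hO

theorem of_test {ψ : ℝ → ℝ} (hψ : IsTestFunction O' ψ) : IsWeakDeriv O ψ (deriv ψ) := by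
  refine ⟨hψ.continuous.locallyIntegrable.locallyIntegrableOn O,
    hψ.deriv.continuous.locallyIntegrable.locallyIntegrableOn O, fun θ hθ => ?_⟩
  rw [hθ.setIntegral_eq, hθ.deriv.setIntegral_eq]
  have h1 : LocallyIntegrableOn ψ O := hψ.continuous.locallyIntegrable.locallyIntegrableOn O
  have h2 : LocallyIntegrableOn (deriv ψ) O :=
    hψ.deriv.continuous.locallyIntegrable.locallyIntegrableOn O
  exact integral_mul_deriv_eq_deriv_mul_of_integrable
    (fun x _ => (hψ.differentiable x).hasDerivAt) (fun x _ => (hθ.differentiable x).hasDerivAt)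
    (hθ.deriv.integrable_mul h1) (hθ.integrable_mul h2) (hθ.integrable_mul h1)

/-- Weak derivatives are stable under convergence in `L¹`. -/
theorem of_tendsto {us vs : ℕ → ℝ → ℝ} (h : ∀ k, IsWeakDeriv O (us k) (vs k))
    (hui : ∀ k, IntegrableOn (us k) O) (hvi : ∀ k, IntegrableOn (vs k) O)
    (hu : IntegrableOn u O) (hv : IntegrableOn v O)
    (hut : Tendsto (fun k => ∫ x in O, |us k x - u x|) atTop (𝓝 0))
    (hvt : Tendsto (fun k => ∫ x in O, |vs k x - v x|) atTop (𝓝 0)) : IsWeakDeriv O u v := by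
  have key : ∀ (ws : ℕ → ℝ → ℝ) (w θ : ℝ → ℝ), (∀ k, IntegrableOn (ws k) O) →
      IntegrableOn w O → Tendsto (fun k => ∫ x in O, |ws k x - w x|) atTop (𝓝 0) →
      IsTestFunction O θ →
      Tendsto (fun k => ∫ x in O, ws k x * θ x) atTop (𝓝 (∫ x in O, w x * θ x)) := by
    intro ws w θ hwi hw hwt hθ
    obtain ⟨C, hC⟩ := hθ.exists_bound
    rw [tendsto_iff_norm_sub_tendsto_zero]
    refine squeeze_zero (fun _ => norm_nonneg _) (fun k => ?_)
      (by simpa using hwt.const_mul C)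
    rw [← integral_sub (hθ.integrable_mul (hwi k).locallyIntegrableOn).integrableOn
      (hθ.integrable_mul hw.locallyIntegrableOn).integrableOn, ← integral_const_mul]
    refine norm_integral_le_of_norm_le (((hwi k).sub hw).abs.const_mul C) (ae_of_all _ fun x => ?_)
    rw [← sub_mul, norm_mul, mul_comm, Real.norm_eq_abs, Real.norm_eq_abs]
    exact mul_le_mul_of_nonneg_right (hC x) (abs_nonneg _)
  refine ⟨hu.locallyIntegrableOn, hv.locallyIntegrableOn, fun θ hθ => ?_⟩
  refine tendsto_nhds_unique (key us u _ hui hu hut hθ.deriv) ?_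
  simp only [fun k => (h k).2.2 θ hθ]
  exact (key vs v _ hvi hv hvt hθ).neg

end IsWeakDeriv

/-! ### Primitives, and second derivatives of functions in `W^{2,∞}_0` -/

/-- The primitive of `h` vanishing at `-∞`. -/
noncomputable def prim (h : ℝ → ℝ) (x : ℝ) : ℝ := ∫ t in Iic x, h t

section prim

variable {h k : ℝ → ℝ}

theorem abs_prim_le (hi : Integrable h) (x : ℝ) : |prim h x| ≤ ∫ t, |h t| :=
  (abs_integral_le_integral_abs (f := h) (μ := volume.restrict (Iic x))).trans
    (setIntegral_le_integral hi.abs (ae_of_all _ fun _ => abs_nonneg _))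

theorem prim_sub_prim (hi : Integrable h) (x y : ℝ) : prim h y - prim h x = ∫ t in x..y, h t :=
  intervalIntegral.integral_Iic_sub_Iic hi.integrableOn hi.integrableOn

theorem prim_sub (hi : Integrable h) (hk : Integrable k) (x : ℝ) :
    prim (fun t => h t - k t) x = prim h x - prim k x :=
  integral_sub hi.integrableOn hk.integrableOn

theorem prim_add (hi : Integrable h) (hk : Integrable k) (x : ℝ) :
    prim (fun t => h t + k t) x = prim h x + prim k x :=
  integral_add hi.integrableOn hk.integrableOn

theorem continuous_prim (hi : Integrable h) : Continuous (prim h) := by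
  have : prim h = fun y => prim h 0 + ∫ t in (0 : ℝ)..y, h t := by
    ext y; rw [← prim_sub_prim hi]; ring
  rw [this]
  exact continuous_const.add (intervalIntegral.continuous_primitive
    (fun _ _ => hi.intervalIntegrable) 0)

theorem IsTestFunction.prim_deriv {O : Set ℝ} {ψ : ℝ → ℝ} (hψ : IsTestFunction O ψ) :
    prim (_root_.deriv ψ) = ψ := by
  ext x
  exact HasCompactSupport.integral_Iic_deriv_eq (hψ.1.of_le (by norm_cast)) hψ.2.1 x

theorem hasDerivAt_prim (hi : Integrable h) (hc : Continuous h) (x : ℝ) :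
    HasDerivAt (prim h) (h x) x := by
  have : prim h = fun y => prim h 0 + ∫ t in (0 : ℝ)..y, h t := by
    ext y; rw [← prim_sub_prim hi]; ring
  rw [this]
  exact (intervalIntegral.integral_hasDerivAt_right hi.intervalIntegrable
    (hc.stronglyMeasurableAtFilter _ _) hc.continuousAt).const_add _

end prim

theorem integrable_of_bounded_of_eq_zero_off {O : Set ℝ} (hO : Bornology.IsBounded O) {h : ℝ → ℝ}
    (hm : AEStronglyMeasurable h volume) {C : ℝ} (hC : ∀ x, |h x| ≤ C) (h0 : ∀ x ∉ O, h x = 0) :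
    Integrable h := by
  obtain ⟨R, hR⟩ := hO.subset_closedBall 0
  have h1 : IntegrableOn h (Metric.closedBall 0 R) :=
    Measure.integrableOn_of_bounded (M := C) (isCompact_closedBall 0 R).measure_lt_top.ne hm
      (ae_of_all _ hC)
  refine (integrableOn_iff_integrable_of_support_subset ?_).1 h1
  intro x hx
  by_contra hx'
  exact hx (h0 x fun hxO => hx' (hR hxO))

theorem integral_abs_le_of_eq_zero_off {O : Set ℝ} (hO : Bornology.IsBounded O) {h : ℝ → ℝ}
    {C : ℝ} (hC : ∀ x, |h x| ≤ C) (h0 : ∀ x ∉ O, h x = 0) :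
    ∫ x, |h x| ≤ C * (volume O).toReal := by
  have e : ∫ x, |h x| = ∫ x in O, |h x| :=
    (setIntegral_eq_integral_of_forall_compl_eq_zero fun x hx => by simp [h0 x hx]).symm
  rw [e]
  refine (le_abs_self _).trans ?_
  exact norm_setIntegral_le_of_norm_le_const (μ := volume) (f := fun x => |h x|)
    hO.measure_lt_top (fun x _ => by simpa using hC x)

/-- `h` is an `L¹` limit of second derivatives of test functions in `O`. -/
def BendApprox (O : Set ℝ) (h : ℝ → ℝ) : Prop :=
  ∀ δ > 0, ∃ ψ : ℝ → ℝ, IsTestFunction O ψ ∧ ∫ x, |deriv (deriv ψ) x - h x| ≤ δ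

/-- `h` is (a representative of) the second derivative of a function in `W^{2,∞}_0(O)`,
extended by zero. -/
structure IsBend (O : Set ℝ) (h : ℝ → ℝ) : Prop where
  measurable : Measurable h
  bounded : ∃ C : ℝ, ∀ x, |h x| ≤ C
  eq_zero : ∀ x ∉ O, h x = 0
  approx : BendApprox O h

theorem BendApprox.add {O : Set ℝ} {h k : ℝ → ℝ} (hh : BendApprox O h) (hk : BendApprox O k)
    (hi : Integrable h) (ki : Integrable k) : BendApprox O (fun x => h x + k x) := by
  intro δ hδ
  obtain ⟨ψ, hψ, h1⟩ := hh (δ / 2) (half_pos hδ)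
  obtain ⟨θ, hθ, h2⟩ := hk (δ / 2) (half_pos hδ)
  refine ⟨_, hψ.add hθ, ?_⟩
  have e1 : deriv (fun x => ψ x + θ x) = fun x => deriv ψ x + deriv θ x := by
    ext x; exact deriv_fun_add (hψ.differentiable x) (hθ.differentiable x)
  have e2 : deriv (deriv (fun x => ψ x + θ x)) = fun x => deriv (deriv ψ) x + deriv (deriv θ) x := by
    rw [e1]; ext x; exact deriv_fun_add (hψ.deriv.differentiable x) (hθ.deriv.differentiable x)
  rw [e2]
  have i1 := (hψ.deriv.deriv.integrable.sub hi).abs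
  have i2 := (hθ.deriv.deriv.integrable.sub ki).abs
  calc _ ≤ ∫ x, (|deriv (deriv ψ) x - h x| + |deriv (deriv θ) x - k x|) := by
        refine integral_mono_of_nonneg (ae_of_all _ fun _ => abs_nonneg _) (i1.add i2)
          (ae_of_all _ fun x => ?_)
        simp only
        rw [add_sub_add_comm]
        exact abs_add_le _ _
    _ = _ := integral_add i1 i2
    _ ≤ δ := by linarith

theorem BendApprox.const_mul {O : Set ℝ} {h : ℝ → ℝ} (hh : BendApprox O h) (c : ℝ) :
    BendApprox O (fun x => c * h x) := by
  intro δ hδ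
  obtain ⟨ψ, hψ, h1⟩ := hh (δ / (|c| + 1)) (by positivity)
  refine ⟨_, hψ.const_mul c, ?_⟩
  have e1 : deriv (fun x => c * ψ x) = fun x => c * deriv ψ x := by
    ext x; exact deriv_const_mul c (hψ.differentiable x)
  have e2 : deriv (deriv (fun x => c * ψ x)) = fun x => c * deriv (deriv ψ) x := by
    rw [e1]; ext x; exact deriv_const_mul c (hψ.deriv.differentiable x)
  simp only [e2, ← mul_sub, abs_mul]
  rw [integral_const_mul]
  calc |c| * ∫ x, |deriv (deriv ψ) x - h x| ≤ |c| * (δ / (|c| + 1)) := by gcongr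
    _ ≤ (|c| + 1) * (δ / (|c| + 1)) := by gcongr; linarith
    _ = δ := by field_simp

namespace IsBend

variable {O : Set ℝ} {h k : ℝ → ℝ}

theorem integrable (hh : IsBend O h) (hO : Bornology.IsBounded O) : Integrable h :=
  integrable_of_bounded_of_eq_zero_off hO hh.measurable.aestronglyMeasurable
    hh.bounded.choose_spec hh.eq_zero

theorem zero : IsBend O (fun _ => 0) :=
  ⟨measurable_const, ⟨0, by simp⟩, fun _ _ => rfl, fun δ hδ => ⟨_, IsTestFunction.zero, by
    simpa using hδ.le⟩⟩

theorem const_mul (hh : IsBend O h) (c : ℝ) : IsBend O (fun x => c * h x) := by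
  obtain ⟨C, hC⟩ := hh.bounded
  refine ⟨hh.measurable.const_mul c, ⟨|c| * C, fun x => ?_⟩, fun x hx => by simp [hh.eq_zero x hx],
    hh.approx.const_mul c⟩
  rw [abs_mul]; exact mul_le_mul_of_nonneg_left (hC x) (abs_nonneg c)

theorem add (hh : IsBend O h) (hk : IsBend O k) (hO : Bornology.IsBounded O) :
    IsBend O (fun x => h x + k x) := by
  obtain ⟨C, hC⟩ := hh.bounded
  obtain ⟨D, hD⟩ := hk.bounded
  exact ⟨hh.measurable.add hk.measurable, ⟨C + D, fun x => (abs_add_le _ _).trans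
    (add_le_add (hC x) (hD x))⟩, fun x hx => by simp [hh.eq_zero x hx, hk.eq_zero x hx],
    hh.approx.add hk.approx (hh.integrable hO) (hk.integrable hO)⟩

theorem sub (hh : IsBend O h) (hk : IsBend O k) (hO : Bornology.IsBounded O) :
    IsBend O (fun x => h x - k x) := by
  simpa [sub_eq_add_neg] using hh.add (hk.const_mul (-1)) hO

theorem exists_seq (hh : IsBend O h) :
    ∃ ψ : ℕ → ℝ → ℝ, (∀ k, IsTestFunction O (ψ k)) ∧
      Tendsto (fun k => ∫ x, |deriv (deriv (ψ k)) x - h x|) atTop (𝓝 0) := by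
  choose ψ hψ h1 using fun k : ℕ => hh.approx (1 / ((k : ℝ) + 1)) (by positivity)
  exact ⟨ψ, hψ, squeeze_zero (fun k => integral_nonneg fun x => abs_nonneg _) h1
      tendsto_one_div_add_atTop_nhds_zero_nat⟩

/-- Both sides are primitives from -∞, so L¹ closeness of second derivatives gives uniform closeness
of first derivatives. -/
theorem abs_deriv_sub_prim_le (hh : IsBend O h) (hO : Bornology.IsBounded O) {ψ : ℝ → ℝ}
    (hψ : IsTestFunction O ψ) (x : ℝ) :
    |deriv ψ x - prim h x| ≤ ∫ x, |deriv (deriv ψ) x - h x| := by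
  have e : deriv ψ x - prim h x = prim (fun t => deriv (deriv ψ) t - h t) x := by
    rw [prim_sub hψ.deriv.deriv.integrable (hh.integrable hO), hψ.deriv.prim_deriv]
  rw [e]
  exact abs_prim_le (hψ.deriv.deriv.integrable.sub (hh.integrable hO)) x

variable {ψ : ℕ → ℝ → ℝ}

theorem tendsto_deriv (hh : IsBend O h) (hO : Bornology.IsBounded O)
    (hψ : ∀ k, IsTestFunction O (ψ k))
    (t0 : Tendsto (fun k => ∫ x, |deriv (deriv (ψ k)) x - h x|) atTop (𝓝 0)) (x : ℝ) :
    Tendsto (fun k => deriv (ψ k) x) atTop (𝓝 (prim h x)) := by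
  rw [tendsto_iff_norm_sub_tendsto_zero]
  exact squeeze_zero (fun _ => norm_nonneg _) (fun k => hh.abs_deriv_sub_prim_le hO (hψ k) x) t0

/-- This is the boundary condition on the first derivative: a pointwise limit of derivatives of test
functions, all of which vanish off `O`. -/
theorem prim_eq_zero (hh : IsBend O h) (hO : Bornology.IsBounded O) (x : ℝ) (hx : x ∉ O) :
    prim h x = 0 := by
  obtain ⟨ψ, hψ, t0⟩ := hh.exists_seq
  refine tendsto_nhds_unique (hh.tendsto_deriv hO hψ t0 x) ?_
  simp [fun k => (hψ k).deriv.eq_zero hx]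

theorem integrable_prim (hh : IsBend O h) (hO : Bornology.IsBounded O) : Integrable (prim h) :=
  integrable_of_bounded_of_eq_zero_off hO
    (continuous_prim (hh.integrable hO)).aestronglyMeasurable
    (abs_prim_le (hh.integrable hO)) (hh.prim_eq_zero hO)

/-- A Poincaré inequality: the primitive is bounded by the L¹ norm and lives on `O`. -/
theorem integral_abs_prim_le (hh : IsBend O h) (hO : Bornology.IsBounded O) :
    ∫ x, |prim h x| ≤ (∫ x, |h x|) * (volume O).toReal :=
  integral_abs_le_of_eq_zero_off hO (abs_prim_le (hh.integrable hO)) (hh.prim_eq_zero hO)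

theorem tendsto_integral_deriv (hh : IsBend O h) (hO : Bornology.IsBounded O)
    (hψ : ∀ k, IsTestFunction O (ψ k))
    (t0 : Tendsto (fun k => ∫ x, |deriv (deriv (ψ k)) x - h x|) atTop (𝓝 0)) :
    Tendsto (fun k => ∫ x, |deriv (ψ k) x - prim h x|) atTop (𝓝 0) := by
  refine squeeze_zero (fun k => integral_nonneg fun x => abs_nonneg _) (fun k =>
    integral_abs_le_of_eq_zero_off hO (hh.abs_deriv_sub_prim_le hO (hψ k)) fun x hx => ?_)
    (by simpa using t0.mul_const (volume O).toReal)
  rw [(hψ k).deriv.eq_zero hx, hh.prim_eq_zero hO x hx, sub_zero]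

theorem abs_sub_prim_prim_le (hh : IsBend O h) (hO : Bornology.IsBounded O) {ψ : ℝ → ℝ}
    (hψ : IsTestFunction O ψ) (x : ℝ) :
    |ψ x - prim (prim h) x| ≤ ∫ x, |deriv ψ x - prim h x| := by
  have e : ψ x - prim (prim h) x = prim (fun t => deriv ψ t - prim h t) x := by
    rw [prim_sub hψ.deriv.integrable (hh.integrable_prim hO), hψ.prim_deriv]
  rw [e]
  exact abs_prim_le (hψ.deriv.integrable.sub (hh.integrable_prim hO)) x

theorem tendsto (hh : IsBend O h) (hO : Bornology.IsBounded O)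
    (hψ : ∀ k, IsTestFunction O (ψ k))
    (t0 : Tendsto (fun k => ∫ x, |deriv (deriv (ψ k)) x - h x|) atTop (𝓝 0)) (x : ℝ) :
    Tendsto (fun k => ψ k x) atTop (𝓝 (prim (prim h) x)) := by
  rw [tendsto_iff_norm_sub_tendsto_zero]
  exact squeeze_zero (fun _ => norm_nonneg _) (fun k => hh.abs_sub_prim_prim_le hO (hψ k) x)
    (hh.tendsto_integral_deriv hO hψ t0)

theorem prim_prim_eq_zero (hh : IsBend O h) (hO : Bornology.IsBounded O) (x : ℝ) (hx : x ∉ O) :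
    prim (prim h) x = 0 := by
  obtain ⟨ψ, hψ, t0⟩ := hh.exists_seq
  refine tendsto_nhds_unique (hh.tendsto hO hψ t0 x) ?_
  simp [fun k => (hψ k).eq_zero hx]

theorem tendsto_integral (hh : IsBend O h) (hO : Bornology.IsBounded O)
    (hψ : ∀ k, IsTestFunction O (ψ k))
    (t0 : Tendsto (fun k => ∫ x, |deriv (deriv (ψ k)) x - h x|) atTop (𝓝 0)) :
    Tendsto (fun k => ∫ x, |ψ k x - prim (prim h) x|) atTop (𝓝 0) := by
  refine squeeze_zero (fun k => integral_nonneg fun x => abs_nonneg _) (fun k =>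
    integral_abs_le_of_eq_zero_off hO (hh.abs_sub_prim_prim_le hO (hψ k)) fun x hx => ?_)
    (by simpa using (hh.tendsto_integral_deriv hO hψ t0).mul_const (volume O).toReal)
  rw [(hψ k).eq_zero hx, hh.prim_prim_eq_zero hO x hx, sub_zero]

theorem integrable_prim_prim (hh : IsBend O h) (hO : Bornology.IsBounded O) :
    Integrable (prim (prim h)) :=
  integrable_of_bounded_of_eq_zero_off hO
    (continuous_prim (hh.integrable_prim hO)).aestronglyMeasurable
    (abs_prim_le (hh.integrable_prim hO)) (hh.prim_prim_eq_zero hO)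

theorem isWeakDeriv (hh : IsBend O h) (hO : Bornology.IsBounded O) :
    IsWeakDeriv O (prim (prim h)) (prim h) ∧ IsWeakDeriv O (prim h) h := by
  obtain ⟨ψ, hψ, t0⟩ := hh.exists_seq
  have t1 := hh.tendsto_integral_deriv hO hψ t0
  have t2 := hh.tendsto_integral hO hψ t0
  have key : ∀ (ws : ℕ → ℝ → ℝ) (w : ℝ → ℝ), (∀ k, Integrable (ws k)) → Integrable w →
      Tendsto (fun k => ∫ x, |ws k x - w x|) atTop (𝓝 0) →
      Tendsto (fun k => ∫ x in O, |ws k x - w x|) atTop (𝓝 0) := fun ws w hi hw ht =>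
    squeeze_zero (fun k => integral_nonneg fun x => abs_nonneg _)
      (fun k => setIntegral_le_integral ((hi k).sub hw).abs (ae_of_all _ fun _ => abs_nonneg _)) ht
  have s0 := key _ _ (fun k => (hψ k).deriv.deriv.integrable) (hh.integrable hO) t0
  have s1 := key _ _ (fun k => (hψ k).deriv.integrable) (hh.integrable_prim hO) t1
  have s2 := key _ _ (fun k => (hψ k).integrable) (hh.integrable_prim_prim hO) t2
  exact ⟨IsWeakDeriv.of_tendsto (fun k => .of_test (hψ k)) (fun k => (hψ k).integrable.integrableOn)
      (fun k => (hψ k).deriv.integrable.integrableOn) (hh.integrable_prim_prim hO).integrableOn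
      (hh.integrable_prim hO).integrableOn s2 s1,
    IsWeakDeriv.of_tendsto (fun k => .of_test (hψ k).deriv)
      (fun k => (hψ k).deriv.integrable.integrableOn)
      (fun k => (hψ k).deriv.deriv.integrable.integrableOn) (hh.integrable_prim hO).integrableOn
      (hh.integrable hO).integrableOn s1 s0⟩

end IsBend

/-! ### Bends supported in an interval -/

theorem IsTestFunction.sub {O : Set ℝ} {ψ θ : ℝ → ℝ} (h : IsTestFunction O ψ)
    (h' : IsTestFunction O θ) : IsTestFunction O (fun x => ψ x - θ x) := by
  simpa [sub_eq_add_neg] using h.add (h'.const_mul (-1))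

/-- The primitive of a test function of zero mean is a test function. -/
theorem IsTestFunction.prim {α β : ℝ} {θ : ℝ → ℝ} (hθ : IsTestFunction (Icc α β) θ)
    (h0 : ∫ x, θ x = 0) :
    IsTestFunction (Icc α β) (_root_.prim θ) ∧ _root_.deriv (_root_.prim θ) = θ := by
  have hd : ∀ x, HasDerivAt (_root_.prim θ) (θ x) x := hasDerivAt_prim hθ.integrable hθ.continuous
  have hd' : _root_.deriv (_root_.prim θ) = θ := funext fun x => (hd x).deriv
  have hs : ∀ x ∉ Icc α β, _root_.prim θ x = 0 := by
    intro x hx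
    rcases lt_or_ge x α with h | h
    · refine setIntegral_eq_zero_of_forall_eq_zero fun t ht => hθ.eq_zero fun ht' => ?_
      exact absurd (ht'.1.trans ht) (not_le.2 h)
    · have e : _root_.prim θ x = ∫ t, θ t :=
        setIntegral_eq_integral_of_forall_compl_eq_zero fun t ht => hθ.eq_zero fun ht' =>
          hx ⟨h, (not_le.1 (fun h' => ht (show t ≤ x from h'))).le.trans ht'.2⟩
      rw [e, h0]
  have hsub : tsupport (_root_.prim θ) ⊆ Icc α β :=
    closure_minimal (fun x hx => by_contra fun h => hx (hs x h)) isClosed_Icc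
  refine ⟨⟨?_, HasCompactSupport.intro isCompact_Icc hs, hsub⟩, hd'⟩
  rw [contDiff_infty_iff_deriv (𝕜 := ℝ), hd']
  exact ⟨fun x => (hd x).differentiableAt, hθ.1⟩

theorem exists_Icc_subset_of_isOpen {O : Set ℝ} (hO : IsOpen O) {a b : ℝ} (hab : a < b)
    (h : Icc a b ⊆ O) : ∃ δ > 0, Icc (a - δ) (b + δ) ⊆ O := by
  obtain ⟨r, hr, h1⟩ := Metric.isOpen_iff.1 hO a (h (left_mem_Icc.2 hab.le))
  obtain ⟨s, hs, h2⟩ := Metric.isOpen_iff.1 hO b (h (right_mem_Icc.2 hab.le))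
  refine ⟨min r s / 2, by positivity, fun x hx => ?_⟩
  have m1 := min_le_left r s
  have m2 := min_le_right r s
  have m3 : 0 < min r s := lt_min hr hs
  rcases lt_or_ge x a with hxa | hxa
  · refine h1 ?_
    rw [Metric.mem_ball, Real.dist_eq, abs_lt]
    constructor <;> linarith [hx.1]
  rcases lt_or_ge b x with hxb | hxb
  · refine h2 ?_
    rw [Metric.mem_ball, Real.dist_eq, abs_lt]
    constructor <;> linarith [hx.2]
  exact h ⟨hxa, hxb⟩

theorem eLpNorm_one_restrict_eq {O : Set ℝ} {f : ℝ → ℝ} (hf : IntegrableOn f O) :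
    eLpNorm f 1 (volume.restrict O) = ENNReal.ofReal (∫ x in O, |f x|) := by
  rw [eLpNorm_one_eq_lintegral_enorm, ← ofReal_integral_norm_eq_lintegral_enorm hf]
  rfl

theorem exists_smooth_cutoff {O : Set ℝ} (hO : IsOpen O) {a b : ℝ} (hab : a < b)
    (h : Icc a b ⊆ O) : ∃ (α β : ℝ) (f ρ : ℝ → ℝ), Icc α β ⊆ O ∧ Icc a b ⊆ Icc α β ∧
      IsTestFunction (Icc α β) f ∧ (∀ x, |f x| ≤ 1) ∧ (∀ x ∈ Icc a b, f x = 1) ∧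
      IsTestFunction (Icc α β) ρ ∧ ∫ x, ρ x = 1 ∧ ∫ x, |ρ x| = 1 := by
  obtain ⟨δ, hδ, hsub⟩ := exists_Icc_subset_of_isOpen hO hab h
  let f : ContDiffBump ((a + b) / 2 : ℝ) :=
    ⟨(b - a) / 2, (b - a) / 2 + δ, by linarith, by linarith⟩
  have hK : Metric.closedBall ((a + b) / 2) ((b - a) / 2 + δ) = Icc (a - δ) (b + δ) := by
    rw [Real.closedBall_eq_Icc]; congr 1 <;> ring
  have hK' : Metric.closedBall ((a + b) / 2) ((b - a) / 2) = Icc a b := by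
    rw [Real.closedBall_eq_Icc]; congr 1 <;> ring
  refine ⟨a - δ, b + δ, f, f.normed volume, hsub, Icc_subset_Icc (by linarith) (by linarith),
    ⟨f.contDiff, f.hasCompactSupport, ?_⟩, fun x => ?_, fun x hx => ?_,
    ⟨f.contDiff_normed, f.hasCompactSupport_normed, ?_⟩, f.integral_normed, ?_⟩
  · rw [f.tsupport_eq, ← hK]
  · rw [abs_of_nonneg f.nonneg]; exact f.le_one
  · exact f.one_of_mem_closedBall (by rw [← hK'] at hx; exact hx)
  · rw [f.tsupport_normed_eq, ← hK]
  · simp_rw [abs_of_nonneg (f.nonneg_normed _)]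
    exact f.integral_normed

/-- The hypotheses on the primitives say that `k` has zero mean and that so does its primitive. A
smooth L¹ approximation of `k` almost satisfies both conditions; subtracting a small multiple of a
fixed bump `ρ` before each of the two integrations restores them exactly, so the double primitive is
a test function. -/
theorem isBend_of_Ioo {O : Set ℝ} (hO : IsOpen O) {a b : ℝ} (hab : a < b)
    (h : Icc a b ⊆ O) {k : ℝ → ℝ} (hk : Measurable k) (hb : ∃ C : ℝ, ∀ x, |k x| ≤ C)
    (k0 : ∀ x ∉ Ioo a b, k x = 0) (k1 : ∀ x ∉ Ioo a b, prim k x = 0)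
    (k2 : prim (prim k) b = 0) : IsBend O k := by
  refine ⟨hk, hb, fun x hx => k0 x fun hx' => hx (h (Ioo_subset_Icc_self hx')), ?_⟩
  obtain ⟨α, β, f, ρ, hsub, habs, hf, hf1, hf2, hρ, hρ1, hρ2⟩ := exists_smooth_cutoff hO hab h
  have ki : Integrable k := integrable_of_bounded_of_eq_zero_off (Metric.isBounded_Ioo a b)
    hk.aestronglyMeasurable hb.choose_spec k0
  have pi : Integrable (prim k) := integrable_of_bounded_of_eq_zero_off (Metric.isBounded_Ioo a b)
    (continuous_prim ki).aestronglyMeasurable (abs_prim_le ki) k1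
  have ik : ∫ x, k x = 0 := by
    rw [← k1 b (by simp)]
    exact (setIntegral_eq_integral_of_forall_compl_eq_zero fun t ht =>
      k0 t fun ht' => ht ht'.2.le).symm
  have ip : ∫ x, prim k x = 0 := by
    rw [← k2]
    exact (setIntegral_eq_integral_of_forall_compl_eq_zero fun t ht =>
      k1 t fun ht' => ht ht'.2.le).symm
  set L : ℝ := (volume (Icc α β)).toReal
  set R : ℝ := ∫ x, |deriv ρ x|
  have hR : 0 ≤ R := integral_nonneg fun _ => abs_nonneg _
  have hL : 0 ≤ L := ENNReal.toReal_nonneg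
  intro δ hδ
  -- Restoring the first mean costs at most `2 * η` in L¹, restoring the second at most `2 * η * L *
  -- R`; the two add up to `δ`.
  set η : ℝ := δ / (2 + 2 * L * R) with hη
  have hη0 : 0 < η := by positivity
  obtain ⟨g, hg1, hg2, hg3⟩ := MemLp.exist_eLpNorm_sub_le (p := 1) (by simp) le_rfl
    (memLp_one_iff_integrable.2 ki) hη0
  have gi : Integrable g := hg2.continuous.integrable_of_hasCompactSupport hg1
  have hgk : ∫ x, |g x - k x| ≤ η := by
    have := eLpNorm_one_restrict_eq (O := univ) (f := k - g) (ki.sub gi).integrableOn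
    rw [Measure.restrict_univ] at this
    rw [this, ENNReal.ofReal_le_ofReal_iff hη0.le] at hg3
    refine le_trans (le_of_eq ?_) hg3
    refine integral_congr_ae (ae_of_all _ fun x => ?_)
    simp [abs_sub_comm]
  -- The cutoff is 1 where `k` lives and at most 1 elsewhere, so it confines the support without
  -- increasing the L¹ error.
  let θ : ℝ → ℝ := fun x => f x * g x
  have hθ : IsTestFunction (Icc α β) θ :=
    ⟨hf.1.mul hg2, hf.2.1.mul_right, (tsupport_mul_subset_left (f := f)).trans hf.2.2⟩
  have hθk : ∫ x, |θ x - k x| ≤ η := by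
    refine le_trans (integral_mono_of_nonneg (ae_of_all _ fun _ => abs_nonneg _) (gi.sub ki).abs
      (ae_of_all _ fun x => ?_)) hgk
    have e : θ x - k x = f x * (g x - k x) := by
      by_cases hx : x ∈ Ioo a b
      · simp [θ, hf2 x (Ioo_subset_Icc_self hx)]
      · simp [θ, k0 x hx]
    simp only [e, abs_mul]
    exact (mul_le_mul_of_nonneg_right (hf1 x) (abs_nonneg _)).trans (by simp)
  set m₀ : ℝ := ∫ x, θ x with hm₀
  have bm : |m₀| ≤ η := by
    have e : m₀ = ∫ x, (θ x - k x) := by rw [integral_sub hθ.integrable ki, ik, sub_zero]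
    rw [e]
    exact (abs_integral_le_integral_abs).trans hθk
  have hθ' := hθ.sub (hρ.const_mul m₀)
  obtain ⟨hp, hpd⟩ := hθ'.prim (by
    rw [integral_sub hθ.integrable (hρ.integrable.const_mul _), integral_const_mul, hρ1]
    simp [m₀])
  set p := prim fun x => θ x - m₀ * ρ x with hp_def
  have b1 : ∫ x, |θ x - m₀ * ρ x - k x| ≤ 2 * η := by
    have i1 := (hθ.integrable.sub ki).abs
    have i2 := (hρ.integrable.abs).const_mul |m₀|
    calc _ ≤ ∫ x, (|θ x - k x| + |m₀| * |ρ x|) := by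
          refine integral_mono_of_nonneg (ae_of_all _ fun _ => abs_nonneg _) (i1.add i2)
            (ae_of_all _ fun x => ?_)
          simp only
          rw [← abs_mul, sub_right_comm]
          exact abs_sub _ _
      _ = _ := integral_add i1 i2
      _ ≤ 2 * η := by rw [integral_const_mul, hρ2]; linarith
  have b2 : ∀ x, |p x - prim k x| ≤ 2 * η := fun x => by
    rw [hp_def, ← prim_sub hθ'.integrable ki]
    exact (abs_prim_le (hθ'.integrable.sub ki) x).trans b1
  set n : ℝ := ∫ x, p x with hn
  have bn : |n| ≤ 2 * η * L := by
    have e : n = ∫ x, (p x - prim k x) := by rw [integral_sub hp.integrable pi, ip, sub_zero]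
    rw [e]
    refine (abs_integral_le_integral_abs).trans
      (integral_abs_le_of_eq_zero_off (Metric.isBounded_Icc α β) b2 fun x hx => ?_)
    rw [hp.eq_zero hx, k1 x fun hx' => hx (habs (Ioo_subset_Icc_self hx')), sub_zero]
  have hp' := hp.sub (hρ.const_mul n)
  obtain ⟨hq, hqd⟩ := hp'.prim (by
    rw [integral_sub hp.integrable (hρ.integrable.const_mul _), integral_const_mul, hρ1]
    simp [n])
  refine ⟨_, hq.mono hsub, ?_⟩
  have e2 : deriv (fun x => p x - n * ρ x) = fun x => (θ x - m₀ * ρ x) - n * deriv ρ x := by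
    ext x
    rw [deriv_fun_sub (hp.differentiable x) ((hρ.const_mul n).differentiable x),
      deriv_const_mul _ (hρ.differentiable x), hpd]
  rw [hqd, e2]
  have i1 := (hθ'.integrable.sub ki).abs
  have i2 := (hρ.deriv.integrable.abs).const_mul |n|
  calc _ ≤ ∫ x, (|θ x - m₀ * ρ x - k x| + |n| * |deriv ρ x|) := by
        refine integral_mono_of_nonneg (ae_of_all _ fun _ => abs_nonneg _) (i1.add i2)
          (ae_of_all _ fun x => ?_)
        simp only
        rw [← abs_mul, sub_right_comm]
        exact abs_sub _ _
    _ = _ := integral_add i1 i2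
    _ ≤ 2 * η + 2 * η * L * R := by
        rw [integral_const_mul]
        exact add_le_add b1 (mul_le_mul_of_nonneg_right bn hR)
    _ = δ := by rw [hη]; field_simp

/-! ### Bounded representatives and the characterisation of `W^{2,∞}_0` -/

theorem exists_bounded_rep {O : Set ℝ} (hO : MeasurableSet O) {u : ℝ → ℝ}
    (hu : MemLp u ∞ (volume.restrict O)) : ∃ v : ℝ → ℝ, Measurable v ∧ (∃ C : ℝ, ∀ x, |v x| ≤ C) ∧
      (∀ x ∉ O, v x = 0) ∧ u =ᵐ[volume.restrict O] v := by
  obtain ⟨w, hw, huw⟩ := hu.1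
  set C : ℝ := (eLpNorm u ∞ (volume.restrict O)).toReal
  have hC : 0 ≤ C := ENNReal.toReal_nonneg
  have hb : ∀ᵐ x ∂(volume.restrict O), |u x| ≤ C := by
    have h1 := enorm_ae_le_eLpNormEssSup u (volume.restrict O)
    filter_upwards [h1] with x hx
    rw [← eLpNorm_exponent_top] at hx
    have := ENNReal.toReal_mono hu.2.ne hx
    rwa [toReal_enorm, Real.norm_eq_abs] at this
  refine ⟨O.indicator fun x => max (-C) (min C (w x)),
    (measurable_const.max (measurable_const.min hw.measurable)).indicator hO, ⟨C, fun x => ?_⟩,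
    fun x hx => indicator_of_notMem hx _, ?_⟩
  · by_cases hx : x ∈ O
    · rw [indicator_of_mem hx, abs_le]
      exact ⟨le_max_left _ _, max_le (by linarith) (min_le_left _ _)⟩
    · rw [indicator_of_notMem hx]; simpa using hC
  · filter_upwards [huw, hb, ae_restrict_mem hO] with x h1 h2 hx
    rw [indicator_of_mem hx, ← h1, min_eq_right (le_of_abs_le h2), max_eq_right (neg_le_of_abs_le h2)]

theorem ae_eq_of_tendsto_eLpNorm {O : Set ℝ} {F : ℕ → ℝ → ℝ} {G K : ℝ → ℝ}
    (hF : ∀ k, Continuous (F k)) (hG : AEStronglyMeasurable G (volume.restrict O))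
    (hFG : Tendsto (fun k => eLpNorm (fun x => F k x - G x) 1 (volume.restrict O)) atTop (𝓝 0))
    (hFK : ∀ x, Tendsto (fun k => F k x) atTop (𝓝 (K x))) : G =ᵐ[volume.restrict O] K := by
  obtain ⟨ns, hns, h⟩ := (tendstoInMeasure_of_tendsto_eLpNorm one_ne_zero
    (fun k => (hF k).aestronglyMeasurable) hG hFG).exists_seq_tendsto_ae
  filter_upwards [h] with x hx
  exact tendsto_nhds_unique hx ((hFK x).comp hns.tendsto_atTop)

theorem memLp_of_bounded {O : Set ℝ} (hOb : Bornology.IsBounded O) (q : ℝ≥0∞) {u : ℝ → ℝ}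
    (hm : AEStronglyMeasurable u (volume.restrict O)) {C : ℝ} (hC : ∀ x, |u x| ≤ C) :
    MemLp u q (volume.restrict O) := by
  have : IsFiniteMeasure (volume.restrict O) := ⟨by simpa using hOb.measure_lt_top⟩
  exact MemLp.of_bound hm C (ae_of_all _ hC)

theorem IsBend.memLp {O : Set ℝ} (hOb : Bornology.IsBounded O) {h : ℝ → ℝ} (hh : IsBend O h)
    (q : ℝ≥0∞) : MemLp (prim (prim h)) q (volume.restrict O) ∧
      MemLp (prim h) q (volume.restrict O) ∧ MemLp h q (volume.restrict O) :=
  ⟨memLp_of_bounded hOb q (hh.integrable_prim_prim hOb).aestronglyMeasurable.restrict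
      (abs_prim_le (hh.integrable_prim hOb)),
    memLp_of_bounded hOb q (hh.integrable_prim hOb).aestronglyMeasurable.restrict
      (abs_prim_le (hh.integrable hOb)),
    memLp_of_bounded hOb q hh.measurable.aestronglyMeasurable hh.bounded.choose_spec⟩

theorem IsBend.memW2InftyZero {O : Set ℝ} (hO : IsOpen O) (hOb : Bornology.IsBounded O)
    {h φ : ℝ → ℝ} (hh : IsBend O h) (hφ : φ =ᵐ[volume.restrict O] prim (prim h)) :
    MemW2InftyZero O φ := by
  obtain ⟨w1, w2⟩ := hh.isWeakDeriv hOb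
  have w1' : IsWeakDeriv O φ (prim h) := w1.congr hφ.symm (ae_eq_refl _)
  obtain ⟨m0, m1, m2⟩ := hh.memLp hOb ∞
  refine ⟨⟨_, _, w1', w2, (memLp_congr_ae hφ).2 m0, m1, m2⟩, ?_⟩
  obtain ⟨ψ, hψ, t0⟩ := hh.exists_seq
  have key : ∀ (F : ℕ → ℝ → ℝ) (G K : ℝ → ℝ), (∀ k, Integrable (F k)) → Integrable G →
      K =ᵐ[volume.restrict O] G →
      Tendsto (fun k => ∫ x, |F k x - G x|) atTop (𝓝 0) →
      Tendsto (fun k => eLpNorm (fun x => F k x - K x) 1 (volume.restrict O)) atTop (𝓝 0) := by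
    intro F G K hF hG hKG ht
    have e : ∀ k, eLpNorm (fun x => F k x - K x) 1 (volume.restrict O)
        = ENNReal.ofReal (∫ x in O, |F k x - G x|) := fun k => by
      rw [← eLpNorm_one_restrict_eq (f := fun x => F k x - G x) ((hF k).sub hG).integrableOn]
      exact eLpNorm_congr_ae (by filter_upwards [hKG] with x hx; rw [hx])
    simp_rw [e]
    rw [← ENNReal.ofReal_zero]
    refine ENNReal.tendsto_ofReal (squeeze_zero (fun k => integral_nonneg fun x => abs_nonneg _)
      (fun k => setIntegral_le_integral ((hF k).sub hG).abs (ae_of_all _ fun _ => abs_nonneg _)) ht)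
  exact ⟨ψ, hψ,
    key _ _ _ (fun k => (hψ k).integrable) (hh.integrable_prim_prim hOb) hφ
      (hh.tendsto_integral hOb hψ t0),
    key _ _ _ (fun k => (hψ k).deriv.integrable) (hh.integrable_prim hOb)
      (w1'.weakDeriv_ae_eq hO) (hh.tendsto_integral_deriv hOb hψ t0),
    key _ _ _ (fun k => (hψ k).deriv.deriv.integrable) (hh.integrable hOb)
      (w1'.weakDeriv2_ae_eq hO w2) t0⟩

/-- Take for `h` a bounded representative of the second derivative. L¹ convergence of the second
derivatives alone forces the test functions to converge pointwise to the double primitive of `h`,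
while they also converge to `φ` in L¹. -/
theorem MemW2InftyZero.exists_isBend {O : Set ℝ} (hO : IsOpen O) (hOb : Bornology.IsBounded O)
    {φ : ℝ → ℝ} (hφ : MemW2InftyZero O φ) :
    ∃ h, IsBend O h ∧ φ =ᵐ[volume.restrict O] prim (prim h) := by
  obtain ⟨⟨u₁, u₂, w1, w2, m0, m1, m2⟩, ψ, hψ, t0, -, t2⟩ := hφ
  obtain ⟨v, vm, vb, v0, hv⟩ := exists_bounded_rep hO.measurableSet m2
  have e2 := (w1.weakDeriv2_ae_eq hO w2).trans hv
  have vi : Integrable v :=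
    integrable_of_bounded_of_eq_zero_off hOb vm.aestronglyMeasurable vb.choose_spec v0
  have s2 : Tendsto (fun k => ∫ x, |deriv (deriv (ψ k)) x - v x|) atTop (𝓝 0) := by
    have e : ∀ k, ∫ x, |deriv (deriv (ψ k)) x - v x| = (eLpNorm (fun x => deriv (deriv (ψ k)) x -
        weakDeriv2 O φ x) 1 (volume.restrict O)).toReal := fun k => by
      have e3 : eLpNorm (fun x => deriv (deriv (ψ k)) x - weakDeriv2 O φ x) 1 (volume.restrict O)
          = eLpNorm (fun x => deriv (deriv (ψ k)) x - v x) 1 (volume.restrict O) :=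
        eLpNorm_congr_ae (by filter_upwards [e2] with x hx; rw [hx])
      rw [e3, eLpNorm_one_restrict_eq (f := fun x => deriv (deriv (ψ k)) x - v x) ((hψ k).deriv.deriv.integrable.sub vi).integrableOn,
        ENNReal.toReal_ofReal (integral_nonneg fun _ => abs_nonneg _)]
      refine (setIntegral_eq_integral_of_forall_compl_eq_zero fun x hx => ?_).symm
      simp [(hψ k).deriv.deriv.eq_zero hx, v0 x hx]
    simp_rw [e]
    have := (ENNReal.tendsto_toReal ENNReal.zero_ne_top).comp t2
    rwa [ENNReal.toReal_zero] at this
  have hb : IsBend O v := ⟨vm, vb, v0, fun δ hδ => by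
    obtain ⟨k, hk⟩ := (s2.eventually (gt_mem_nhds hδ)).exists
    exact ⟨ψ k, hψ k, hk.le⟩⟩
  exact ⟨v, hb, ae_eq_of_tendsto_eLpNorm (fun k => (hψ k).continuous) m0.1 t0
      (hb.tendsto hOb hψ s2)⟩

/-- From here on, competitors are handled through `h` alone, with everywhere defined, continuous
lower-order derivatives. -/
theorem memW2InftyZero_iff {O : Set ℝ} (hO : IsOpen O) (hOb : Bornology.IsBounded O) {φ : ℝ → ℝ} :
    MemW2InftyZero O φ ↔ ∃ h, IsBend O h ∧ φ =ᵐ[volume.restrict O] prim (prim h) :=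
  ⟨fun h => h.exists_isBend hO hOb, fun ⟨_, hh, hφ⟩ => hh.memW2InftyZero hO hOb hφ⟩

/-! ### Weak convergence and level-convex functions -/

/-- The hypothesis `hup` says that `v` is at most the upper limit of `X`; rational bounds and
integer tails keep the conditions countable, so that they can later hold simultaneously almost
everywhere. Terms above `v - 1/(n+1)` occur infinitely often, and compactness extracts a cluster
point from them. -/
theorem exists_cluster_ge {S : Set ℝ} {X : ℕ → ℝ} {C : ℝ} (hX : ∀ᶠ j in atTop, |X j| ≤ C)
    (hcl : ∀ κ : ℕ → ℕ, StrictMono κ → ∀ y, Tendsto (fun j => X (κ j)) atTop (𝓝 y) → y ∈ S)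
    {v : ℝ} (hup : ∀ (r : ℚ) (N : ℕ), (∀ j ≥ N, X j ≤ r) → v ≤ r) : ∃ s ∈ S, v ≤ s := by
  have h1 : ∀ n : ℕ, ∃ᶠ j in atTop, v - 1 / ((n : ℝ) + 1) < X j ∧ |X j| ≤ C := by
    intro n
    refine Frequently.and_eventually ?_ hX
    intro hn
    obtain ⟨r, hr1, hr2⟩ := exists_rat_btwn (sub_lt_self v (show 0 < 1 / ((n : ℝ) + 1) by positivity))
    obtain ⟨N, hN⟩ := eventually_atTop.1 hn
    exact absurd (hup r N fun j hj => (not_lt.1 (hN j hj)).trans hr1.le) (not_le.2 hr2)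
  obtain ⟨κ, hκ, h2⟩ := extraction_forall_of_frequently h1
  obtain ⟨y, -, τ, hτ, hy⟩ := (isCompact_Icc (a := -C) (b := C)).tendsto_subseq
    (fun n => abs_le.1 (h2 n).2)
  refine ⟨y, hcl (κ ∘ τ) (hκ.comp hτ) y hy, ?_⟩
  have h3 : Tendsto (fun n : ℕ => v - 1 / (((τ n : ℕ) : ℝ) + 1)) atTop (𝓝 (v - 0)) :=
    (tendsto_one_div_add_atTop_nhds_zero_nat.comp hτ.tendsto_atTop).const_sub v
  rw [sub_zero] at h3
  exact le_of_tendsto_of_tendsto' h3 hy fun n => (h2 (τ n)).1.le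

/-- There are cluster points on either side of `v`, and a convex subset of the line contains
everything between two of its points. This replaces Mazur's lemma by a pointwise argument available
for a scalar second derivative. -/
theorem mem_of_cluster {S : Set ℝ} (hS : Convex ℝ S) {X : ℕ → ℝ} {C : ℝ}
    (hX : ∀ᶠ j in atTop, |X j| ≤ C)
    (hcl : ∀ κ : ℕ → ℕ, StrictMono κ → ∀ y, Tendsto (fun j => X (κ j)) atTop (𝓝 y) → y ∈ S)
    {v : ℝ} (hlow : ∀ (r : ℚ) (N : ℕ), (∀ j ≥ N, (r : ℝ) ≤ X j) → (r : ℝ) ≤ v)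
    (hup : ∀ (r : ℚ) (N : ℕ), (∀ j ≥ N, X j ≤ r) → v ≤ r) : v ∈ S := by
  obtain ⟨s, hs, hvs⟩ := exists_cluster_ge hX hcl hup
  obtain ⟨t, ht, hvt⟩ := exists_cluster_ge (S := {y | -y ∈ S}) (X := fun j => -X j) (C := C)
    (v := -v) (by simpa using hX) (fun κ hκ y hy => hcl κ hκ (-y) (by simpa using hy.neg))
    (fun r N h => by
      have := hlow (-r) N fun j hj => by push_cast; linarith [h j hj]
      push_cast at this; linarith)
  exact hS.ordConnected.out ht hs ⟨by linarith, hvs⟩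

/-- On the set where the whole tail is at least `r`, every integral of `Y` is a limit of integrals
at least `r` times the measure. Only countably many pairs (r, N) occur. -/
theorem ae_lower_of_tendsto_setIntegral {O : Set ℝ} (hO : MeasurableSet O) (hOb : volume O < ⊤)
    {X : ℕ → ℝ → ℝ} {Y : ℝ → ℝ} (hX : ∀ j, Measurable (X j)) (hXi : ∀ j, IntegrableOn (X j) O)
    (hY : IntegrableOn Y O)
    (h : ∀ A ⊆ O, MeasurableSet A → Tendsto (fun j => ∫ x in A, X j x) atTop (𝓝 (∫ x in A, Y x))) :
    ∀ᵐ x ∂(volume.restrict O), ∀ (r : ℚ) (N : ℕ), (∀ j ≥ N, (r : ℝ) ≤ X j x) → (r : ℝ) ≤ Y x := by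
  rw [ae_all_iff]; intro r
  rw [ae_all_iff]; intro N
  set B : Set ℝ := {x | ∀ j ≥ N, (r : ℝ) ≤ X j x} with hB
  have hBm : MeasurableSet B := by
    have : B = ⋂ j, ⋂ (_ : j ≥ N), {x | (r : ℝ) ≤ X j x} := by ext x; simp [hB]
    rw [this]
    exact .iInter fun j => .iInter fun _ => measurableSet_le measurable_const (hX j)
  have : IsFiniteMeasure (volume.restrict (B ∩ O)) :=
    ⟨by simpa using (measure_mono inter_subset_right).trans_lt hOb⟩
  have key : (fun _ => (r : ℝ)) ≤ᵐ[volume.restrict (B ∩ O)] Y := by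
    refine ae_le_of_forall_setIntegral_le (integrable_const _)
      (hY.mono_set inter_subset_right) fun A hA _ => ?_
    rw [Measure.restrict_restrict hA]
    have hAO : A ∩ (B ∩ O) ⊆ O := fun x hx => hx.2.2
    have hAm : MeasurableSet (A ∩ (B ∩ O)) := hA.inter (hBm.inter hO)
    refine ge_of_tendsto (h _ hAO hAm) ?_
    filter_upwards [eventually_ge_atTop N] with j hj
    refine setIntegral_mono_on ?_ ((hXi j).mono_set hAO) hAm fun x hx => hx.2.1 j hj
    exact integrableOn_const ((measure_mono hAO).trans_lt hOb).ne
  rw [← Measure.restrict_restrict hBm, EventuallyLE, ae_restrict_iff' hBm] at key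
  exact key

theorem ae_upper_of_tendsto_setIntegral {O : Set ℝ} (hO : MeasurableSet O) (hOb : volume O < ⊤)
    {X : ℕ → ℝ → ℝ} {Y : ℝ → ℝ} (hX : ∀ j, Measurable (X j)) (hXi : ∀ j, IntegrableOn (X j) O)
    (hY : IntegrableOn Y O)
    (h : ∀ A ⊆ O, MeasurableSet A → Tendsto (fun j => ∫ x in A, X j x) atTop (𝓝 (∫ x in A, Y x))) :
    ∀ᵐ x ∂(volume.restrict O), ∀ (r : ℚ) (N : ℕ), (∀ j ≥ N, X j x ≤ (r : ℝ)) → Y x ≤ (r : ℝ) := by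
  have := ae_lower_of_tendsto_setIntegral hO hOb (X := fun j x => -X j x) (Y := fun x => -Y x)
    (fun j => (hX j).neg) (fun j => (hXi j).neg) hY.neg
    (fun A hA hAm => by simpa only [integral_neg] using (h A hA hAm).neg)
  filter_upwards [this] with x hx r N hr
  have := hx (-r) N fun j hj => by push_cast; linarith [hr j hj]
  push_cast at this; linarith

/-- Lower semicontinuity of the supremal functional under weak convergence of the top order
argument and pointwise convergence of the others. -/
theorem ae_le_of_weak_convergence {H : ℝ → ℝ → ℝ → ℝ → ℝ} {O : Set ℝ} (hO : MeasurableSet O)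
    (hOb : volume O < ⊤)
    (hcont : ∀ x ∈ O, Continuous fun z : ℝ × ℝ × ℝ => H x z.1 z.2.1 z.2.2)
    (hlevel : ∀ x ∈ O, ∀ η P c : ℝ, Convex ℝ {X : ℝ | H x η P X ≤ c})
    {U P X : ℕ → ℝ → ℝ} {U' P' Y : ℝ → ℝ} {c C₁ B : ℝ} (hC₁ : 0 < C₁)
    (hU : ∀ᵐ x ∂(volume.restrict O), Tendsto (fun j => U j x) atTop (𝓝 (U' x)))
    (hP : ∀ᵐ x ∂(volume.restrict O), Tendsto (fun j => P j x) atTop (𝓝 (P' x)))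
    (hX : ∀ j, Measurable (X j)) (hXi : ∀ j, IntegrableOn (X j) O) (hY : IntegrableOn Y O)
    (h : ∀ A ⊆ O, MeasurableSet A → Tendsto (fun j => ∫ x in A, X j x) atTop (𝓝 (∫ x in A, Y x)))
    (hcoer : ∀ᵐ x ∂(volume.restrict O), ∀ᶠ j in atTop,
      C₁ * |X j x| ≤ H x (U j x) (P j x) (X j x) + B)
    (hmeas : ∀ c' > c, Tendsto (fun j => volume {x ∈ O | c' < H x (U j x) (P j x) (X j x)})
      atTop (𝓝 0)) :
    ∀ᵐ x ∂(volume.restrict O), H x (U' x) (P' x) (Y x) ≤ c ∧ C₁ * |Y x| ≤ c + B := by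
  have key : ∀ n : ℕ, ∀ᵐ x ∂(volume.restrict O), H x (U' x) (P' x) (Y x) ≤ c + 1 / ((n : ℝ) + 1) ∧
      C₁ * |Y x| ≤ c + 1 / ((n : ℝ) + 1) + B := by
    intro n
    set c' : ℝ := c + 1 / ((n : ℝ) + 1) with hc'
    have hcc' : c < c' := by rw [hc']; linarith [show 0 < 1 / ((n : ℝ) + 1) by positivity]
    -- Along a subsequence the bad sets have summable measure, so by Borel-Cantelli almost every
    -- point leaves them for good.
    have hev : ∀ k : ℕ, ∀ᶠ j in atTop,
        volume {x ∈ O | c' < H x (U j x) (P j x) (X j x)} < (2⁻¹ : ℝ≥0∞) ^ k := fun k =>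
      (hmeas c' hcc').eventually (gt_mem_nhds (ENNReal.pow_pos (by simp) k))
    obtain ⟨κ, hκ, hsmall⟩ := extraction_forall_of_eventually hev
    have hae := ae_eventually_notMem (μ := volume)
      (s := fun k => {x ∈ O | c' < H x (U (κ k) x) (P (κ k) x) (X (κ k) x)})
      (ne_top_of_le_ne_top (b := ∑' k : ℕ, (2⁻¹ : ℝ≥0∞) ^ k) (by simp)
        (ENNReal.tsum_le_tsum fun k => (hsmall k).le))
    have hA : ∀ A ⊆ O, MeasurableSet A →
        Tendsto (fun j => ∫ x in A, X (κ j) x) atTop (𝓝 (∫ x in A, Y x)) :=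
      fun A hA hAm => (h A hA hAm).comp hκ.tendsto_atTop
    filter_upwards [ae_restrict_of_ae hae, ae_restrict_mem hO, hU, hP, hcoer,
      ae_lower_of_tendsto_setIntegral hO hOb (fun j => hX (κ j)) (fun j => hXi (κ j)) hY hA,
      ae_upper_of_tendsto_setIntegral hO hOb (fun j => hX (κ j)) (fun j => hXi (κ j)) hY hA]
      with x h1 hxO hUx hPx hcx hlo hup
    have h1' : ∀ᶠ k in atTop, H x (U (κ k) x) (P (κ k) x) (X (κ k) x) ≤ c' := by
      filter_upwards [h1] with k hk
      exact not_lt.1 fun h' => hk ⟨hxO, h'⟩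
    have h2 : ∀ᶠ k in atTop, C₁ * |X (κ k) x| ≤ c' + B := by
      filter_upwards [h1', hκ.tendsto_atTop.eventually hcx] with k hk hk'
      linarith
    -- Intersecting with the coercivity ball carries the bound on `Y` through the same cluster point
    -- argument.
    have hconv : Convex ℝ ({y : ℝ | H x (U' x) (P' x) y ≤ c'} ∩ {y : ℝ | C₁ * |y| ≤ c' + B}) := by
      refine (hlevel x hxO _ _ _).inter ?_
      have : {y : ℝ | C₁ * |y| ≤ c' + B} = Icc (-((c' + B) / C₁)) ((c' + B) / C₁) := by
        ext y
        rw [mem_Icc, ← abs_le, mem_ofPred_eq, le_div_iff₀' hC₁]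
      rw [this]
      exact convex_Icc _ _
    refine mem_of_cluster hconv (X := fun k => X (κ k) x) (C := (c' + B) / C₁) ?_ ?_ hlo hup
    · filter_upwards [h2] with k hk
      rwa [le_div_iff₀' hC₁]
    · intro τ hτ y hy
      have hκτ : Tendsto (fun j => κ (τ j)) atTop atTop := (hκ.comp hτ).tendsto_atTop
      refine ⟨?_, ?_⟩
      · have hlim := ((hcont x hxO).tendsto (U' x, P' x, y)).comp
          ((hUx.comp hκτ).prodMk_nhds ((hPx.comp hκτ).prodMk_nhds hy))
        exact le_of_tendsto hlim (hτ.tendsto_atTop.eventually h1')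
      · exact le_of_tendsto ((hy.abs).const_mul C₁) (hτ.tendsto_atTop.eventually h2)
  filter_upwards [ae_all_iff.2 key] with x hx
  have h3 : Tendsto (fun n : ℕ => c + 1 / ((n : ℝ) + 1)) atTop (𝓝 (c + 0)) :=
    tendsto_one_div_add_atTop_nhds_zero_nat.const_add c
  rw [add_zero] at h3
  exact ⟨ge_of_tendsto' h3 fun n => (hx n).1, ge_of_tendsto' (h3.add_const B) fun n => (hx n).2⟩

/-! ### Weak compactness and weak closedness in `L²` -/

/-- Sequential Banach-Alaoglu in the dual of a separable space, transported by the Riesz isometry.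
-/
theorem exists_weakly_convergent_subseq {E : Type*} [NormedAddCommGroup E] [InnerProductSpace ℝ E]
    [CompleteSpace E] [TopologicalSpace.SeparableSpace E] {x : ℕ → E} {C : ℝ}
    (hx : ∀ j, ‖x j‖ ≤ C) : ∃ (a : E) (κ : ℕ → ℕ), StrictMono κ ∧
      ∀ y, Tendsto (fun j => inner ℝ (x (κ j)) y) atTop (𝓝 (inner ℝ a y)) := by
  let L : ℕ → WeakDual ℝ E := fun j =>
    StrongDual.toWeakDual (InnerProductSpace.toDual ℝ E (x j))
  have hL : ∀ j, L j ∈ WeakDual.toStrongDual ⁻¹' Metric.closedBall (0 : StrongDual ℝ E) C := by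
    intro j
    rw [mem_preimage, mem_closedBall_zero_iff]
    exact ((InnerProductSpace.toDual ℝ E).norm_map (x j)).le.trans (hx j)
  obtain ⟨l, -, κ, hκ, hl⟩ := WeakDual.isSeqCompact_closedBall ℝ E 0 C hL
  refine ⟨(InnerProductSpace.toDual ℝ E).symm (WeakDual.toStrongDual l), κ, hκ, fun y => ?_⟩
  have h1 := ((WeakDual.eval_continuous (𝕜 := ℝ) y).tendsto l).comp hl
  rw [InnerProductSpace.toDual_symm_apply]
  exact h1

section L2

variable {μ : Measure ℝ}

theorem inner_toLp {f g : ℝ → ℝ} (hf : MemLp f 2 μ) (hg : MemLp g 2 μ) :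
    inner ℝ (hf.toLp f) (hg.toLp g) = ∫ x, f x * g x ∂μ := by
  rw [L2.inner_def]
  refine integral_congr_ae ?_
  filter_upwards [hf.coeFn_toLp, hg.coeFn_toLp] with x h1 h2
  rw [h1, h2, real_inner_eq_re_inner]
  simp [mul_comm]

theorem exists_weak_subseq_L2 [SFinite μ] {f : ℕ → ℝ → ℝ} (hf : ∀ j, MemLp (f j) 2 μ) {C : ℝ}
    (hC : ∀ j, ∫ x, f j x * f j x ∂μ ≤ C) :
    ∃ (κ : ℕ → ℕ) (X : ℝ → ℝ), StrictMono κ ∧ MemLp X 2 μ ∧ ∀ k : ℝ → ℝ, MemLp k 2 μ →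
      Tendsto (fun j => ∫ x, f (κ j) x * k x ∂μ) atTop (𝓝 (∫ x, X x * k x ∂μ)) := by
  have : Fact ((2 : ℝ≥0∞) ≠ ⊤) := ⟨by simp⟩
  have hb : ∀ j, ‖(hf j).toLp (f j)‖ ≤ √C := fun j => by
    apply Real.le_sqrt_of_sq_le
    rw [← real_inner_self_eq_norm_sq, inner_toLp]
    exact hC j
  obtain ⟨a, κ, hκ, h⟩ := exists_weakly_convergent_subseq hb
  refine ⟨κ, a, hκ, Lp.memLp a, fun k hk => ?_⟩
  have h1 := h (hk.toLp k)
  simp only [inner_toLp] at h1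
  have e : inner ℝ a (hk.toLp k) = ∫ x, a x * k x ∂μ := by
    rw [← inner_toLp (Lp.memLp a) hk, Lp.toLp_coeFn]
  rwa [e] at h1

end L2

theorem indicator_ae_eq_of_ae_restrict {O : Set ℝ} (hO : MeasurableSet O) {f g : ℝ → ℝ}
    (h : f =ᵐ[volume.restrict O] g) : O.indicator f =ᵐ[volume] O.indicator g := by
  rw [EventuallyEq, ae_restrict_iff' hO] at h
  filter_upwards [h] with x hx
  by_cases hxO : x ∈ O
  · simp [hxO, hx hxO]
  · simp [hxO]

theorem BendApprox.congr {O : Set ℝ} {h k : ℝ → ℝ} (hh : BendApprox O h) (hk : h =ᵐ[volume] k) :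
    BendApprox O k := by
  intro δ hδ
  obtain ⟨ψ, hψ, h1⟩ := hh δ hδ
  refine ⟨ψ, hψ, le_trans (le_of_eq (integral_congr_ae ?_)) h1⟩
  filter_upwards [hk] with x hx
  rw [hx]

theorem integrable_indicator_of_memLp_two {O : Set ℝ} (hO : MeasurableSet O)
    (hOb : Bornology.IsBounded O) {f : ℝ → ℝ} (hf : MemLp f 2 (volume.restrict O)) :
    Integrable (O.indicator f) := by
  have : IsFiniteMeasure (volume.restrict O) := ⟨by simpa using hOb.measure_lt_top⟩
  exact (integrable_indicator_iff hO).2 (hf.integrable (by norm_num))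

/-- The `L²` functions which are `L¹` limits of second derivatives of test functions. -/
noncomputable def bendSubmodule {O : Set ℝ} (hO : MeasurableSet O) (hOb : Bornology.IsBounded O) :
    Submodule ℝ (Lp ℝ 2 (volume.restrict O)) where
  carrier := {f | BendApprox O (O.indicator f)}
  zero_mem' := by
    refine BendApprox.congr (h := fun _ => 0) IsBend.zero.approx ?_
    have : (fun _ => (0 : ℝ)) = O.indicator (0 : ℝ → ℝ) := by ext x; simp
    rw [this]
    exact (indicator_ae_eq_of_ae_restrict hO (Lp.coeFn_zero _ _ _)).symm
  add_mem' := by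
    intro f g hf hg
    have h1 := BendApprox.add hf hg (integrable_indicator_of_memLp_two hO hOb (Lp.memLp f))
      (integrable_indicator_of_memLp_two hO hOb (Lp.memLp g))
    refine h1.congr ?_
    filter_upwards [indicator_ae_eq_of_ae_restrict hO (Lp.coeFn_add f g)] with x hx
    rw [hx]
    by_cases hxO : x ∈ O <;> simp [hxO]
  smul_mem' := by
    intro c f hf
    refine (BendApprox.const_mul hf c).congr ?_
    filter_upwards [indicator_ae_eq_of_ae_restrict hO (Lp.coeFn_smul c f)] with x hx
    rw [hx]
    by_cases hxO : x ∈ O <;> simp [hxO]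

theorem integral_abs_indicator_sub_le {O : Set ℝ} (hO : MeasurableSet O)
    (hOb : Bornology.IsBounded O) (f g : Lp ℝ 2 (volume.restrict O)) :
    ∫ x, |O.indicator f x - O.indicator g x| ≤ ‖f - g‖ * (volume O).toReal ^ (1 / 2 : ℝ) := by
  have : IsFiniteMeasure (volume.restrict O) := ⟨by simpa using hOb.measure_lt_top⟩
  have i : IntegrableOn (fun x => f x - g x) O :=
    ((Lp.memLp f).integrable (by norm_num)).sub ((Lp.memLp g).integrable (by norm_num))
  have e : ∫ x, |O.indicator f x - O.indicator g x| = ∫ x in O, |f x - g x| := by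
    rw [← integral_indicator hO]
    congr 1; ext x
    by_cases hxO : x ∈ O <;> simp [hxO]
  rw [e, ← ENNReal.toReal_ofReal (integral_nonneg fun x => abs_nonneg (f x - g x)),
    ← eLpNorm_one_restrict_eq (f := fun x => f x - g x) i, Lp.norm_def]
  have h1 := eLpNorm_le_eLpNorm_mul_rpow_measure_univ (p := 1) (q := 2)
    (μ := volume.restrict O) (f := fun x => f x - g x) (by norm_num) i.aestronglyMeasurable
  have e2 : eLpNorm (fun x => f x - g x) 2 (volume.restrict O)
      = eLpNorm (f - g : Lp ℝ 2 (volume.restrict O)) 2 (volume.restrict O) :=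
    eLpNorm_congr_ae (Lp.coeFn_sub f g).symm
  rw [e2, Measure.restrict_apply_univ] at h1
  have h2 := ENNReal.toReal_mono (ENNReal.mul_ne_top (Lp.eLpNorm_ne_top _)
    (ENNReal.rpow_ne_top_of_nonneg (by norm_num) hOb.measure_lt_top.ne)) h1
  rw [ENNReal.toReal_mul, ← ENNReal.toReal_rpow] at h2
  norm_num at h2 ⊢
  exact h2

/-- The class `BendApprox` is closed under weak `L²` limits. -/
theorem BendApprox.of_weak_limit {O : Set ℝ} (hO : MeasurableSet O) (hOb : Bornology.IsBounded O)
    {h : ℕ → ℝ → ℝ} (hh : ∀ j, IsBend O (h j)) {X : ℝ → ℝ} (hX : MemLp X 2 (volume.restrict O))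
    (hX0 : ∀ x ∉ O, X x = 0)
    (hw : ∀ k, MemLp k 2 (volume.restrict O) →
      Tendsto (fun j => ∫ x in O, h j x * k x) atTop (𝓝 (∫ x in O, X x * k x))) :
    BendApprox O X := by
  set K := bendSubmodule hO hOb
  have hm : ∀ j, MemLp (h j) 2 (volume.restrict O) := fun j => ((hh j).memLp hOb 2).2.2
  have hK : ∀ j, (hm j).toLp (h j) ∈ K := fun j => by
    refine BendApprox.congr (hh j).approx ?_
    have e : h j = O.indicator (h j) := by
      ext x
      by_cases hxO : x ∈ O
      · simp [hxO]
      · simp [hxO, (hh j).eq_zero x hxO]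
    exact (EventuallyEq.of_eq e).trans (indicator_ae_eq_of_ae_restrict hO (hm j).coeFn_toLp.symm)
  -- A weak limit is orthogonal to everything orthogonal to the subspace, hence lies in its double
  -- orthogonal complement, which is its norm closure.
  have hXK : hX.toLp X ∈ K.topologicalClosure := by
    rw [← Submodule.orthogonal_orthogonal_eq_closure, Submodule.mem_orthogonal']
    intro y hy
    have h1 := hw y (Lp.memLp y)
    have e : ∀ {k : ℝ → ℝ} (hk : MemLp k 2 (volume.restrict O)),
        ∫ x in O, k x * y x = inner ℝ (hk.toLp k) y := fun hk => by
      rw [← inner_toLp hk (Lp.memLp y), Lp.toLp_coeFn]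
    rw [e hX] at h1
    refine tendsto_nhds_unique h1 ?_
    simp only [fun j => e (hm j), fun j => Submodule.inner_right_of_mem_orthogonal (hK j) hy]
    exact tendsto_const_nhds
  intro δ hδ
  set V : ℝ := (volume O).toReal ^ (1 / 2 : ℝ)
  have hV : 0 ≤ V := by positivity
  rw [← SetLike.mem_coe, Submodule.topologicalClosure_coe, Metric.mem_closure_iff] at hXK
  obtain ⟨f, hf, hfX⟩ := hXK (δ / 2 / (V + 1)) (by positivity)
  obtain ⟨ψ, hψ, h1⟩ := (show BendApprox O (O.indicator f) from hf) (δ / 2) (half_pos hδ)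
  refine ⟨ψ, hψ, ?_⟩
  have hXe : O.indicator (hX.toLp X) =ᵐ[volume] X := by
    refine (indicator_ae_eq_of_ae_restrict hO hX.coeFn_toLp).trans (EventuallyEq.of_eq ?_)
    ext x
    by_cases hxO : x ∈ O
    · simp [hxO]
    · simp [hxO, hX0 x hxO]
  have h2 := integral_abs_indicator_sub_le hO hOb f (hX.toLp X)
  have i1 := (hψ.deriv.deriv.integrable.sub
    (integrable_indicator_of_memLp_two hO hOb (Lp.memLp f))).abs
  have i2 := ((integrable_indicator_of_memLp_two hO hOb (Lp.memLp f)).sub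
    (integrable_indicator_of_memLp_two hO hOb (Lp.memLp (hX.toLp X)))).abs
  rw [dist_comm, dist_eq_norm] at hfX
  calc ∫ x, |deriv (deriv ψ) x - X x|
      ≤ ∫ x, (|deriv (deriv ψ) x - O.indicator f x|
          + |O.indicator f x - O.indicator (hX.toLp X) x|) := by
        refine integral_mono_of_nonneg (ae_of_all _ fun _ => abs_nonneg _) (i1.add i2) ?_
        filter_upwards [hXe] with x hx
        rw [hx]
        exact abs_sub_le _ _ _
    _ = _ := integral_add i1 i2
    _ ≤ δ / 2 + δ / 2 / (V + 1) * V := by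
        refine add_le_add h1 (h2.trans ?_)
        exact mul_le_mul_of_nonneg_right hfX.le hV
    _ ≤ δ / 2 + δ / 2 / (V + 1) * (V + 1) := by gcongr; linarith
    _ = δ := by field_simp; ring

/-- Evaluating the primitive at a point is pairing with a bounded function, so weak convergence
already sees it. -/
theorem prim_eq_setIntegral {O : Set ℝ} {h : ℝ → ℝ} (h0 : ∀ x ∉ O, h x = 0)
    (x : ℝ) : prim h x = ∫ t in O, h t * (Iic x).indicator 1 t := by
  rw [setIntegral_eq_integral_of_forall_compl_eq_zero (fun t ht => by simp [h0 t ht]), prim,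
    ← integral_indicator measurableSet_Iic]
  congr 1; ext t
  by_cases ht : t ∈ Iic x <;> simp [ht]

/-- Weak `L²` convergence of second derivatives gives pointwise convergence of first ones. -/
theorem tendsto_prim_of_weak {O : Set ℝ} (hOb : Bornology.IsBounded O) {h : ℕ → ℝ → ℝ}
    {X : ℝ → ℝ} (h0 : ∀ j, ∀ x ∉ O, h j x = 0) (hX0 : ∀ x ∉ O, X x = 0)
    (hw : ∀ k, MemLp k 2 (volume.restrict O) →
      Tendsto (fun j => ∫ x in O, h j x * k x) atTop (𝓝 (∫ x in O, X x * k x))) (x : ℝ) :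
    Tendsto (fun j => prim (h j) x) atTop (𝓝 (prim X x)) := by
  simp only [fun j => prim_eq_setIntegral (h0 j) x, prim_eq_setIntegral hX0 x]
  refine hw _ (memLp_of_bounded hOb 2
    ((measurable_const.indicator measurableSet_Iic).aestronglyMeasurable) (C := 1) fun t => ?_)
  by_cases ht : t ∈ Iic x <;> simp [ht]

/-- Dominated convergence: the first primitives vanish off the bounded set `O` and are uniformly
bounded there. -/
theorem tendsto_prim_prim_of_tendsto {O : Set ℝ} (hO : IsOpen O) (hOb : Bornology.IsBounded O)
    {h : ℕ → ℝ → ℝ}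
    {X : ℝ → ℝ} (hh : ∀ j, IsBend O (h j)) {A : ℝ} (hA : ∀ᶠ j in atTop, ∀ x, |prim (h j) x| ≤ A)
    (ht : ∀ x, Tendsto (fun j => prim (h j) x) atTop (𝓝 (prim X x))) (x : ℝ) :
    Tendsto (fun j => prim (prim (h j)) x) atTop (𝓝 (prim (prim X) x)) := by
  refine tendsto_integral_filter_of_dominated_convergence (O.indicator fun _ => A)
    (Eventually.of_forall fun j =>
      (continuous_prim ((hh j).integrable hOb)).aestronglyMeasurable) ?_ ?_
    (ae_of_all _ fun t => ht t)
  · filter_upwards [hA] with j hj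
    refine ae_of_all _ fun t => ?_
    by_cases htO : t ∈ O
    · simpa [htO] using hj t
    · simp [htO, (hh j).prim_eq_zero hOb t htO]
  · exact ((integrable_indicator_iff hO.measurableSet).2
      (integrableOn_const hOb.measure_lt_top.ne)).restrict

/-! ### Elementary real estimates -/

theorem exists_rpow_le_mul_add {s δ : ℝ} (hs0 : 0 ≤ s) (hs : s < 1) (hδ : 0 < δ) :
    ∃ K : ℝ, ∀ y : ℝ, 0 ≤ y → y ^ s ≤ δ * y + K := by
  obtain ⟨Y, hY⟩ := eventually_atTop.1
    (((tendsto_rpow_neg_atTop (show 0 < 1 - s by linarith)).eventually (gt_mem_nhds hδ)).and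
      (eventually_gt_atTop 0))
  refine ⟨(max Y 0) ^ s, fun y hy => ?_⟩
  have hm : 0 ≤ (max Y 0) ^ s := by positivity
  rcases le_total y (max Y 0) with h | h
  · have := Real.rpow_le_rpow hy h hs0
    nlinarith [mul_nonneg hδ.le hy]
  · obtain ⟨h1, h2⟩ := hY y ((le_max_left _ _).trans h)
    have h3 : y ^ s = y ^ (-(1 - s)) * y := by
      rw [← Real.rpow_add_one h2.ne']; congr 1; ring
    rw [h3]
    nlinarith

/-- Here `A` stands for the L¹ norm of the second derivative; `G + D * A` and `G + A` are the
resulting bounds for the function and its slope. Exponents below 1 let both powers be absorbed on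
the left. -/
theorem exists_bound_of_sublinear {C α β γ D G s t : ℝ} (hC : 0 < C) (hβ : 0 ≤ β) (hγ : 0 ≤ γ)
    (hD : 0 ≤ D) (hG : 0 ≤ G) (hs0 : 0 ≤ s) (hs : s < 1) (ht0 : 0 ≤ t) (ht : t < 1) :
    ∃ A₀ : ℝ, ∀ A : ℝ, 0 ≤ A → C * A ≤ α + β * (G + D * A) ^ s + γ * (G + A) ^ t → A ≤ A₀ := by
  -- The slopes are chosen so that each power absorbs at most `C / 4 * A`, leaving `C / 2 * A` on
  -- the left.
  obtain ⟨K, hK⟩ := exists_rpow_le_mul_add hs0 hs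
    (show 0 < C / 4 / ((β + 1) * (D + 1)) by positivity)
  obtain ⟨L, hL⟩ := exists_rpow_le_mul_add ht0 ht (show 0 < C / 4 / (γ + 1) by positivity)
  set δ := C / 4 / ((β + 1) * (D + 1)) with hδ
  set η := C / 4 / (γ + 1) with hη
  have d1 : β * (δ * D) ≤ C / 4 := by
    have : δ * ((β + 1) * (D + 1)) = C / 4 := by rw [hδ]; field_simp
    have hδ0 : 0 ≤ δ := by positivity
    nlinarith [mul_nonneg hδ0 hβ, mul_nonneg hδ0 hD]
  have d2 : γ * η ≤ C / 4 := by
    have : η * (γ + 1) = C / 4 := by rw [hη]; field_simp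
    have hη0 : 0 ≤ η := by positivity
    nlinarith
  refine ⟨(α + β * (δ * G + K) + γ * (η * G + L)) / (C / 2), fun A hA h => ?_⟩
  rw [le_div_iff₀ (by positivity)]
  have h1 := mul_le_mul_of_nonneg_left (hK (G + D * A) (by positivity)) hβ
  have h2 := mul_le_mul_of_nonneg_left (hL (G + A) (by positivity)) hγ
  have h3 := mul_le_mul_of_nonneg_right d1 hA
  have h4 := mul_le_mul_of_nonneg_right d2 hA
  linarith

/-- Bernoulli's inequality at -e/(e+b). It turns an additive error in an L^p mean into an additive
error for the integral of the p-th power. -/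
theorem add_rpow_le_add_mul {b e p : ℝ} (hb : 0 ≤ b) (he : 0 < e) (hp : 1 ≤ p) :
    (e + b) ^ p ≤ b ^ p + p * e * (e + b) ^ (p - 1) := by
  have hs : 0 < e + b := by positivity
  have h1 := one_add_mul_self_le_rpow_one_add (s := -(e / (e + b))) (by
    rw [neg_le_neg_iff, div_le_one hs]; linarith) hp
  have e1 : 1 + -(e / (e + b)) = b / (e + b) := by field_simp; ring
  rw [e1, Real.div_rpow hb hs.le, le_div_iff₀ (by positivity)] at h1
  have e2 : (e + b) ^ p = (e + b) * (e + b) ^ (p - 1) := by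
    rw [Real.rpow_sub_one hs.ne']; field_simp
  have e3 : (1 + p * -(e / (e + b))) * (e + b) ^ p
      = (e + b) ^ p - p * e * (e + b) ^ (p - 1) := by
    rw [e2]; field_simp; ring
  linarith

/-- Comparison with a geometric decay whose ratio uses the midpoint of `a'` and `b`. -/
theorem tendsto_rpow_div_rpow {a : ℕ → ℝ} {a' b : ℝ} {p : ℕ → ℝ} (ha0 : ∀ᶠ j in atTop, 0 ≤ a j)
    (ha : Tendsto a atTop (𝓝 a')) (hab : a' < b) (hp : Tendsto p atTop atTop) :
    Tendsto (fun j => a j ^ p j / b ^ p j) atTop (𝓝 0) := by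
  have ha' : 0 ≤ a' := ge_of_tendsto ha ha0
  have hb : 0 < b := ha'.trans_lt hab
  set d := (a' + b) / 2 with hd
  have hd0 : 0 ≤ d / b := by positivity
  have hd1 : d / b < 1 := by rw [div_lt_one hb]; linarith
  refine squeeze_zero' (g := fun j => (d / b) ^ p j) ?_ ?_
    ((tendsto_rpow_atTop_of_base_lt_one _ (by linarith) hd1).comp hp)
  · filter_upwards [ha0] with j hj
    positivity
  · filter_upwards [ha0, ha.eventually (gt_mem_nhds (show a' < d by linarith)),
      hp.eventually_ge_atTop 0] with j h1 h2 h3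
    rw [← Real.div_rpow h1 hb.le]
    exact Real.rpow_le_rpow (by positivity) (by gcongr) h3

theorem tendsto_mul_rpow_div_rpow {e p : ℕ → ℝ} {L b : ℝ} (he : ∀ j, 0 < e j) (hL : 0 < L)
    (hb : 0 < b) (hp : Tendsto p atTop atTop)
    (het : Tendsto (fun j => e j ^ (1 / p j)) atTop (𝓝 0)) :
    Tendsto (fun j => p j * e j * L ^ p j / b ^ p j) atTop (𝓝 0) := by
  have h1 : Tendsto (fun j => p j * Real.exp (-p j)) atTop (𝓝 0) := by
    have := (Real.tendsto_pow_mul_exp_neg_atTop_nhds_zero 1).comp hp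
    simp only [pow_one] at this
    exact this
  have hc : 0 < b * Real.exp (-1) / L := by positivity
  refine squeeze_zero' ?_ ?_ h1
  · filter_upwards [hp.eventually_gt_atTop 0] with j hj
    have := he j
    positivity
  · filter_upwards [hp.eventually_gt_atTop 0, het.eventually (gt_mem_nhds hc)] with j h1 h2
    -- The threshold is chosen so that the quotient is at most p exp(-p).
    have h3 : e j ≤ (b * Real.exp (-1) / L) ^ p j := by
      have := Real.rpow_le_rpow (Real.rpow_nonneg (he j).le _) h2.le h1.le
      rwa [← Real.rpow_mul (he j).le, one_div_mul_cancel h1.ne', Real.rpow_one] at this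
    rw [Real.div_rpow (by positivity) hL.le, Real.mul_rpow hb.le (by positivity),
      ← Real.exp_mul, neg_one_mul] at h3
    have hLp : 0 < L ^ p j := by positivity
    have hbp : 0 < b ^ p j := by positivity
    rw [le_div_iff₀ hLp] at h3
    rw [div_le_iff₀ hbp]
    calc p j * e j * L ^ p j = p j * (e j * L ^ p j) := by ring
      _ ≤ p j * (b ^ p j * Real.exp (-p j)) := by gcongr
      _ = _ := by ring

/-! ### The functionals along a Dirichlet class -/

/-- The density `H(x, u, u', u'')` for `u = g + v`, where `v` has second derivative `h`. -/
noncomputable def jetDensity (H : ℝ → ℝ → ℝ → ℝ → ℝ) (g₀ g₁ g₂ h : ℝ → ℝ) (x : ℝ) : ℝ :=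
  H x (g₀ x + prim (prim h) x) (g₁ x + prim h x) (g₂ x + h x)

/-- The `L^p` mean of `M + J` over `Ω`. -/
noncomputable def lpMean (Ω : Set ℝ) (M p : ℝ) (J : ℝ → ℝ) : ℝ≥0∞ :=
  laverage (volume.restrict Ω) (fun x => ENNReal.ofReal (M + J x) ^ p) ^ (1 / p)

/-- The standing assumptions on the Hamiltonian and on the jet of the boundary datum. -/
structure JetProblem (Ω : Set ℝ) (H : ℝ → ℝ → ℝ → ℝ → ℝ) (m M : ℝ) (g₀ g₁ g₂ : ℝ → ℝ) : Prop where
  isOpen : IsOpen Ω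
  isBounded : Bornology.IsBounded Ω
  cont : ContinuousOn (fun z : ℝ × ℝ × ℝ × ℝ => H z.1 z.2.1 z.2.2.1 z.2.2.2)
    (Ω ×ˢ (univ : Set (ℝ × ℝ × ℝ)))
  pos : 0 < m
  lt : m < M
  lower : ∀ x ∈ Ω, ∀ η P X : ℝ, -m ≤ H x η P X
  level : ∀ x ∈ Ω, ∀ η P c : ℝ, Convex ℝ {X : ℝ | H x η P X ≤ c}
  coercive : ∃ C₁ C₂ s t : ℝ, 0 < C₁ ∧ 0 < C₂ ∧ 0 ≤ s ∧ s < 1 ∧ 0 ≤ t ∧ t < 1 ∧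
    ∀ᵐ x ∂(volume.restrict Ω), ∀ η P X : ℝ,
      C₁ * |X| - C₂ * (1 + |η| ^ s + |P| ^ t) ≤ H x η P X
  measurable₀ : Measurable g₀
  measurable₁ : Measurable g₁
  measurable₂ : Measurable g₂
  bounded : ∃ G : ℝ, ∀ x, |g₀ x| ≤ G ∧ |g₁ x| ≤ G ∧ |g₂ x| ≤ G

theorem lintegral_le_of_lpMean_le {Ω : Set ℝ} (hΩ : Bornology.IsBounded Ω) {M p : ℝ} (hp : 0 < p)
    {J : ℝ → ℝ} {k : ℝ≥0∞} (h : lpMean Ω M p J ≤ k) :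
    ∫⁻ x in Ω, ENNReal.ofReal (M + J x) ^ p ≤ k ^ p * volume Ω := by
  have : IsFiniteMeasure (volume.restrict Ω) := ⟨by simpa using hΩ.measure_lt_top⟩
  rw [← measure_mul_laverage, Measure.restrict_apply_univ, mul_comm]
  gcongr
  have := ENNReal.rpow_le_rpow h hp.le
  rwa [lpMean, ← ENNReal.rpow_mul, one_div_mul_cancel hp.ne', ENNReal.rpow_one] at this

theorem lpMean_le_of_ae_le {Ω : Set ℝ} (hΩ : Bornology.IsBounded Ω) {M p c : ℝ} (hp : 0 < p)
    {J : ℝ → ℝ} (h : ∀ᵐ x ∂(volume.restrict Ω), J x ≤ c) :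
    lpMean Ω M p J ≤ ENNReal.ofReal (M + c) := by
  have : IsFiniteMeasure (volume.restrict Ω) := ⟨by simpa using hΩ.measure_lt_top⟩
  rw [lpMean, one_div, ENNReal.rpow_inv_le_iff hp, laverage_eq]
  refine ENNReal.div_le_of_le_mul ?_
  rw [← lintegral_const]
  refine lintegral_mono_ae ?_
  filter_upwards [h] with x hx
  gcongr

/-- With F the integrand and k the bound, F^q ≤ k^q (1 + (F/k)^p) pointwise for q ≤ p. This stands
in for Hölder's inequality at the price of a factor 2, and needs no measurability of `J`. -/
theorem lintegral_rpow_le_of_lpMean_le {Ω : Set ℝ} (hΩ : Bornology.IsBounded Ω) {M p q K : ℝ}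
    (hq : 0 < q) (hqp : q ≤ p) (hK : 0 < K) {J : ℝ → ℝ}
    (h : lpMean Ω M p J ≤ ENNReal.ofReal K) :
    ∫⁻ x in Ω, ENNReal.ofReal (M + J x) ^ q ≤ 2 * ENNReal.ofReal K ^ q * volume Ω := by
  set k := ENNReal.ofReal K
  have hk0 : k ≠ 0 := by simpa [k] using hK
  have hkt : k ≠ ⊤ := ENNReal.ofReal_ne_top
  have hp : 0 < p := hq.trans_le hqp
  have hkp0 : k ^ p ≠ 0 := by simp [hk0, hkt]
  have hkpt : k ^ p ≠ ⊤ := ENNReal.rpow_ne_top_of_nonneg hp.le hkt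
  have hkqt : k ^ q ≠ ⊤ := ENNReal.rpow_ne_top_of_nonneg hq.le hkt
  have pw : ∀ x, ENNReal.ofReal (M + J x) ^ q
      ≤ k ^ q * (1 + (k ^ p)⁻¹ * ENNReal.ofReal (M + J x) ^ p) := by
    intro x
    set F := ENNReal.ofReal (M + J x)
    have e : F = k * (F / k) := (ENNReal.mul_div_cancel hk0 hkt).symm
    have e2 : (k ^ p)⁻¹ * F ^ p = (F / k) ^ p := by
      rw [ENNReal.div_rpow_of_nonneg _ _ hp.le, mul_comm, div_eq_mul_inv]
    rw [e2]
    conv_lhs => rw [e, ENNReal.mul_rpow_of_nonneg _ _ hq.le]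
    gcongr
    rcases le_total (F / k) 1 with h1 | h1
    · exact (ENNReal.rpow_le_one h1 hq.le).trans le_self_add
    · exact (ENNReal.rpow_le_rpow_of_exponent_le h1 hqp).trans le_add_self
  calc _ ≤ ∫⁻ x in Ω, k ^ q * (1 + (k ^ p)⁻¹ * ENNReal.ofReal (M + J x) ^ p) := lintegral_mono pw
    _ = k ^ q * (volume Ω + (k ^ p)⁻¹ * ∫⁻ x in Ω, ENNReal.ofReal (M + J x) ^ p) := by
      rw [lintegral_const_mul' _ _ hkqt, lintegral_add_left measurable_const,
        lintegral_const_mul' _ _ (ENNReal.inv_ne_top.2 hkp0)]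
      simp
    _ ≤ k ^ q * (volume Ω + (k ^ p)⁻¹ * (k ^ p * volume Ω)) := by
      gcongr
      exact lintegral_le_of_lpMean_le hΩ hp h
    _ = _ := by
      rw [← mul_assoc, ENNReal.inv_mul_cancel hkp0 hkpt]
      ring

/-- Chebyshev's inequality for the `p j`-th powers. -/
theorem tendsto_measure_superlevel {O : Set ℝ} (hO : MeasurableSet O) {J : ℕ → ℝ → ℝ}
    (hJ : ∀ j, AEMeasurable (J j) (volume.restrict O)) {M c : ℝ} (hb : 0 < M + c)
    {p r : ℕ → ℝ} (hp : ∀ j, 0 < p j)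
    (hle : ∀ᶠ j in atTop, ∫⁻ x in O, ENNReal.ofReal (M + J j x) ^ p j ≤ ENNReal.ofReal (r j))
    (hr : Tendsto (fun j => r j / (M + c) ^ p j) atTop (𝓝 0)) :
    Tendsto (fun j => volume {x ∈ O | c < J j x}) atTop (𝓝 0) := by
  have h1 : Tendsto (fun j => ENNReal.ofReal (r j / (M + c) ^ p j)) atTop (𝓝 0) := by
    simpa using ENNReal.tendsto_ofReal hr
  refine tendsto_of_tendsto_of_tendsto_of_le_of_le' tendsto_const_nhds h1
    (Eventually.of_forall fun _ => zero_le) ?_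
  filter_upwards [hle] with j hj
  have hpos : 0 < (M + c) ^ p j := Real.rpow_pos_of_pos hb _
  have hm : AEMeasurable (fun x => ENNReal.ofReal (M + J j x) ^ p j) (volume.restrict O) :=
    ((hJ j).const_add M).ennreal_ofReal.pow_const _
  have h2 := meas_ge_le_lintegral_div hm (ε := ENNReal.ofReal ((M + c) ^ p j))
    (by simpa using hpos) ENNReal.ofReal_ne_top
  rw [ENNReal.ofReal_div_of_pos hpos]
  refine le_trans ?_ (h2.trans (ENNReal.div_le_div_right hj _))
  rw [Measure.restrict_apply' hO]
  refine measure_mono fun x hx => ⟨?_, hx.1⟩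
  change ENNReal.ofReal ((M + c) ^ p j) ≤ ENNReal.ofReal (M + J j x) ^ p j
  rw [← ENNReal.ofReal_rpow_of_pos hb]
  exact ENNReal.rpow_le_rpow (ENNReal.ofReal_le_ofReal (by linarith [hx.2])) (hp j).le

/-! ### A priori estimates from bounded energy -/

namespace JetProblem

variable {Ω : Set ℝ} {H : ℝ → ℝ → ℝ → ℝ → ℝ} {m M : ℝ} {g₀ g₁ g₂ : ℝ → ℝ}

theorem continuous_slice (S : JetProblem Ω H m M g₀ g₁ g₂) {x : ℝ} (hx : x ∈ Ω) :
    Continuous fun z : ℝ × ℝ × ℝ => H x z.1 z.2.1 z.2.2 := by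
  have : Continuous fun z : ℝ × ℝ × ℝ => ((x, z) : ℝ × ℝ × ℝ × ℝ) := by fun_prop
  exact S.cont.comp_continuous this fun z => ⟨hx, mem_univ _⟩

theorem aemeasurable_comp (S : JetProblem Ω H m M g₀ g₁ g₂) {u v w : ℝ → ℝ} (hu : Measurable u)
    (hv : Measurable v) (hw : Measurable w) :
    AEMeasurable (fun x => H x (u x) (v x) (w x)) (volume.restrict Ω) := by
  classical
  have hs : MeasurableSet (Ω ×ˢ (univ : Set (ℝ × ℝ × ℝ))) :=
    S.isOpen.measurableSet.prod MeasurableSet.univ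
  have h1 := S.cont.measurable_piecewise (g := fun _ => 0) continuousOn_const hs
  have h2 : Measurable fun x : ℝ => ((x, u x, v x, w x) : ℝ × ℝ × ℝ × ℝ) := by fun_prop
  refine ⟨_, h1.comp h2, ?_⟩
  filter_upwards [ae_restrict_mem S.isOpen.measurableSet] with x hx
  simp [piecewise, hx]

theorem aemeasurable_jetDensity (S : JetProblem Ω H m M g₀ g₁ g₂) {h : ℝ → ℝ} (hh : IsBend Ω h) :
    AEMeasurable (jetDensity H g₀ g₁ g₂ h) (volume.restrict Ω) :=
  S.aemeasurable_comp
    (S.measurable₀.add (continuous_prim (hh.integrable_prim S.isBounded)).measurable)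
    (S.measurable₁.add (continuous_prim (hh.integrable S.isBounded)).measurable)
    (S.measurable₂.add hh.measurable)

/-- A priori estimates for functions of bounded energy. -/
theorem exists_estimates (S : JetProblem Ω H m M g₀ g₁ g₂) {K : ℝ} (hK : 0 < K) :
    ∃ C₁ A B : ℝ, 0 < C₁ ∧ ∀ (h : ℝ → ℝ) (p : ℝ), IsBend Ω h → 1 ≤ p →
      lpMean Ω M p (jetDensity H g₀ g₁ g₂ h) ≤ ENNReal.ofReal K →
        ∫ x, |h x| ≤ A ∧ ∀ᵐ x ∂(volume.restrict Ω),
          C₁ * |g₂ x + h x| ≤ jetDensity H g₀ g₁ g₂ h x + B := by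
  obtain ⟨C₁, C₂, s, t, hC₁, hC₂, hs0, hs, ht0, ht, hco⟩ := S.coercive
  obtain ⟨G, hG⟩ := S.bounded
  have hG0 : 0 ≤ G := (abs_nonneg _).trans (hG 0).1
  set D : ℝ := (volume Ω).toReal
  have hD : 0 ≤ D := ENNReal.toReal_nonneg
  have hM : 0 < M := S.pos.trans S.lt
  obtain ⟨A₀, hA₀⟩ := exists_bound_of_sublinear (C := C₁)
    (α := 2 * K * D + C₁ * G * D + C₂ * D)
    (β := C₂ * D) (γ := C₂ * D) (D := D) (G := G) (s := s) (t := t) hC₁ (by positivity)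
    (by positivity) hD hG0 hs0 hs ht0 ht
  have pw : ∀ h : ℝ → ℝ, IsBend Ω h → ∀ A : ℝ, ∫ x, |h x| ≤ A → ∀ᵐ x ∂(volume.restrict Ω),
      C₁ * |g₂ x + h x| ≤ jetDensity H g₀ g₁ g₂ h x
        + C₂ * (1 + (G + D * A) ^ s + (G + A) ^ t) := by
    intro h hh A hA
    filter_upwards [hco] with x hx
    have h1 := hx (g₀ x + prim (prim h) x) (g₁ x + prim h x) (g₂ x + h x)
    have b1 : |g₁ x + prim h x| ≤ G + A := (abs_add_le _ _).trans
      (add_le_add (hG x).2.1 ((abs_prim_le (hh.integrable S.isBounded) x).trans hA))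
    have b0 : |g₀ x + prim (prim h) x| ≤ G + D * A := by
      refine (abs_add_le _ _).trans (add_le_add (hG x).1
        ((abs_prim_le (hh.integrable_prim S.isBounded) x).trans
          ((hh.integral_abs_prim_le S.isBounded).trans ?_)))
      rw [mul_comm]
      exact mul_le_mul_of_nonneg_left hA hD
    have c0 := Real.rpow_le_rpow (abs_nonneg _) b0 hs0
    have c1 := Real.rpow_le_rpow (abs_nonneg _) b1 ht0
    have := mul_le_mul_of_nonneg_left (add_le_add (add_le_add (le_refl (1 : ℝ)) c0) c1) hC₂.le
    rw [jetDensity]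
    linarith
  refine ⟨C₁, A₀, C₂ * (1 + (G + D * A₀) ^ s + (G + A₀) ^ t), hC₁, fun h p hh hp hle => ?_⟩
  -- Integrating the pointwise coercivity estimate, with the L¹ norm of `h` itself as the bound `A`,
  -- bounds that norm by sublinear powers of itself.
  have hbd : ∫ x, |h x| ≤ A₀ := by
    set A : ℝ := ∫ x, |h x| with hA
    have hA0 : 0 ≤ A := integral_nonneg fun _ => abs_nonneg _
    refine hA₀ A hA0 ?_
    set R : ℝ := C₂ * (1 + (G + D * A) ^ s + (G + A) ^ t) with hR
    have hR0 : 0 ≤ R := by positivity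
    have l1 : ENNReal.ofReal (C₁ * A) = ∫⁻ x in Ω, ENNReal.ofReal (C₁ * |h x|) := by
      rw [← ofReal_integral_eq_lintegral_ofReal, integral_const_mul]
      · congr 2
        exact (setIntegral_eq_integral_of_forall_compl_eq_zero fun x hx => by
          simp [hh.eq_zero x hx]).symm
      · exact ((hh.integrable S.isBounded).abs.const_mul C₁).integrableOn
      · exact ae_of_all _ fun x => by positivity
    have l2 : ∫⁻ x in Ω, ENNReal.ofReal (C₁ * |h x|)
        ≤ ∫⁻ x in Ω, (ENNReal.ofReal (M + jetDensity H g₀ g₁ g₂ h x) ^ (1 : ℝ)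
          + ENNReal.ofReal (C₁ * G + R)) := by
      refine lintegral_mono_ae ?_
      filter_upwards [pw h hh A le_rfl] with x hx
      rw [ENNReal.rpow_one]
      refine le_trans (ENNReal.ofReal_le_ofReal ?_) ENNReal.ofReal_add_le
      have h1 : |h x| ≤ |g₂ x + h x| + G := by
        have h2 := abs_sub (g₂ x + h x) (g₂ x)
        rw [add_sub_cancel_left] at h2
        linarith [(hG x).2.2]
      have := mul_le_mul_of_nonneg_left h1 hC₁.le
      linarith
    rw [lintegral_add_right _ measurable_const] at l2
    have l3 := lintegral_rpow_le_of_lpMean_le S.isBounded one_pos hp hK hle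
    rw [ENNReal.rpow_one] at l3
    have l4 : ENNReal.ofReal (C₁ * A) ≤ ENNReal.ofReal (2 * K * D + (C₁ * G + R) * D) := by
      rw [l1]
      refine l2.trans ((add_le_add_left l3 _).trans (le_of_eq ?_))
      have hv : volume Ω = ENNReal.ofReal D :=
        (ENNReal.ofReal_toReal S.isBounded.measure_lt_top.ne).symm
      have hQ : 0 ≤ C₁ * G + R := by positivity
      have h2 : (2 : ℝ≥0∞) = ENNReal.ofReal 2 := by simp
      rw [lintegral_const, Measure.restrict_apply_univ, hv, h2, ← ENNReal.ofReal_mul (by norm_num),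
        ← ENNReal.ofReal_mul (by positivity), ← ENNReal.ofReal_mul hQ,
        ← ENNReal.ofReal_add (by positivity) (by positivity)]
    rw [ENNReal.ofReal_le_ofReal_iff (by positivity)] at l4
    rw [hR] at l4
    linarith
  exact ⟨hbd, pw h hh A₀ hbd⟩

end JetProblem

/-! ### Semicontinuity and closedness along sequences of bounded energy -/

namespace JetProblem

variable {Ω : Set ℝ} {H : ℝ → ℝ → ℝ → ℝ → ℝ} {m M : ℝ} {g₀ g₁ g₂ : ℝ → ℝ}

theorem integrableOn_of_bounded (S : JetProblem Ω H m M g₀ g₁ g₂) {u : ℝ → ℝ} (hu : Measurable u)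
    {C : ℝ} (hC : ∀ x, |u x| ≤ C) : IntegrableOn u Ω :=
  memLp_one_iff_integrable.1 (memLp_of_bounded S.isBounded 1 hu.aestronglyMeasurable hC)

/-- Pointwise convergence of lower order derivatives under weak convergence and energy bounds. -/
theorem tendsto_prim_prim (S : JetProblem Ω H m M g₀ g₁ g₂) {f : ℕ → ℝ → ℝ}
    (hf : ∀ j, IsBend Ω (f j)) {X : ℝ → ℝ} (hX0 : ∀ x ∉ Ω, X x = 0)
    (hw : ∀ k, MemLp k 2 (volume.restrict Ω) →
      Tendsto (fun j => ∫ x in Ω, f j x * k x) atTop (𝓝 (∫ x in Ω, X x * k x)))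
    {p : ℕ → ℝ} (hp : ∀ j, 1 ≤ p j) {K : ℝ} (hK : 0 < K)
    (hle : ∀ᶠ j in atTop, lpMean Ω M (p j) (jetDensity H g₀ g₁ g₂ (f j)) ≤ ENNReal.ofReal K)
    (x : ℝ) :
    Tendsto (fun j => prim (prim (f j)) x) atTop (𝓝 (prim (prim X) x)) := by
  obtain ⟨C₁, A, B, hC₁, hest⟩ := S.exists_estimates hK
  refine tendsto_prim_prim_of_tendsto S.isOpen S.isBounded hf (A := A) ?_
    (tendsto_prim_of_weak S.isBounded (fun j => (hf j).eq_zero) hX0 hw) x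
  filter_upwards [hle] with j hj y
  exact (abs_prim_le ((hf j).integrable S.isBounded) y).trans (hest _ _ (hf j) (hp j) hj).1

/-- Lower semicontinuity along a weakly converging sequence of bounded energy. -/
theorem ae_le_of_weak (S : JetProblem Ω H m M g₀ g₁ g₂) {f : ℕ → ℝ → ℝ}
    (hf : ∀ j, IsBend Ω (f j)) {X : ℝ → ℝ} (hX : MemLp X 2 (volume.restrict Ω))
    (hX0 : ∀ x ∉ Ω, X x = 0)
    (hw : ∀ k, MemLp k 2 (volume.restrict Ω) →
      Tendsto (fun j => ∫ x in Ω, f j x * k x) atTop (𝓝 (∫ x in Ω, X x * k x)))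
    {p : ℕ → ℝ} (hp : ∀ j, 1 ≤ p j) {K : ℝ} (hK : 0 < K)
    (hle : ∀ᶠ j in atTop, lpMean Ω M (p j) (jetDensity H g₀ g₁ g₂ (f j)) ≤ ENNReal.ofReal K)
    {O : Set ℝ} (hO : MeasurableSet O) (hOΩ : O ⊆ Ω) {c : ℝ}
    (hmeas : ∀ c' > c, Tendsto (fun j => volume {x ∈ O | c' < jetDensity H g₀ g₁ g₂ (f j) x})
      atTop (𝓝 0)) :
    (∀ᵐ x ∂(volume.restrict O), jetDensity H g₀ g₁ g₂ X x ≤ c) ∧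
      ∃ C : ℝ, ∀ᵐ x ∂(volume.restrict O), |X x| ≤ C := by
  have : IsFiniteMeasure (volume.restrict Ω) := ⟨by simpa using S.isBounded.measure_lt_top⟩
  obtain ⟨C₁, A, B, hC₁, hest⟩ := S.exists_estimates hK
  obtain ⟨G, hG⟩ := S.bounded
  have hXi : IntegrableOn X Ω := hX.integrable (by norm_num)
  have hgi : IntegrableOn g₂ Ω := S.integrableOn_of_bounded S.measurable₂ fun x => (hG x).2.2
  have hfi : ∀ j, IntegrableOn (f j) Ω := fun j => ((hf j).integrable S.isBounded).integrableOn
  obtain ⟨j₀, hj₀⟩ := eventually_atTop.1 hle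
  have hcoer : ∀ᵐ x ∂(volume.restrict O), ∀ᶠ j in atTop,
      C₁ * |g₂ x + f j x| ≤ jetDensity H g₀ g₁ g₂ (f j) x + B := by
    have h1 : ∀ j, ∀ᵐ x ∂(volume.restrict O), j₀ ≤ j →
        C₁ * |g₂ x + f j x| ≤ jetDensity H g₀ g₁ g₂ (f j) x + B := fun j => by
      by_cases hj : j₀ ≤ j
      · filter_upwards [ae_restrict_of_ae_restrict_of_subset hOΩ
          (hest _ _ (hf j) (hp j) (hj₀ j hj)).2] with x hx _
        exact hx
      · exact ae_of_all _ fun x h => absurd h hj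
    filter_upwards [ae_all_iff.2 h1] with x hx
    filter_upwards [eventually_ge_atTop j₀] with j hj
    exact hx j hj
  have hint : ∀ A ⊆ O, MeasurableSet A → Tendsto (fun j => ∫ x in A, (g₂ x + f j x)) atTop
      (𝓝 (∫ x in A, (g₂ x + X x))) := by
    intro A hA hAm
    have e : ∀ k : ℝ → ℝ, ∫ x in Ω, k x * A.indicator 1 x = ∫ x in A, k x := by
      intro k
      have e1 : (fun x => k x * A.indicator 1 x) = A.indicator k := by
        ext x
        by_cases hx : x ∈ A <;> simp [hx]
      rw [e1, setIntegral_indicator hAm, inter_eq_right.2 (hA.trans hOΩ)]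
    have h1 := hw (A.indicator 1) (memLp_of_bounded S.isBounded 2
      (measurable_const.indicator hAm).aestronglyMeasurable (C := 1) fun x => by
        by_cases hx : x ∈ A <;> simp [hx])
    simp only [e] at h1
    rw [integral_add (hgi.mono_set (hA.trans hOΩ)) (hXi.mono_set (hA.trans hOΩ))]
    simp only [fun j => integral_add (hgi.mono_set (hA.trans hOΩ))
      ((hfi j).mono_set (hA.trans hOΩ))]
    exact h1.const_add _
  have key := ae_le_of_weak_convergence (H := H) hO
    ((measure_mono hOΩ).trans_lt S.isBounded.measure_lt_top)
    (fun x hx => S.continuous_slice (hOΩ hx)) (fun x hx => S.level x (hOΩ hx))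
    (U := fun j x => g₀ x + prim (prim (f j)) x) (P := fun j x => g₁ x + prim (f j) x)
    (X := fun j x => g₂ x + f j x) (U' := fun x => g₀ x + prim (prim X) x)
    (P' := fun x => g₁ x + prim X x) (Y := fun x => g₂ x + X x) (c := c) (B := B) hC₁
    (ae_of_all _ fun x => (S.tendsto_prim_prim hf hX0 hw hp hK hle x).const_add _)
    (ae_of_all _ fun x => (tendsto_prim_of_weak S.isBounded (fun j => (hf j).eq_zero)
      hX0 hw x).const_add _)
    (fun j => S.measurable₂.add (hf j).measurable)
    (fun j => (hgi.add (hfi j)).mono_set hOΩ) ((hgi.add hXi).mono_set hOΩ) hint hcoer hmeas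
  refine ⟨key.mono fun x hx => hx.1, (c + B) / C₁ + G, key.mono fun x hx => ?_⟩
  have h1 : |g₂ x + X x| ≤ (c + B) / C₁ := by
    rw [le_div_iff₀' hC₁]; exact hx.2
  have h2 := abs_sub (g₂ x + X x) (g₂ x)
  rw [add_sub_cancel_left] at h2
  linarith [(hG x).2.2]

/-- Weak limits of sequences of bounded energy stay in the Dirichlet class. -/
theorem exists_isBend_limit (S : JetProblem Ω H m M g₀ g₁ g₂) {f : ℕ → ℝ → ℝ}
    (hf : ∀ j, IsBend Ω (f j)) {X : ℝ → ℝ} (hX : MemLp X 2 (volume.restrict Ω))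
    (hw : ∀ k, MemLp k 2 (volume.restrict Ω) →
      Tendsto (fun j => ∫ x in Ω, f j x * k x) atTop (𝓝 (∫ x in Ω, X x * k x)))
    {p : ℕ → ℝ} (hp : ∀ j, 1 ≤ p j) (hpt : Tendsto p atTop atTop) {K : ℝ} (hK : 0 < K)
    (hle : ∀ᶠ j in atTop, lpMean Ω M (p j) (jetDensity H g₀ g₁ g₂ (f j)) ≤ ENNReal.ofReal K) :
    ∃ Φ, IsBend Ω Φ ∧ X =ᵐ[volume.restrict Ω] Φ := by
  have hΩ := S.isOpen.measurableSet
  set Y := Ω.indicator X with hYdef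
  have hXY : X =ᵐ[volume.restrict Ω] Y := (indicator_ae_eq_restrict hΩ).symm
  have hY : MemLp Y 2 (volume.restrict Ω) := (memLp_congr_ae hXY).1 hX
  have hY0 : ∀ x ∉ Ω, Y x = 0 := fun x hx => indicator_of_notMem hx _
  have hwY : ∀ k, MemLp k 2 (volume.restrict Ω) →
      Tendsto (fun j => ∫ x in Ω, f j x * k x) atTop (𝓝 (∫ x in Ω, Y x * k x)) := by
    intro k hk
    have e : ∫ x in Ω, Y x * k x = ∫ x in Ω, X x * k x :=
      integral_congr_ae (by filter_upwards [hXY] with x hx; rw [hx])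
    rw [e]
    exact hw k hk
  -- A mean of `M + H` bounded by `K` makes every level above `K - M` asymptotically negligible,
  -- since K^p/(M+c')^p → 0.
  have hmeas : ∀ c' > K - M, Tendsto (fun j => volume
      {x ∈ Ω | c' < jetDensity H g₀ g₁ g₂ (f j) x}) atTop (𝓝 0) := by
    intro c' hc'
    refine tendsto_measure_superlevel hΩ (fun j => S.aemeasurable_jetDensity (hf j)) (M := M)
      (by linarith) (fun j => one_pos.trans_le (hp j))
      (r := fun j => K ^ p j * (volume Ω).toReal) ?_ ?_
    · filter_upwards [hle] with j hj
      refine (lintegral_le_of_lpMean_le S.isBounded (one_pos.trans_le (hp j)) hj).trans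
        (le_of_eq ?_)
      rw [ENNReal.ofReal_mul (by positivity), ENNReal.ofReal_toReal S.isBounded.measure_lt_top.ne,
        ENNReal.ofReal_rpow_of_pos hK]
    · have := (tendsto_rpow_div_rpow (a := fun _ => K) (Eventually.of_forall fun _ => hK.le)
        tendsto_const_nhds (show K < M + c' by linarith) hpt).mul_const (volume Ω).toReal
      rw [zero_mul] at this
      refine this.congr fun j => ?_
      ring
  -- The weak limit is a priori only in L²; coercivity on the sublevel set makes it essentially
  -- bounded.
  obtain ⟨-, C, hC⟩ := S.ae_le_of_weak hf hY hY0 hwY hp hK hle hΩ le_rfl hmeas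
  obtain ⟨Φ, hΦm, hΦb, hΦ0, hYΦ⟩ := exists_bounded_rep hΩ (memLp_top_of_bound hY.1 C hC)
  have hap := BendApprox.of_weak_limit hΩ S.isBounded hf hY hY0 hwY
  refine ⟨Φ, ⟨hΦm, hΦb, hΦ0, hap.congr ?_⟩, hXY.trans hYΦ⟩
  have h1 := indicator_ae_eq_of_ae_restrict hΩ hYΦ
  have e1 : Ω.indicator Y = Y := by simp [Y]
  have e2 : Ω.indicator Φ = Φ := indicator_eq_self.2 fun x hx => by_contra fun h => hx (hΦ0 x h)
  rwa [e1, e2] at h1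

end JetProblem

/-! ### Local competitors -/

/-- Truncation to the interval commutes with taking primitives precisely because the primitive based
at `a` returns to zero at `b`. -/
theorem prim_indicator_Ioo {F u : ℝ → ℝ} {a b : ℝ} (hab : a < b)
    (hF : ∀ x ∈ Icc a b, ∫ t in a..x, u t = F x) (hFb : F b = 0) :
    prim ((Ioo a b).indicator u) = (Ioo a b).indicator F := by
  ext x
  rw [prim, setIntegral_indicator measurableSet_Ioo]
  rcases le_or_gt x a with h | h
  · have : Iic x ∩ Ioo a b = ∅ := by
      ext t; simp only [mem_inter_iff, mem_Iic, mem_Ioo, mem_empty_iff_false, iff_false]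
      rintro ⟨h1, h2, -⟩; linarith
    rw [this, indicator_of_notMem (fun hx => absurd hx.1 (not_lt.2 h))]
    simp
  rcases lt_or_ge x b with h' | h'
  · have : Iic x ∩ Ioo a b = Ioc a x := by
      ext t; simp only [mem_inter_iff, mem_Iic, mem_Ioo, mem_Ioc]
      constructor
      · rintro ⟨h1, h2, -⟩; exact ⟨h2, h1⟩
      · rintro ⟨h1, h2⟩; exact ⟨h2, h1, h2.trans_lt h'⟩
    rw [this, indicator_of_mem (show x ∈ Ioo a b from ⟨h, h'⟩), ← hF x ⟨h.le, h'.le⟩,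
      intervalIntegral.integral_of_le h.le]
  · have : Iic x ∩ Ioo a b = Ioo a b :=
      inter_eq_right.2 fun t ht => ht.2.le.trans h'
    rw [this, indicator_of_notMem (fun hx => absurd hx.2 (not_lt.2 h')), ← hFb,
      ← hF b ⟨hab.le, le_rfl⟩, intervalIntegral.integral_of_le hab.le, integral_Ioc_eq_integral_Ioo]

/-- A cubic with prescribed values and slopes at the end points of an interval. -/
theorem exists_hermite_cubic {a b : ℝ} (hab : a < b) : ∃ C : ℝ, 0 < C ∧ ∀ A A' D D' N : ℝ,
    |A| ≤ N → |A'| ≤ N → |D| ≤ N → |D'| ≤ N → ∃ q q₁ q₂ : ℝ → ℝ,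
      (∀ x, HasDerivAt q (q₁ x) x) ∧ (∀ x, HasDerivAt q₁ (q₂ x) x) ∧ Continuous q₁ ∧
      Continuous q₂ ∧ q a = A ∧ q₁ a = A' ∧ q b = D ∧ q₁ b = D' ∧
      ∀ x ∈ Icc a b, |q x| ≤ C * N ∧ |q₁ x| ≤ C * N ∧ |q₂ x| ≤ C * N := by
  set L := b - a with hL
  have hL0 : 0 < L := sub_pos.2 hab
  -- In the variable θ = (x - a)/L every coefficient of the cubic is at most T = 10(1 + L)N, so the
  -- cubic and its first two derivatives are bounded by 4T, 6T/L and 8T/L²; the constant is the sum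
  -- of the three factors.
  refine ⟨40 * (1 + L) + 60 * (1 + L) / L + 80 * (1 + L) / L ^ 2, by positivity, ?_⟩
  intro A A' D D' N h1 h2 h3 h4
  have hN : 0 ≤ N := (abs_nonneg _).trans h1
  set T := 10 * (1 + L) * N with hT
  have hLN : 0 ≤ L * N := by positivity
  obtain ⟨c₁, hc₁⟩ : ∃ c, c = L * A' := ⟨_, rfl⟩
  obtain ⟨c₂, hc₂⟩ : ∃ c, c = 3 * (D - A) - 2 * (L * A') - L * D' := ⟨_, rfl⟩
  obtain ⟨c₃, hc₃⟩ : ∃ c, c = 2 * (A - D) + L * A' + L * D' := ⟨_, rfl⟩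
  have k2 : |L * A'| ≤ L * N := by rw [abs_mul, abs_of_pos hL0]; gcongr
  have k4 : |L * D'| ≤ L * N := by rw [abs_mul, abs_of_pos hL0]; gcongr
  rw [abs_le] at h1 h3 k2 k4
  have hT' : T = 10 * N + 10 * (L * N) := by rw [hT]; ring
  have b0 : |A| ≤ T := by rw [abs_le]; constructor <;> linarith
  have b1 : |c₁| ≤ T := by rw [abs_le, hc₁]; constructor <;> linarith
  have b2 : |c₂| ≤ T := by rw [abs_le, hc₂]; constructor <;> linarith
  have b3 : |c₃| ≤ T := by rw [abs_le, hc₃]; constructor <;> linarith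
  have hT0 : 0 ≤ T := (abs_nonneg _).trans b0
  have hθ : ∀ x, HasDerivAt (fun x => (x - a) / L) (1 / L) x := fun x =>
    ((hasDerivAt_id x).sub_const a).div_const L
  refine ⟨fun x => A + c₁ * ((x - a) / L) + c₂ * ((x - a) / L) ^ 2 + c₃ * ((x - a) / L) ^ 3,
    fun x => (c₁ + 2 * c₂ * ((x - a) / L) + 3 * c₃ * ((x - a) / L) ^ 2) / L,
    fun x => (2 * c₂ + 6 * c₃ * ((x - a) / L)) / L ^ 2, fun x => ?_, fun x => ?_, by fun_prop,
    by fun_prop, by simp, ?_, ?_, ?_, fun x hx => ?_⟩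
  · convert! (((hθ x).const_mul c₁).const_add A).add (((hθ x).pow 2).const_mul c₂) |>.add
      (((hθ x).pow 3).const_mul c₃) using 1
    push_cast; field_simp
  · convert! ((((hθ x).const_mul (2 * c₂)).const_add c₁).add
      (((hθ x).pow 2).const_mul (3 * c₃))).div_const L using 1
    push_cast; field_simp; ring
  · simp [hc₁]; field_simp
  · have : (b - a) / L = 1 := div_self hL0.ne'
    simp only [this, hc₁, hc₂, hc₃]; ring
  · have : (b - a) / L = 1 := div_self hL0.ne'
    simp only [this, hc₁, hc₂, hc₃]; field_simp; ring
  · have t0 : 0 ≤ (x - a) / L := div_nonneg (sub_nonneg.2 hx.1) hL0.le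
    have t1 : (x - a) / L ≤ 1 := by rw [div_le_one hL0]; linarith [hx.2]
    set θ := (x - a) / L
    have s1 : ∀ c, |c| ≤ T → |c * θ| ≤ T := fun c hc => by
      rw [abs_mul, abs_of_nonneg t0]; nlinarith [abs_nonneg c]
    have s2 : ∀ c, |c| ≤ T → |c * θ ^ 2| ≤ T := fun c hc => by
      have := s1 _ (s1 c hc); rwa [mul_assoc, ← sq] at this
    have s3 : ∀ c, |c| ≤ T → |c * θ ^ 3| ≤ T := fun c hc => by
      have := s1 _ (s2 c hc); rwa [mul_assoc, ← pow_succ] at this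
    have r0 : 0 ≤ 60 * (1 + L) / L := by positivity
    have r1 : 0 ≤ 80 * (1 + L) / L ^ 2 := by positivity
    have r2 : 0 ≤ 40 * (1 + L) := by positivity
    refine ⟨?_, ?_, ?_⟩
    · refine le_trans (b := 4 * T) ?_ ?_
      · have u1 := abs_le.1 (s1 c₁ b1)
        have u2 := abs_le.1 (s2 c₂ b2)
        have u3 := abs_le.1 (s3 c₃ b3)
        have u0 := abs_le.1 b0
        rw [abs_le]; constructor <;> linarith
      · have : 4 * T = 40 * (1 + L) * N := by rw [hT]; ring
        rw [this, add_mul, add_mul]; linarith [mul_nonneg r0 hN, mul_nonneg r1 hN]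
    · refine le_trans (b := 6 * T / L) ?_ ?_
      · rw [abs_div, abs_of_pos hL0]
        gcongr
        have u1 := abs_le.1 b1
        have u2 := abs_le.1 (s1 c₂ b2)
        have u3 := abs_le.1 (s2 c₃ b3)
        rw [abs_le]; constructor <;> linarith
      · have : 6 * T / L = 60 * (1 + L) / L * N := by rw [hT]; ring
        rw [this, add_mul, add_mul]; linarith [mul_nonneg r2 hN, mul_nonneg r1 hN]
    · refine le_trans (b := 8 * T / L ^ 2) ?_ ?_
      · rw [abs_div, abs_of_pos (pow_pos hL0 2)]
        gcongr
        have u2 := abs_le.1 b2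
        have u3 := abs_le.1 (s1 c₃ b3)
        rw [abs_le]; constructor <;> linarith
      · have : 8 * T / L ^ 2 = 80 * (1 + L) / L ^ 2 * N := by rw [hT]; ring
        rw [this, add_mul, add_mul]; linarith [mul_nonneg r2 hN, mul_nonneg r0 hN]

/-- A function in `W^{2,∞}_0(Ω)` may be cut off outside an interval at the price of a cubic. -/
theorem exists_localization {Ω : Set ℝ} (hΩ : IsOpen Ω) (hΩb : Bornology.IsBounded Ω) {a b : ℝ}
    (hab : a < b) (hsub : Icc a b ⊆ Ω) : ∃ C : ℝ, 0 < C ∧ ∀ (E : ℝ → ℝ) (N : ℝ), IsBend Ω E →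
      |prim (prim E) a| ≤ N → |prim E a| ≤ N → |prim (prim E) b| ≤ N → |prim E b| ≤ N →
      ∃ q q₁ q₂ : ℝ → ℝ,
        IsBend Ω ((Ioo a b).indicator fun x => E x - q₂ x) ∧
        prim ((Ioo a b).indicator fun x => E x - q₂ x)
          = (Ioo a b).indicator (fun x => prim E x - q₁ x) ∧
        prim (prim ((Ioo a b).indicator fun x => E x - q₂ x))
          = (Ioo a b).indicator (fun x => prim (prim E) x - q x) ∧
        ∀ x ∈ Icc a b, |q x| ≤ C * N ∧ |q₁ x| ≤ C * N ∧ |q₂ x| ≤ C * N := by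
  obtain ⟨C, hC, hq⟩ := exists_hermite_cubic hab
  refine ⟨C, hC, fun E N hE h1 h2 h3 h4 => ?_⟩
  obtain ⟨q, q₁, q₂, d0, d1, c1, c2, e1, e2, e3, e4, hb⟩ := hq _ _ _ _ N h1 h2 h3 h4
  have iE := hE.integrable hΩb
  have iE1 := hE.integrable_prim hΩb
  have p1 : prim ((Ioo a b).indicator fun x => E x - q₂ x)
      = (Ioo a b).indicator (fun x => prim E x - q₁ x) := by
    refine prim_indicator_Ioo hab (fun x hx => ?_) (by simp [e4])
    rw [intervalIntegral.integral_sub iE.intervalIntegrable (c2.intervalIntegrable _ _),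
      ← prim_sub_prim iE, intervalIntegral.integral_eq_sub_of_hasDerivAt (fun t _ => d1 t)
        (c2.intervalIntegrable _ _), e2]
    ring
  have p2 : prim (prim ((Ioo a b).indicator fun x => E x - q₂ x))
      = (Ioo a b).indicator (fun x => prim (prim E) x - q x) := by
    rw [p1]
    refine prim_indicator_Ioo hab (fun x hx => ?_) (by simp [e3])
    rw [intervalIntegral.integral_sub iE1.intervalIntegrable (c1.intervalIntegrable _ _),
      ← prim_sub_prim iE1, intervalIntegral.integral_eq_sub_of_hasDerivAt (fun t _ => d0 t)
        (c1.intervalIntegrable _ _), e1]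
    ring
  refine ⟨q, q₁, q₂, ?_, p1, p2, hb⟩
  obtain ⟨B, hB⟩ := hE.bounded
  refine isBend_of_Ioo hΩ hab hsub
    ((hE.measurable.sub c2.measurable).indicator measurableSet_Ioo) ⟨B + C * N, fun x => ?_⟩
    (fun x hx => indicator_of_notMem hx _) (fun x hx => by rw [p1, indicator_of_notMem hx])
    (by rw [p2, indicator_of_notMem (by simp)])
  have hB0 : 0 ≤ B := (abs_nonneg _).trans (hB a)
  have hN : 0 ≤ N := (abs_nonneg _).trans h1
  by_cases hx : x ∈ Ioo a b
  · rw [indicator_of_mem hx]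
    exact (abs_sub _ _).trans (add_le_add (hB x) (hb x (Ioo_subset_Icc_self hx)).2.2)
  · rw [indicator_of_notMem hx, abs_zero]
    positivity

/-! ### Localised comparison of energies -/

theorem lpMean_eq_ofReal {Ω : Set ℝ} (hΩ : Bornology.IsBounded Ω) (h0 : volume Ω ≠ 0) {M p s : ℝ}
    (hp : 0 < p) (hs : 0 ≤ s) {J : ℝ → ℝ}
    (h : ∫⁻ x in Ω, ENNReal.ofReal (M + J x) ^ p = ENNReal.ofReal s) :
    lpMean Ω M p J = ENNReal.ofReal ((s / (volume Ω).toReal) ^ (1 / p)) := by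
  have hD : 0 < (volume Ω).toReal := ENNReal.toReal_pos h0 hΩ.measure_lt_top.ne
  rw [lpMean, laverage_eq, Measure.restrict_apply_univ, h,
    ← ENNReal.ofReal_rpow_of_nonneg (by positivity) (by positivity), ENNReal.ofReal_div_of_pos hD,
    ENNReal.ofReal_toReal hΩ.measure_lt_top.ne]

/-- After raising to the power `p` the comparison is additive over the domain, so the parts outside
`I`, where the densities agree, cancel. What remains on `I` is the competitor's share plus the error
produced by the tolerance `e`. -/
theorem lintegral_le_of_lpMean_comparison {Ω I : Set ℝ} (hΩ : Bornology.IsBounded Ω)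
    (hI : MeasurableSet I) (hIΩ : I ⊆ Ω) (h0 : volume Ω ≠ 0) {M p e c K : ℝ} (hp : 1 ≤ p)
    (he : 0 < e) (he1 : e ≤ 1) (hK : 0 < K) (hc : 0 ≤ M + c) {J J' : ℝ → ℝ}
    (hJ : ∀ x ∈ Ω \ I, J' x = J x) (hΩm : MeasurableSet Ω)
    (hJ' : ∀ᵐ x ∂(volume.restrict I), J' x ≤ c) (hle : lpMean Ω M p J ≤ ENNReal.ofReal K)
    (hmin : lpMean Ω M p J ≤ ENNReal.ofReal e + lpMean Ω M p J') :
    ∫⁻ x in I, ENNReal.ofReal (M + J x) ^ p ≤ ENNReal.ofReal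
      ((volume Ω).toReal * (M + c) ^ p
        + (volume Ω).toReal * (p * e * (M + c + K + 1) ^ p)) := by
  have hp0 : 0 < p := one_pos.trans_le hp
  set D := (volume Ω).toReal with hDdef
  have hD : 0 < D := ENNReal.toReal_pos h0 hΩ.measure_lt_top.ne
  have hv : volume Ω = ENNReal.ofReal D := (ENNReal.ofReal_toReal hΩ.measure_lt_top.ne).symm
  have split : ∀ F : ℝ → ℝ≥0∞, ∫⁻ x in Ω, F x = (∫⁻ x in I, F x) + ∫⁻ x in Ω \ I, F x := fun F => by
    rw [← lintegral_inter_add_sdiff F Ω hI, inter_eq_right.2 hIΩ]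
  have eT : ∫⁻ x in Ω \ I, ENNReal.ofReal (M + J' x) ^ p
      = ∫⁻ x in Ω \ I, ENNReal.ofReal (M + J x) ^ p :=
    setLIntegral_congr_fun (hΩm.diff hI) fun x hx => by simp only [hJ x hx]
  have hF : ∫⁻ x in Ω, ENNReal.ofReal (M + J x) ^ p ≤ ENNReal.ofReal (K ^ p * D) := by
    refine (lintegral_le_of_lpMean_le hΩ hp0 hle).trans (le_of_eq ?_)
    rw [ENNReal.ofReal_mul (by positivity), hv, ENNReal.ofReal_rpow_of_pos hK]
  have hG : ∫⁻ x in I, ENNReal.ofReal (M + J' x) ^ p ≤ ENNReal.ofReal ((M + c) ^ p * D) := by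
    calc _ ≤ ∫⁻ _ in I, ENNReal.ofReal (M + c) ^ p := by
          refine lintegral_mono_ae ?_
          filter_upwards [hJ'] with x hx
          gcongr
      _ = ENNReal.ofReal (M + c) ^ p * volume I := by simp
      _ ≤ ENNReal.ofReal (M + c) ^ p * volume Ω := by gcongr
      _ = _ := by
        rw [ENNReal.ofReal_mul (by positivity), hv, ENNReal.ofReal_rpow_of_nonneg hc hp0.le]
  have hsplitF := split fun x => ENNReal.ofReal (M + J x) ^ p
  have hsplitG := split fun x => ENNReal.ofReal (M + J' x) ^ p
  rw [eT] at hsplitG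
  set SF := ∫⁻ x in I, ENNReal.ofReal (M + J x) ^ p
  set SG := ∫⁻ x in I, ENNReal.ofReal (M + J' x) ^ p
  set T := ∫⁻ x in Ω \ I, ENNReal.ofReal (M + J x) ^ p
  have hTF : SF + T ≤ ENNReal.ofReal (K ^ p * D) := hsplitF.symm.trans_le hF
  have fF : SF ≠ ⊤ := ne_top_of_le_ne_top ENNReal.ofReal_ne_top (le_self_add.trans hTF)
  have fT : T ≠ ⊤ := ne_top_of_le_ne_top ENNReal.ofReal_ne_top (le_add_self.trans hTF)
  have fG : SG ≠ ⊤ := ne_top_of_le_ne_top ENNReal.ofReal_ne_top hG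
  -- All three integrals are finite, so the cancellation can be done in the reals.
  obtain ⟨sF, sF0, rF⟩ : ∃ s : ℝ, 0 ≤ s ∧ SF = ENNReal.ofReal s :=
    ⟨SF.toReal, ENNReal.toReal_nonneg, (ENNReal.ofReal_toReal fF).symm⟩
  obtain ⟨sG, sG0, rG⟩ : ∃ s : ℝ, 0 ≤ s ∧ SG = ENNReal.ofReal s :=
    ⟨SG.toReal, ENNReal.toReal_nonneg, (ENNReal.ofReal_toReal fG).symm⟩
  obtain ⟨t, t0, rT⟩ : ∃ s : ℝ, 0 ≤ s ∧ T = ENNReal.ofReal s :=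
    ⟨T.toReal, ENNReal.toReal_nonneg, (ENNReal.ofReal_toReal fT).symm⟩
  rw [rF, rT, ← ENNReal.ofReal_add sF0 t0] at hsplitF
  rw [rG, rT, ← ENNReal.ofReal_add sG0 t0] at hsplitG
  rw [rF, rT, ← ENNReal.ofReal_add sF0 t0, ENNReal.ofReal_le_ofReal_iff (by positivity)] at hTF
  rw [rG, ENNReal.ofReal_le_ofReal_iff (by positivity)] at hG
  rw [lpMean_eq_ofReal hΩ h0 hp0 (by positivity) hsplitF,
    lpMean_eq_ofReal hΩ h0 hp0 (by positivity) hsplitG,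
    ← ENNReal.ofReal_add he.le (by positivity), ENNReal.ofReal_le_ofReal_iff (by positivity)]
    at hmin
  rw [rF]
  refine ENNReal.ofReal_le_ofReal ?_
  set x := (sF + t) / D with hx
  set y := (sG + t) / D with hy
  have hx0 : 0 ≤ x := by positivity
  have hy0 : 0 ≤ y := by positivity
  set β := y ^ (1 / p) with hβ
  have hβ0 : 0 ≤ β := by positivity
  have eβ : β ^ p = y := by rw [hβ, ← Real.rpow_mul hy0, one_div_mul_cancel hp0.ne', Real.rpow_one]
  have hxβ : x ≤ (e + β) ^ p := by
    have := Real.rpow_le_rpow (by positivity) hmin hp0.le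
    rwa [← Real.rpow_mul hx0, one_div_mul_cancel hp0.ne', Real.rpow_one] at this
  -- The part on `I` contributes at most (M+c)^p and the rest at most K^p; superadditivity of the
  -- p-th power combines them.
  have hyK : y ≤ (M + c + K) ^ p := by
    refine le_trans ?_ (Real.add_rpow_le_rpow_add hc hK.le hp)
    rw [hy, div_le_iff₀ hD]
    linarith
  have hβK : β ≤ M + c + K := by
    rw [← eβ] at hyK
    exact (Real.rpow_le_rpow_iff hβ0 (by positivity) hp0).1 hyK
  -- The extra 1 absorbs `e` and makes the base at least 1, so that the exponent may be raised to
  -- `p`.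
  have hb : (e + β) ^ (p - 1) ≤ (M + c + K + 1) ^ p := by
    refine (Real.rpow_le_rpow (by positivity) (show e + β ≤ M + c + K + 1 by linarith)
      (by linarith)).trans (Real.rpow_le_rpow_of_exponent_le (by linarith) (by linarith))
  have h1 := add_rpow_le_add_mul hβ0 he hp
  have h2 : x ≤ y + p * e * (M + c + K + 1) ^ p := by
    rw [eβ] at h1
    have : p * e * (e + β) ^ (p - 1) ≤ p * e * (M + c + K + 1) ^ p := by gcongr
    linarith
  have ex : D * x = sF + t := by rw [hx]; field_simp
  have ey : D * y = sG + t := by rw [hy]; field_simp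
  have h3 := mul_le_mul_of_nonneg_left h2 hD.le
  rw [mul_add, ex, ey] at h3
  linarith

theorem BendApprox.mono {O O' : Set ℝ} {h : ℝ → ℝ} (hh : BendApprox O h) (hO : O ⊆ O') :
    BendApprox O' h := fun δ hδ =>
  let ⟨ψ, hψ, h1⟩ := hh δ hδ
  ⟨ψ, hψ.mono hO, h1⟩

theorem IsBend.mono {O O' : Set ℝ} {h : ℝ → ℝ} (hh : IsBend O h) (hO : O ⊆ O') : IsBend O' h :=
  ⟨hh.measurable, hh.bounded, fun x hx => hh.eq_zero x fun hx' => hx (hO hx'), hh.approx.mono hO⟩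

theorem prim_prim_add {Ω : Set ℝ} (hΩ : Bornology.IsBounded Ω) {h k : ℝ → ℝ} (hh : IsBend Ω h)
    (hk : IsBend Ω k) :
    (prim fun t => h t + k t) = (fun x => prim h x + prim k x) ∧
    prim (prim fun t => h t + k t) = fun x => prim (prim h) x + prim (prim k) x := by
  have e : (prim fun t => h t + k t) = fun x => prim h x + prim k x :=
    funext fun x => prim_add (hh.integrable hΩ) (hk.integrable hΩ) x
  refine ⟨e, ?_⟩
  rw [e]
  exact funext fun x => prim_add (hh.integrable_prim hΩ) (hk.integrable_prim hΩ) x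

theorem prim_prim_sub {Ω : Set ℝ} (hΩ : Bornology.IsBounded Ω) {h k : ℝ → ℝ} (hh : IsBend Ω h)
    (hk : IsBend Ω k) :
    (prim fun t => h t - k t) = (fun x => prim h x - prim k x) ∧
    prim (prim fun t => h t - k t) = fun x => prim (prim h) x - prim (prim k) x := by
  have e : (prim fun t => h t - k t) = fun x => prim h x - prim k x :=
    funext fun x => prim_sub (hh.integrable hΩ) (hk.integrable hΩ) x
  refine ⟨e, ?_⟩
  rw [e]
  exact funext fun x => prim_sub (hh.integrable_prim hΩ) (hk.integrable_prim hΩ) x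

/-! ### Comparison of approximate minimisers with competitors -/

namespace JetProblem

variable {Ω : Set ℝ} {H : ℝ → ℝ → ℝ → ℝ → ℝ} {m M : ℝ} {g₀ g₁ g₂ : ℝ → ℝ}

theorem exists_jet_bound (S : JetProblem Ω H m M g₀ g₁ g₂) {W : ℝ → ℝ} (hW : IsBend Ω W) :
    ∃ R : ℝ, ∀ x, |g₀ x + prim (prim W) x| ≤ R ∧ |g₁ x + prim W x| ≤ R ∧ |g₂ x + W x| ≤ R := by
  obtain ⟨G, hG⟩ := S.bounded
  obtain ⟨B, hB⟩ := hW.bounded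
  have b1 := abs_prim_le (hW.integrable S.isBounded)
  have b0 := abs_prim_le (hW.integrable_prim S.isBounded)
  have hB0 : 0 ≤ B := (abs_nonneg _).trans (hB 0)
  have h1 : 0 ≤ ∫ t, |W t| := integral_nonneg fun _ => abs_nonneg _
  have h2 : 0 ≤ ∫ t, |prim W t| := integral_nonneg fun _ => abs_nonneg _
  refine ⟨G + B + (∫ t, |W t|) + ∫ t, |prim W t|, fun x => ⟨?_, ?_, ?_⟩⟩
  · linarith [abs_add_le (g₀ x) (prim (prim W) x), b0 x, (hG x).1]
  · linarith [abs_add_le (g₁ x) (prim W x), b1 x, (hG x).2.1]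
  · linarith [abs_add_le (g₂ x) (W x), hB x, (hG x).2.2]

/-- Uniform continuity of the density under small perturbations of the jet. -/
theorem exists_perturbation (S : JetProblem Ω H m M g₀ g₁ g₂) {a b : ℝ} (hsub : Icc a b ⊆ Ω)
    {W : ℝ → ℝ} (hW : IsBend Ω W) {η : ℝ} (hη : 0 < η) : ∃ δ > 0, ∀ x ∈ Icc a b,
      ∀ y z w : ℝ, |y| ≤ δ → |z| ≤ δ → |w| ≤ δ →
        H x (g₀ x + prim (prim W) x - y) (g₁ x + prim W x - z) (g₂ x + W x - w)
          ≤ jetDensity H g₀ g₁ g₂ W x + η := by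
  obtain ⟨R, hR⟩ := S.exists_jet_bound hW
  -- The box is enlarged by 1, so jets perturbed by at most 1 remain in it.
  set Q : Set (ℝ × ℝ × ℝ × ℝ) := Icc a b ×ˢ (Icc (-(R + 1)) (R + 1) ×ˢ
    (Icc (-(R + 1)) (R + 1) ×ˢ Icc (-(R + 1)) (R + 1))) with hQ
  have hQc : IsCompact Q := isCompact_Icc.prod (isCompact_Icc.prod (isCompact_Icc.prod isCompact_Icc))
  have hQs : Q ⊆ Ω ×ˢ (univ : Set (ℝ × ℝ × ℝ)) := fun z hz => ⟨hsub hz.1, mem_univ _⟩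
  have huc := hQc.uniformContinuousOn_of_continuous (S.cont.mono hQs)
  obtain ⟨δ, hδ, h1⟩ := Metric.uniformContinuousOn_iff.1 huc η hη
  refine ⟨min (δ / 2) 1, by positivity, fun x hx y z w hy hz hw => ?_⟩
  have hmem : ∀ r v : ℝ, |r| ≤ R → |v| ≤ min (δ / 2) 1 → r - v ∈ Icc (-(R + 1)) (R + 1) := by
    intro r v hr hv
    have h2 := abs_le.1 (hv.trans (min_le_right _ _))
    have h3 := abs_le.1 hr
    constructor <;> linarith
  have hmem0 : ∀ r : ℝ, |r| ≤ R → r ∈ Icc (-(R + 1)) (R + 1) := by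
    intro r hr
    have h3 := abs_le.1 hr
    constructor <;> linarith
  have hd : ∀ r v : ℝ, |v| ≤ min (δ / 2) 1 → dist (r - v) r < δ := by
    intro r v hv
    rw [Real.dist_eq, sub_sub_cancel_left, abs_neg]
    linarith [hv.trans (min_le_left _ _)]
  obtain ⟨r0, r1, r2⟩ := hR x
  have h4 := h1 (x, g₀ x + prim (prim W) x - y, g₁ x + prim W x - z, g₂ x + W x - w)
    ⟨hx, hmem _ _ r0 hy, hmem _ _ r1 hz, hmem _ _ r2 hw⟩
    (x, g₀ x + prim (prim W) x, g₁ x + prim W x, g₂ x + W x)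
    ⟨hx, hmem0 _ r0, hmem0 _ r1, hmem0 _ r2⟩ (by
      simp only [Prod.dist_eq, dist_self]
      exact max_lt hδ (max_lt (hd _ _ hy) (max_lt (hd _ _ hz) (hd _ _ hw))))
  rw [Real.dist_eq] at h4
  simp only at h4
  rw [jetDensity]
  linarith [(abs_lt.1 h4).2]

/-- On an interval compactly inside `Ω`, approximate minimisers asymptotically do not exceed the
energy of any competitor with the same boundary jet as their limit. -/
theorem tendsto_measure_local (S : JetProblem Ω H m M g₀ g₁ g₂) {f : ℕ → ℝ → ℝ}
    (hf : ∀ j, IsBend Ω (f j)) {Φ : ℝ → ℝ} (hΦ : IsBend Ω Φ)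
    (ht1 : ∀ x, Tendsto (fun j => prim (f j) x) atTop (𝓝 (prim Φ x)))
    (ht0 : ∀ x, Tendsto (fun j => prim (prim (f j)) x) atTop (𝓝 (prim (prim Φ) x)))
    {p e : ℕ → ℝ} (hp : ∀ j, 1 ≤ p j) (hpt : Tendsto p atTop atTop) (he : ∀ j, 0 < e j)
    (he1 : ∀ᶠ j in atTop, e j ≤ 1) (het : Tendsto (fun j => e j ^ (1 / p j)) atTop (𝓝 0))
    {K : ℝ} (hK : 0 < K)
    (hle : ∀ᶠ j in atTop, lpMean Ω M (p j) (jetDensity H g₀ g₁ g₂ (f j)) ≤ ENNReal.ofReal K)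
    (hmin : ∀ j v, IsBend Ω v → lpMean Ω M (p j) (jetDensity H g₀ g₁ g₂ (f j))
      ≤ ENNReal.ofReal (e j) + lpMean Ω M (p j) (jetDensity H g₀ g₁ g₂ v))
    {a b : ℝ} (hab : a < b) (hsub : Icc a b ⊆ Ω) {k : ℝ → ℝ} (hk : IsBend Ω k)
    (ha1 : prim k a = 0) (hb1 : prim k b = 0) (ha0 : prim (prim k) a = 0)
    (hb0 : prim (prim k) b = 0) {c : ℝ} (hcm : -m ≤ c)
    (hc : ∀ᵐ x ∂(volume.restrict (Ioo a b)),
      jetDensity H g₀ g₁ g₂ (fun x => Φ x + k x) x ≤ c) {c' : ℝ} (hc' : c < c') :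
    Tendsto (fun j => volume {x ∈ Ioo a b | c' < jetDensity H g₀ g₁ g₂ (f j) x}) atTop (𝓝 0) := by
  have hIΩ : Ioo a b ⊆ Ω := Ioo_subset_Icc_self.trans hsub
  have hMc : 0 < M + c := by linarith [S.lt]
  -- The gap from `c` to `c₁` pays for the cubic perturbation, the gap from `c₁` to `c'` for the
  -- geometric decay.
  set c₁ := (c + c') / 2 with hc₁
  have hW := hΦ.add hk S.isBounded
  obtain ⟨W1, W0⟩ := prim_prim_add S.isBounded hΦ hk
  set W := fun x => Φ x + k x with hWdef
  obtain ⟨C, hC, hloc⟩ := exists_localization S.isOpen S.isBounded hab hsub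
  obtain ⟨δ, hδ, hpert⟩ := S.exists_perturbation hsub hW (show 0 < c₁ - c by linarith)
  let E : ℕ → ℝ → ℝ := fun j x => W x - f j x
  have hE : ∀ j, IsBend Ω (E j) := fun j => hW.sub (hf j) S.isBounded
  have pE : ∀ j, prim (E j) = (fun x => prim W x - prim (f j) x) ∧
      prim (prim (E j)) = fun x => prim (prim W) x - prim (prim (f j)) x :=
    fun j => prim_prim_sub S.isBounded hW (hf j)
  let N : ℕ → ℝ := fun j => |prim (prim (E j)) a| + |prim (E j) a| + |prim (prim (E j)) b|
    + |prim (E j) b|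
  -- Since `k` vanishes to first order at `a` and `b`, the end-point jet of `W - f j` tends to that
  -- of `Φ - Φ`, which is zero.
  have hN : Tendsto (fun j => C * N j) atTop (𝓝 0) := by
    have z1 : ∀ x, prim k x = 0 → Tendsto (fun j => |prim (E j) x|) atTop (𝓝 0) := by
      intro x hx
      have h1 := ((ht1 x).const_sub (prim Φ x)).abs
      simp only [sub_self, abs_zero] at h1
      refine h1.congr fun j => ?_
      rw [(pE j).1, W1]; simp only [hx, add_zero]
    have z0 : ∀ x, prim (prim k) x = 0 → Tendsto (fun j => |prim (prim (E j)) x|) atTop (𝓝 0) := by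
      intro x hx
      have h1 := ((ht0 x).const_sub (prim (prim Φ) x)).abs
      simp only [sub_self, abs_zero] at h1
      refine h1.congr fun j => ?_
      rw [(pE j).2, W0]; simp only [hx, add_zero]
    simpa using ((((z0 a ha0).add (z1 a ha1)).add (z0 b hb0)).add (z1 b hb1)).const_mul C
  -- The competitor adds the localised difference to `f j`: it has the jet of `W` minus the small
  -- cubic inside the interval and the jet of `f j` outside.
  have hcomp : ∀ j, C * N j ≤ δ → ∃ v, IsBend Ω v ∧
      (∀ x ∈ Ω \ Ioo a b, jetDensity H g₀ g₁ g₂ v x = jetDensity H g₀ g₁ g₂ (f j) x) ∧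
      ∀ᵐ x ∂(volume.restrict (Ioo a b)), jetDensity H g₀ g₁ g₂ v x ≤ c₁ := by
    intro j hj
    have n1 := abs_nonneg (prim (prim (E j)) a)
    have n2 := abs_nonneg (prim (E j) a)
    have n3 := abs_nonneg (prim (prim (E j)) b)
    have n4 := abs_nonneg (prim (E j) b)
    obtain ⟨q, q₁, q₂, hq, hq1, hq0, hqb⟩ := hloc (E j) (N j) (hE j)
      (by simp only [N]; linarith) (by simp only [N]; linarith) (by simp only [N]; linarith)
      (by simp only [N]; linarith)
    obtain ⟨V1, V0⟩ := prim_prim_add S.isBounded (hf j) hq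
    refine ⟨_, (hf j).add hq S.isBounded, fun x hx => ?_, ?_⟩
    · rw [jetDensity, V0, V1, hq0, hq1]
      simp only [indicator_of_notMem hx.2, add_zero]
      rfl
    · filter_upwards [hc, ae_restrict_mem measurableSet_Ioo] with x hxc hx
      have hxI := Ioo_subset_Icc_self hx
      obtain ⟨b0, b1, b2⟩ := hqb x hxI
      have h1 := hpert x hxI (q x) (q₁ x) (q₂ x) (b0.trans hj) (b1.trans hj) (b2.trans hj)
      rw [jetDensity, V0, V1, hq0, hq1]
      obtain ⟨P1, P0⟩ := pE j
      rw [P0, P1]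
      simp only [indicator_of_mem hx]
      have e0 : g₀ x + (prim (prim (f j)) x + (prim (prim W) x - prim (prim (f j)) x - q x))
          = g₀ x + prim (prim W) x - q x := by ring
      have e1 : g₁ x + (prim (f j) x + (prim W x - prim (f j) x - q₁ x))
          = g₁ x + prim W x - q₁ x := by ring
      have e2 : g₂ x + (f j x + (E j x - q₂ x)) = g₂ x + W x - q₂ x := by simp only [E]; ring
      rw [e0, e1, e2]
      linarith
  have hvol : volume Ω ≠ 0 := by
    have h1 : 0 < volume (Ioo a b) := by rw [Real.volume_Ioo]; simpa using hab
    exact (h1.trans_le (measure_mono hIΩ)).ne'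
  have hb : 0 < M + c' := by linarith
  refine tendsto_measure_superlevel measurableSet_Ioo (fun j =>
    (S.aemeasurable_jetDensity (hf j)).mono_measure (Measure.restrict_mono hIΩ le_rfl)) (M := M) hb
    (fun j => one_pos.trans_le (hp j))
    (r := fun j => (volume Ω).toReal * (M + c₁) ^ p j
        + (volume Ω).toReal * (p j * e j * (M + c₁ + K + 1) ^ p j)) ?_ ?_
  · filter_upwards [hle, he1, hN.eventually (ge_mem_nhds hδ)] with j h1 h2 h3
    obtain ⟨v, hv, hv1, hv2⟩ := hcomp j h3
    exact lintegral_le_of_lpMean_comparison S.isBounded measurableSet_Ioo hIΩ hvol (hp j) (he j) h2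
      hK (by linarith) hv1 S.isOpen.measurableSet hv2 h1 (hmin j v hv)
  · have l1 := (tendsto_rpow_div_rpow (a := fun _ => M + c₁) (b := M + c')
      (Eventually.of_forall fun _ => by linarith) tendsto_const_nhds (by linarith) hpt).const_mul
      (volume Ω).toReal
    have l2 := (tendsto_mul_rpow_div_rpow (L := M + c₁ + K + 1) he (by linarith) hb hpt het).const_mul
      (volume Ω).toReal
    have l3 := l1.add l2
    simp only [mul_zero, add_zero] at l3
    refine l3.congr fun j => ?_
    ring

/-- Global version of the previous estimate. -/
theorem tendsto_measure_global (S : JetProblem Ω H m M g₀ g₁ g₂) {f : ℕ → ℝ → ℝ}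
    (hf : ∀ j, IsBend Ω (f j))
    {p e : ℕ → ℝ} (hp : ∀ j, 1 ≤ p j) (hpt : Tendsto p atTop atTop) (he : ∀ j, 0 < e j)
    (het : Tendsto e atTop (𝓝 0))
    (hmin : ∀ j v, IsBend Ω v → lpMean Ω M (p j) (jetDensity H g₀ g₁ g₂ (f j))
      ≤ ENNReal.ofReal (e j) + lpMean Ω M (p j) (jetDensity H g₀ g₁ g₂ v))
    {v : ℝ → ℝ} (hv : IsBend Ω v) {c : ℝ} (hcm : -m ≤ c)
    (hc : ∀ᵐ x ∂(volume.restrict Ω), jetDensity H g₀ g₁ g₂ v x ≤ c) {c' : ℝ} (hc' : c < c') :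
    Tendsto (fun j => volume {x ∈ Ω | c' < jetDensity H g₀ g₁ g₂ (f j) x}) atTop (𝓝 0) := by
  have hMc : 0 < M + c := by linarith [S.lt]
  refine tendsto_measure_superlevel S.isOpen.measurableSet (fun j =>
    S.aemeasurable_jetDensity (hf j)) (M := M) (by linarith)
    (fun j => one_pos.trans_le (hp j))
    (r := fun j => (e j + (M + c)) ^ p j * (volume Ω).toReal) (Eventually.of_forall fun j => ?_) ?_
  · have h0 := he j
    have h1 : lpMean Ω M (p j) (jetDensity H g₀ g₁ g₂ (f j)) ≤ ENNReal.ofReal (e j + (M + c)) := by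
      rw [ENNReal.ofReal_add h0.le hMc.le]
      refine (hmin j v hv).trans ?_
      gcongr
      exact lpMean_le_of_ae_le S.isBounded (one_pos.trans_le (hp j)) hc
    refine (lintegral_le_of_lpMean_le S.isBounded (one_pos.trans_le (hp j)) h1).trans (le_of_eq ?_)
    rw [ENNReal.ofReal_mul (by positivity), ENNReal.ofReal_toReal S.isBounded.measure_lt_top.ne,
      ENNReal.ofReal_rpow_of_pos (by positivity)]
  · have h1 : Tendsto (fun j => e j + (M + c)) atTop (𝓝 (M + c)) := by
      simpa using het.add_const (M + c)
    have := (tendsto_rpow_div_rpow (b := M + c')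
      (Eventually.of_forall fun j => by linarith [he j]) h1 (by linarith) hpt).mul_const
      (volume Ω).toReal
    rw [zero_mul] at this
    refine this.congr fun j => ?_
    ring

end JetProblem

/-! ### Energies as extended real numbers -/

theorem alongJet_ae_eq {O : Set ℝ} (hO : IsOpen O) (H : ℝ → ℝ → ℝ → ℝ → ℝ) {u u₀ u₁ u₂ : ℝ → ℝ}
    (h0 : u =ᵐ[volume.restrict O] u₀) (h1 : IsWeakDeriv O u u₁) (h2 : IsWeakDeriv O u₁ u₂) :
    alongJet H u O =ᵐ[volume.restrict O] fun x => H x (u₀ x) (u₁ x) (u₂ x) := by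
  filter_upwards [h0, h1.weakDeriv_ae_eq hO, h1.weakDeriv2_ae_eq hO h2] with x e0 e1 e2
  rw [alongJet, e0, e1, e2]

/-- A strict inequality the other way would leave room for a real level between the two essential
suprema, so infinite values need no separate treatment. -/
theorem supEnergy_le_supEnergy {H : ℝ → ℝ → ℝ → ℝ → ℝ} {O : Set ℝ} {u w : ℝ → ℝ}
    (h : ∀ c : ℝ, (∀ᵐ x ∂(volume.restrict O), alongJet H w O x ≤ c) →
      ∀ᵐ x ∂(volume.restrict O), alongJet H u O x ≤ c) :
    supEnergy H u O ≤ supEnergy H w O := by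
  by_contra hlt
  obtain ⟨c, h1, h2⟩ := EReal.lt_iff_exists_real_btwn.1 (not_le.1 hlt)
  have h3 := h c (by
    filter_upwards [ae_lt_of_essSup_lt h1] with x hx
    exact_mod_cast hx.le)
  refine absurd h2 (not_lt.2 (essSup_le_of_ae_le _ ?_))
  filter_upwards [h3] with x hx
  exact_mod_cast hx

theorem ennreal_le_of_ereal_sub_le {A B : ℝ≥0∞} {M e : ℝ} (he : 0 ≤ e)
    (h : (A : EReal) - (M : EReal) ≤ (e : EReal) + ((B : EReal) - (M : EReal))) :
    A ≤ ENNReal.ofReal e + B := by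
  rcases eq_or_ne B ⊤ with rfl | hB
  · simp
  lift B to NNReal using hB
  rcases eq_or_ne A ⊤ with rfl | hA
  · exfalso
    have e1 : ((B : ℝ≥0∞) : EReal) = ((B : ℝ) : EReal) := rfl
    rw [e1, ← EReal.coe_sub, ← EReal.coe_add, EReal.coe_ennreal_top, EReal.top_sub_coe] at h
    exact absurd h (not_le.2 (EReal.coe_lt_top _))
  lift A to NNReal using hA
  have e1 : ((B : ℝ≥0∞) : EReal) = ((B : ℝ) : EReal) := rfl
  have e2 : ((A : ℝ≥0∞) : EReal) = ((A : ℝ) : EReal) := rfl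
  rw [e1, e2, ← EReal.coe_sub, ← EReal.coe_sub, ← EReal.coe_add, EReal.coe_le_coe_iff] at h
  have h1 : (A : ℝ) ≤ e + B := by linarith
  rw [← ENNReal.ofReal_coe_nnreal (p := A), ← ENNReal.ofReal_coe_nnreal (p := B),
    ← ENNReal.ofReal_add he (NNReal.coe_nonneg B)]
  exact ENNReal.ofReal_le_ofReal h1

theorem lpEnergy_eq {Ω : Set ℝ} {H : ℝ → ℝ → ℝ → ℝ → ℝ} {M p : ℝ} {u J : ℝ → ℝ}
    (h : alongJet H u Ω =ᵐ[volume.restrict Ω] J) :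
    lpEnergy H M p u Ω = (lpMean Ω M p J : EReal) - (M : EReal) := by
  rw [lpEnergy, lpMean]
  congr 3
  refine laverage_congr ?_
  filter_upwards [h] with x hx
  rw [hx]

theorem tendsto_zero_of_rpow_inv {e p : ℕ → ℝ} (he : ∀ j, 0 < e j) (hp : Tendsto p atTop atTop)
    (h : Tendsto (fun j => e j ^ (1 / p j)) atTop (𝓝 0)) : Tendsto e atTop (𝓝 0) := by
  refine squeeze_zero' (g := fun j => (1 / 2 : ℝ) ^ p j)
    (Eventually.of_forall fun j => (he j).le) ?_
    ((tendsto_rpow_atTop_of_base_lt_one _ (by norm_num) (by norm_num)).comp hp)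
  filter_upwards [hp.eventually_gt_atTop 0,
    h.eventually (gt_mem_nhds (show (0 : ℝ) < 1 / 2 by norm_num))] with j h1 h2
  have := Real.rpow_le_rpow (Real.rpow_nonneg (he j).le _) h2.le h1.le
  rwa [← Real.rpow_mul (he j).le, one_div_mul_cancel h1.ne', Real.rpow_one] at this

/-- The end points are the nearest points of the complement on either side, which exist because `O`
is bounded and open. -/
theorem exists_component {O : Set ℝ} (hO : IsOpen O) (hb : Bornology.IsBounded O) {x : ℝ}
    (hx : x ∈ O) : ∃ a b, x ∈ Ioo a b ∧ Ioo a b ⊆ O ∧ a ∉ O ∧ b ∉ O := by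
  obtain ⟨R, hR⟩ := hb.subset_closedBall 0
  have hR' : ∀ y ∈ O, |y| ≤ R := fun y hy => by simpa using hR hy
  have hxR := abs_le.1 (hR' x hx)
  have c1 : IsClosed (Iic x ∩ Oᶜ) := isClosed_Iic.inter hO.isClosed_compl
  have c2 : IsClosed (Ici x ∩ Oᶜ) := isClosed_Ici.inter hO.isClosed_compl
  have n1 : (Iic x ∩ Oᶜ).Nonempty := ⟨-R - 1, by simp only [mem_Iic]; linarith,
    fun h => by linarith [(abs_le.1 (hR' _ h)).1]⟩
  have n2 : (Ici x ∩ Oᶜ).Nonempty := ⟨R + 1, by simp only [mem_Ici]; linarith,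
    fun h => by linarith [(abs_le.1 (hR' _ h)).2]⟩
  have b1 : BddAbove (Iic x ∩ Oᶜ) := ⟨x, fun y hy => hy.1⟩
  have b2 : BddBelow (Ici x ∩ Oᶜ) := ⟨x, fun y hy => hy.1⟩
  have m1 := c1.csSup_mem n1 b1
  have m2 := c2.csInf_mem n2 b2
  refine ⟨sSup (Iic x ∩ Oᶜ), sInf (Ici x ∩ Oᶜ), ⟨lt_of_le_of_ne m1.1 fun h => m1.2 (by rw [h]; exact hx),
    lt_of_le_of_ne m2.1 fun h => m2.2 (by rw [← h]; exact hx)⟩, fun y hy => by_contra fun hyO => ?_, m1.2, m2.2⟩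
  rcases le_total y x with h | h
  · exact absurd (le_csSup b1 ⟨h, hyO⟩) (not_le.2 hy.1)
  · exact absurd (csInf_le b2 ⟨h, hyO⟩) (not_le.2 hy.2)

/-! ### Weak convergence in `L^q` -/

theorem abs_integral_mul_le {μ : Measure ℝ} {q q' : ℝ} (hq : q.HolderConjugate q') {f g : ℝ → ℝ}
    (hf : MemLp f (ENNReal.ofReal q) μ) (hg : MemLp g (ENNReal.ofReal q') μ) :
    |∫ x, f x * g x ∂μ| ≤ (eLpNorm f (ENNReal.ofReal q) μ).toReal
      * (eLpNorm g (ENNReal.ofReal q') μ).toReal := by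
  have := hq.ennrealOfReal
  have h1 : eLpNorm (f • g) 1 μ ≤ _ := eLpNorm_smul_le_mul_eLpNorm (p := ENNReal.ofReal q)
    (q := ENNReal.ofReal q') (r := 1) hg.1 hf.1
  have h2 : ‖∫ x, f x * g x ∂μ‖ₑ ≤ eLpNorm (f • g) 1 μ := by
    rw [eLpNorm_one_eq_lintegral_enorm]
    exact enorm_integral_le_lintegral_enorm _
  have h3 := ENNReal.toReal_mono (ENNReal.mul_ne_top hf.2.ne hg.2.ne) (h2.trans h1)
  rwa [ENNReal.toReal_mul, toReal_enorm, Real.norm_eq_abs] at h3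

/-- Simple functions are dense in L^{q'} and belong to L², so a uniform L^q bound upgrades the class
of test functions. -/
theorem tendsto_integral_mul_of_weak {μ : Measure ℝ} [IsFiniteMeasure μ] {q q' : ℝ}
    (hq : q.HolderConjugate q')
    {f : ℕ → ℝ → ℝ} {X : ℝ → ℝ} (hf : ∀ j, MemLp (f j) (ENNReal.ofReal q) μ)
    (hX : MemLp X (ENNReal.ofReal q) μ) {C : ℝ≥0∞} (hC : C ≠ ⊤)
    (hfC : ∀ᶠ j in atTop, eLpNorm (f j) (ENNReal.ofReal q) μ ≤ C)
    (hw : ∀ k, MemLp k 2 μ → Tendsto (fun j => ∫ x, f j x * k x ∂μ) atTop (𝓝 (∫ x, X x * k x ∂μ)))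
    {k : ℝ → ℝ} (hk : MemLp k (ENNReal.ofReal q') μ) :
    Tendsto (fun j => ∫ x, f j x * k x ∂μ) atTop (𝓝 (∫ x, X x * k x ∂μ)) := by
  have := hq.ennrealOfReal
  rw [Metric.tendsto_atTop']
  intro δ hδ
  set B : ℝ := C.toReal + (eLpNorm X (ENNReal.ofReal q) μ).toReal + 1
  have hB : 0 < B := by positivity
  obtain ⟨s, hs, hsm⟩ := hk.exists_simpleFunc_eLpNorm_sub_lt ENNReal.ofReal_ne_top
    (ε := ENNReal.ofReal (δ / 2 / B)) (by simp only [ne_eq, ENNReal.ofReal_eq_zero, not_le]; positivity)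
  have hs2 : MemLp s 2 μ := s.memLp_of_isFiniteMeasure 2 μ
  have hks : MemLp (fun x => k x - s x) (ENNReal.ofReal q') μ := hk.sub hsm
  have hr : (eLpNorm (fun x => k x - s x) (ENNReal.ofReal q') μ).toReal ≤ δ / 2 / B :=
    ENNReal.toReal_le_of_le_ofReal (by positivity) hs.le
  have hr0 : 0 ≤ (eLpNorm (fun x => k x - s x) (ENNReal.ofReal q') μ).toReal :=
    ENNReal.toReal_nonneg
  have dec : ∀ h : ℝ → ℝ, MemLp h (ENNReal.ofReal q) μ →
      ∫ x, h x * k x ∂μ = ∫ x, h x * s x ∂μ + ∫ x, h x * (k x - s x) ∂μ := by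
    intro h hh
    rw [← integral_add]
    · congr 1; ext x; ring
    · exact hh.integrable_mul hsm
    · exact hh.integrable_mul hks
  obtain ⟨j₁, h1⟩ := Metric.tendsto_atTop'.1 (hw s hs2) (δ / 2) (half_pos hδ)
  obtain ⟨j₂, h2⟩ := eventually_atTop.1 hfC
  refine ⟨max j₁ j₂, fun j hj => ?_⟩
  have d1 := h1 j ((le_max_left _ _).trans_lt hj)
  have b1 := abs_integral_mul_le hq (hf j) hks
  have b2 := abs_integral_mul_le hq hX hks
  have b3 := ENNReal.toReal_mono hC (h2 j ((le_max_right _ _).trans hj.le))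
  rw [Real.dist_eq] at d1 ⊢
  rw [dec _ (hf j), dec _ hX, abs_lt]
  rw [abs_lt] at d1
  rw [abs_le] at b1 b2
  have e1 : (eLpNorm (f j) (ENNReal.ofReal q) μ).toReal
      * (eLpNorm (fun x => k x - s x) (ENNReal.ofReal q') μ).toReal
      + (eLpNorm X (ENNReal.ofReal q) μ).toReal
      * (eLpNorm (fun x => k x - s x) (ENNReal.ofReal q') μ).toReal ≤ δ / 2 := by
    rw [← add_mul]
    calc _ ≤ B * (δ / 2 / B) := by
          refine mul_le_mul ?_ hr hr0 hB.le
          simp only [B]; linarith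
      _ = δ / 2 := by field_simp
  constructor <;> linarith

theorem tendsto_integral_mul_of_bounded {O : Set ℝ} {w : ℕ → ℝ → ℝ} {v k : ℝ → ℝ} {A : ℝ}
    (hm : ∀ j, Measurable (w j)) (hA : ∀ᶠ j in atTop, ∀ x, |w j x| ≤ A)
    (ht : ∀ x, Tendsto (fun j => w j x) atTop (𝓝 (v x))) (hk : IntegrableOn k O) :
    Tendsto (fun j => ∫ x in O, w j x * k x) atTop (𝓝 (∫ x in O, v x * k x)) := by
  refine tendsto_integral_filter_of_dominated_convergence (fun x => A * |k x|)
    (Eventually.of_forall fun j => (hm j).aestronglyMeasurable.mul hk.aestronglyMeasurable) ?_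
    (hk.abs.const_mul A) (ae_of_all _ fun x => (ht x).mul_const _)
  filter_upwards [hA] with j hj
  refine ae_of_all _ fun x => ?_
  rw [norm_mul, Real.norm_eq_abs, Real.norm_eq_abs]
  exact mul_le_mul_of_nonneg_right (hj x) (abs_nonneg _)

namespace JetProblem

variable {Ω : Set ℝ} {H : ℝ → ℝ → ℝ → ℝ → ℝ} {m M : ℝ} {g₀ g₁ g₂ : ℝ → ℝ}

/-- Uniform `L^q` bounds along sequences of bounded energy. -/
theorem exists_eLpNorm_bound (S : JetProblem Ω H m M g₀ g₁ g₂) {f : ℕ → ℝ → ℝ}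
    (hf : ∀ j, IsBend Ω (f j)) {p : ℕ → ℝ} (hp : ∀ j, 1 ≤ p j) (hpt : Tendsto p atTop atTop)
    {K : ℝ} (hK : 0 < K)
    (hle : ∀ᶠ j in atTop, lpMean Ω M (p j) (jetDensity H g₀ g₁ g₂ (f j)) ≤ ENNReal.ofReal K)
    {q : ℝ} (hq : 1 ≤ q) : ∃ C : ℝ≥0∞, C ≠ ⊤ ∧
      ∀ᶠ j in atTop, eLpNorm (f j) (ENNReal.ofReal q) (volume.restrict Ω) ≤ C := by
  have : IsFiniteMeasure (volume.restrict Ω) := ⟨by simpa using S.isBounded.measure_lt_top⟩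
  obtain ⟨C₁, A, B, hC₁, hest⟩ := S.exists_estimates hK
  obtain ⟨G, hG⟩ := S.bounded
  have hq0 : 0 < q := one_pos.trans_le hq
  set Q := ENNReal.ofReal q
  have hQ1 : 1 ≤ Q := by rw [← ENNReal.ofReal_one]; exact ENNReal.ofReal_le_ofReal hq
  have hQ0 : Q ≠ 0 := (one_pos.trans_le hQ1).ne'
  set T : ℝ≥0∞ := (2 * ENNReal.ofReal K ^ q * volume Ω) ^ (1 / q)
  set D : ℝ := |B| / C₁ + G
  refine ⟨‖C₁⁻¹‖ₑ * T + eLpNorm (fun _ : ℝ => D) Q (volume.restrict Ω),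
    ENNReal.add_ne_top.2 ⟨ENNReal.mul_ne_top enorm_ne_top (ENNReal.rpow_ne_top_of_nonneg
      (by positivity) (ENNReal.mul_ne_top (ENNReal.mul_ne_top (by simp)
        (ENNReal.rpow_ne_top_of_nonneg hq0.le ENNReal.ofReal_ne_top))
        S.isBounded.measure_lt_top.ne)), (memLp_const D).2.ne⟩, ?_⟩
  -- Once `p j ≥ q`, the L^q norm of `M + H` is controlled by its `p j`-mean, and coercivity passes
  -- the bound to the second derivative.
  filter_upwards [hle, hpt.eventually_ge_atTop q] with j h1 h2
  set J := jetDensity H g₀ g₁ g₂ (f j) with hJ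
  have hJm : AEStronglyMeasurable (fun x => M + J x) (volume.restrict Ω) :=
    ((S.aemeasurable_jetDensity (hf j)).const_add M).aestronglyMeasurable
  have hJ0 : ∀ᵐ x ∂(volume.restrict Ω), 0 ≤ M + J x := by
    filter_upwards [ae_restrict_mem S.isOpen.measurableSet] with x hx
    have := S.lower x hx (g₀ x + prim (prim (f j)) x) (g₁ x + prim (f j) x) (g₂ x + f j x)
    rw [hJ, jetDensity]
    linarith [S.lt]
  have e1 : eLpNorm (fun x => M + J x) Q (volume.restrict Ω) ≤ T := by
    rw [eLpNorm_eq_lintegral_rpow_enorm_toReal hQ0 ENNReal.ofReal_ne_top,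
      ENNReal.toReal_ofReal hq0.le]
    refine ENNReal.rpow_le_rpow ?_ (by positivity)
    refine le_trans (lintegral_mono_ae ?_)
      (lintegral_rpow_le_of_lpMean_le S.isBounded hq0 h2 hK h1)
    filter_upwards [hJ0] with x hx
    rw [Real.enorm_of_nonneg hx]
  have e2 : eLpNorm (fun x => C₁⁻¹ * (M + J x)) Q (volume.restrict Ω)
      ≤ ‖C₁⁻¹‖ₑ * T := by
    have := eLpNorm_const_smul C₁⁻¹ (fun x => M + J x) Q (volume.restrict Ω)
    calc _ = ‖C₁⁻¹‖ₑ * eLpNorm (fun x => M + J x) Q (volume.restrict Ω) := this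
      _ ≤ _ := by gcongr
  refine le_trans (eLpNorm_mono_ae_real (g := fun x => C₁⁻¹ * (M + J x) + D) ?_)
    ((eLpNorm_add_le (hJm.const_mul _) aestronglyMeasurable_const hQ1).trans
      (add_le_add_left e2 _))
  filter_upwards [(hest _ _ (hf j) (hp j) h1).2] with x hx
  have h3 : |f j x| ≤ |g₂ x + f j x| + G := by
    have h4 := abs_sub (g₂ x + f j x) (g₂ x)
    rw [add_sub_cancel_left] at h4
    linarith [(hG x).2.2]
  have h5 : |g₂ x + f j x| ≤ C₁⁻¹ * (M + J x) + |B| / C₁ := by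
    have e : C₁⁻¹ * (M + J x) + |B| / C₁ = (M + J x + |B|) / C₁ := by field_simp
    rw [e, le_div_iff₀' hC₁]
    linarith [le_abs_self B, S.pos, S.lt]
  rw [Real.norm_eq_abs]
  simp only [D]
  linarith

end JetProblem

namespace JetProblem

variable {Ω : Set ℝ} {H : ℝ → ℝ → ℝ → ℝ → ℝ} {m M : ℝ} {g g₀ g₁ g₂ : ℝ → ℝ}

/-! ### Functions in the Dirichlet class -/

theorem mem_dirichletClass_iff (S : JetProblem Ω H m M g₀ g₁ g₂)
    (hg : g =ᵐ[volume.restrict Ω] g₀) {u : ℝ → ℝ} :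
    u ∈ dirichletClass Ω g ↔
      ∃ h, IsBend Ω h ∧ u =ᵐ[volume.restrict Ω] fun x => g₀ x + prim (prim h) x := by
  rw [dirichletClass, mem_ofPred_eq, memW2InftyZero_iff S.isOpen S.isBounded]
  refine exists_congr fun h => and_congr_right fun _ => ⟨fun hu => ?_, fun hu => ?_⟩
  · filter_upwards [hu, hg] with x h1 h2
    rw [← h1, ← h2]; ring
  · filter_upwards [hu, hg] with x h1 h2
    rw [h1, h2]; ring

theorem isWeakDeriv_of_bend (S : JetProblem Ω H m M g₀ g₁ g₂) (hg₁ : IsWeakDeriv Ω g₀ g₁)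
    (hg₂ : IsWeakDeriv Ω g₁ g₂) {u h : ℝ → ℝ} (hh : IsBend Ω h)
    (hu : u =ᵐ[volume.restrict Ω] fun x => g₀ x + prim (prim h) x) :
    IsWeakDeriv Ω u (fun x => g₁ x + prim h x) ∧
      IsWeakDeriv Ω (fun x => g₁ x + prim h x) (fun x => g₂ x + h x) := by
  obtain ⟨h1, h2⟩ := hh.isWeakDeriv S.isBounded
  exact ⟨(hg₁.add h1).congr hu.symm (ae_eq_refl _), hg₂.add h2⟩

theorem memW2_of_bend (S : JetProblem Ω H m M g₀ g₁ g₂) (hg₁ : IsWeakDeriv Ω g₀ g₁)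
    (hg₂ : IsWeakDeriv Ω g₁ g₂) {u h : ℝ → ℝ} (hh : IsBend Ω h)
    (hu : u =ᵐ[volume.restrict Ω] fun x => g₀ x + prim (prim h) x) (q : ℝ≥0∞) : MemW2 Ω q u := by
  obtain ⟨h1, h2⟩ := S.isWeakDeriv_of_bend hg₁ hg₂ hh hu
  obtain ⟨G, hG⟩ := S.bounded
  obtain ⟨m0, m1, m2⟩ := hh.memLp S.isBounded q
  refine ⟨_, _, h1, h2, (memLp_congr_ae hu).2 (MemLp.add ?_ m0), MemLp.add ?_ m1, MemLp.add ?_ m2⟩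
  · exact memLp_of_bounded S.isBounded q S.measurable₀.aestronglyMeasurable fun x => (hG x).1
  · exact memLp_of_bounded S.isBounded q S.measurable₁.aestronglyMeasurable fun x => (hG x).2.1
  · exact memLp_of_bounded S.isBounded q S.measurable₂.aestronglyMeasurable fun x => (hG x).2.2

theorem alongJet_ae_eq_jetDensity (S : JetProblem Ω H m M g₀ g₁ g₂) (hg₁ : IsWeakDeriv Ω g₀ g₁)
    (hg₂ : IsWeakDeriv Ω g₁ g₂) {u h : ℝ → ℝ} (hh : IsBend Ω h)
    (hu : u =ᵐ[volume.restrict Ω] fun x => g₀ x + prim (prim h) x) {O : Set ℝ} (hO : IsOpen O)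
    (hOΩ : O ⊆ Ω) : alongJet H u O =ᵐ[volume.restrict O] jetDensity H g₀ g₁ g₂ h := by
  obtain ⟨h1, h2⟩ := S.isWeakDeriv_of_bend hg₁ hg₂ hh hu
  exact alongJet_ae_eq hO H (ae_restrict_of_ae_restrict_of_subset hOΩ hu) (h1.mono hOΩ)
    (h2.mono hOΩ)

theorem weakDeriv_ae_eq_of_bend (S : JetProblem Ω H m M g₀ g₁ g₂) (hg₁ : IsWeakDeriv Ω g₀ g₁)
    (hg₂ : IsWeakDeriv Ω g₁ g₂) {u h : ℝ → ℝ} (hh : IsBend Ω h)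
    (hu : u =ᵐ[volume.restrict Ω] fun x => g₀ x + prim (prim h) x) :
    weakDeriv Ω u =ᵐ[volume.restrict Ω] (fun x => g₁ x + prim h x) ∧
      weakDeriv2 Ω u =ᵐ[volume.restrict Ω] (fun x => g₂ x + h x) := by
  obtain ⟨h1, h2⟩ := S.isWeakDeriv_of_bend hg₁ hg₂ hh hu
  exact ⟨h1.weakDeriv_ae_eq S.isOpen, h1.weakDeriv2_ae_eq S.isOpen h2⟩

/-! ### Compactness -/

theorem eventually_jet_bound (S : JetProblem Ω H m M g₀ g₁ g₂) {f : ℕ → ℝ → ℝ}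
    (hf : ∀ j, IsBend Ω (f j)) {p : ℕ → ℝ} (hp : ∀ j, 1 ≤ p j) {K : ℝ} (hK : 0 < K)
    (hle : ∀ᶠ j in atTop, lpMean Ω M (p j) (jetDensity H g₀ g₁ g₂ (f j)) ≤ ENNReal.ofReal K) :
    ∃ R : ℝ, ∀ᶠ j in atTop, ∀ x,
      |g₀ x + prim (prim (f j)) x| ≤ R ∧ |g₁ x + prim (f j) x| ≤ R := by
  obtain ⟨C₁, A, B, hC₁, hest⟩ := S.exists_estimates hK
  obtain ⟨G, hG⟩ := S.bounded
  set D := (volume Ω).toReal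
  have hD : 0 ≤ D := ENNReal.toReal_nonneg
  refine ⟨max (G + A * D) (G + A), ?_⟩
  filter_upwards [hle] with j hj x
  have h1 := (hest _ _ (hf j) (hp j) hj).1
  constructor
  · refine le_trans ((abs_add_le _ _).trans (add_le_add (hG x).1 ?_)) (le_max_left _ _)
    exact (abs_prim_le ((hf j).integrable_prim S.isBounded) x).trans
      (((hf j).integral_abs_prim_le S.isBounded).trans (by gcongr))
  · exact le_trans ((abs_add_le _ _).trans (add_le_add (hG x).2.1
      ((abs_prim_le ((hf j).integrable S.isBounded) x).trans h1))) (le_max_right _ _)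

/-- The function and its first derivative converge pointwise and boundedly; only the second
derivative needs the uniform L^q bounds. -/
theorem weaklyConvergesW2_of_bend (S : JetProblem Ω H m M g₀ g₁ g₂) (hg₁ : IsWeakDeriv Ω g₀ g₁)
    (hg₂ : IsWeakDeriv Ω g₁ g₂) {f u : ℕ → ℝ → ℝ} (hf : ∀ j, IsBend Ω (f j))
    (hu : ∀ j, u j =ᵐ[volume.restrict Ω] fun x => g₀ x + prim (prim (f j)) x)
    {p : ℕ → ℝ} (hp : ∀ j, 1 ≤ p j) (hpt : Tendsto p atTop atTop) {K : ℝ} (hK : 0 < K)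
    (hle : ∀ᶠ j in atTop, lpMean Ω M (p j) (jetDensity H g₀ g₁ g₂ (f j)) ≤ ENNReal.ofReal K)
    {Φ : ℝ → ℝ} (hΦ : IsBend Ω Φ)
    (hw : ∀ k, MemLp k 2 (volume.restrict Ω) →
      Tendsto (fun j => ∫ x in Ω, f j x * k x) atTop (𝓝 (∫ x in Ω, Φ x * k x))) :
    WeaklyConvergesW2 Ω u (fun x => g₀ x + prim (prim Φ) x) := by
  have : IsFiniteMeasure (volume.restrict Ω) := ⟨by simpa using S.isBounded.measure_lt_top⟩
  obtain ⟨G, hG⟩ := S.bounded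
  intro q q' hqq'
  refine ⟨fun j => S.memW2_of_bend hg₁ hg₂ (hf j) (hu j) _,
    S.memW2_of_bend hg₁ hg₂ hΦ (ae_eq_refl _) _, fun k hk => ?_⟩
  have hki : IntegrableOn k Ω := hk.integrable (by
    rw [← ENNReal.ofReal_one]; exact ENNReal.ofReal_le_ofReal hqq'.symm.lt.le)
  obtain ⟨R, hR⟩ := S.eventually_jet_bound hf hp hK hle
  obtain ⟨dΦ1, dΦ2⟩ := S.weakDeriv_ae_eq_of_bend hg₁ hg₂ hΦ (ae_eq_refl _)
  have cong : ∀ {a b : ℝ → ℝ}, a =ᵐ[volume.restrict Ω] b →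
      ∫ x in Ω, a x * k x = ∫ x in Ω, b x * k x := fun h =>
    integral_congr_ae (by filter_upwards [h] with x hx; rw [hx])
  refine ⟨?_, ?_, ?_⟩
  · simp only [fun j => cong (hu j)]
    refine tendsto_integral_mul_of_bounded (A := R) (fun j => S.measurable₀.add
      (continuous_prim ((hf j).integrable_prim S.isBounded)).measurable)
      (hR.mono fun j hj x => (hj x).1) (fun x => ?_) hki
    exact (S.tendsto_prim_prim hf hΦ.eq_zero hw hp hK hle x).const_add _
  · simp only [fun j => cong (S.weakDeriv_ae_eq_of_bend hg₁ hg₂ (hf j) (hu j)).1, cong dΦ1]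
    refine tendsto_integral_mul_of_bounded (A := R) (fun j => S.measurable₁.add
      (continuous_prim ((hf j).integrable S.isBounded)).measurable)
      (hR.mono fun j hj x => (hj x).2) (fun x => ?_) hki
    exact (tendsto_prim_of_weak S.isBounded (fun j => (hf j).eq_zero) hΦ.eq_zero hw x).const_add _
  · simp only [fun j => cong (S.weakDeriv_ae_eq_of_bend hg₁ hg₂ (hf j) (hu j)).2, cong dΦ2]
    obtain ⟨C, hC, hfC⟩ := S.exists_eLpNorm_bound hf hp hpt hK hle hqq'.lt.le
    have h1 := tendsto_integral_mul_of_weak hqq' (fun j => ((hf j).memLp S.isBounded _).2.2)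
      (hΦ.memLp S.isBounded _).2.2 hC hfC hw hk
    have hgk : IntegrableOn (fun x => g₂ x * k x) Ω :=
      hki.bdd_mul S.measurable₂.aestronglyMeasurable (ae_of_all _ fun x => (hG x).2.2)
    have hbk : ∀ {h : ℝ → ℝ}, IsBend Ω h → IntegrableOn (fun x => h x * k x) Ω := fun hh =>
      hki.bdd_mul hh.measurable.aestronglyMeasurable (ae_of_all _ hh.bounded.choose_spec)
    simp only [add_mul, fun j => integral_add hgk (hbk (hf j)), integral_add hgk (hbk hΦ)]
    exact h1.const_add _

theorem exists_weakly_convergent_subseq (S : JetProblem Ω H m M g₀ g₁ g₂)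
    (hg₁ : IsWeakDeriv Ω g₀ g₁)
    (hg₂ : IsWeakDeriv Ω g₁ g₂) {f u : ℕ → ℝ → ℝ} (hf : ∀ j, IsBend Ω (f j))
    (hu : ∀ j, u j =ᵐ[volume.restrict Ω] fun x => g₀ x + prim (prim (f j)) x)
    {p : ℕ → ℝ} (hp : ∀ j, 1 ≤ p j) (hpt : Tendsto p atTop atTop) {K : ℝ} (hK : 0 < K)
    (hle : ∀ᶠ j in atTop, lpMean Ω M (p j) (jetDensity H g₀ g₁ g₂ (f j)) ≤ ENNReal.ofReal K) :
    ∃ κ : ℕ → ℕ, StrictMono κ ∧ ∃ w, WeaklyConvergesW2 Ω (fun j => u (κ j)) w := by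
  have : IsFiniteMeasure (volume.restrict Ω) := ⟨by simpa using S.isBounded.measure_lt_top⟩
  obtain ⟨C, hC, hfC⟩ := S.exists_eLpNorm_bound hf hp hpt hK hle one_le_two
  obtain ⟨j₀, hj₀⟩ := eventually_atTop.1 hfC
  have hm : ∀ j, MemLp (f j) 2 (volume.restrict Ω) := fun j => ((hf j).memLp S.isBounded _).2.2
  have e2 : ENNReal.ofReal 2 = 2 := by simp
  -- The shift by `j₀` skips the finitely many indices for which the norm bound may fail.
  obtain ⟨τ, X, hτ, hX, hw⟩ := exists_weak_subseq_L2 (C := C.toReal * C.toReal)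
    (fun j => hm (j + j₀)) fun j => by
      have h1 := hm (j + j₀)
      rw [← e2] at h1
      have h2 := abs_integral_mul_le Real.HolderConjugate.two_two h1 h1
      have h3 := ENNReal.toReal_mono hC (hj₀ (j + j₀) (Nat.le_add_left _ _))
      exact (le_abs_self _).trans (h2.trans
        (mul_le_mul h3 h3 ENNReal.toReal_nonneg ENNReal.toReal_nonneg))
  have hκ : StrictMono fun j => τ j + j₀ := fun a b hab => Nat.add_lt_add_right (hτ hab) _
  refine ⟨fun j => τ j + j₀, hκ, ?_⟩
  have hle' := hκ.tendsto_atTop.eventually hle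
  have hpt' := hpt.comp hκ.tendsto_atTop
  obtain ⟨Φ, hΦ, hXΦ⟩ := S.exists_isBend_limit (fun j => hf (τ j + j₀)) hX hw (fun j => hp _) hpt'
    hK hle'
  refine ⟨_, S.weaklyConvergesW2_of_bend hg₁ hg₂ (fun j => hf (τ j + j₀)) (fun j => hu _)
    (fun j => hp _) hpt' hK hle' hΦ fun k hk => ?_⟩
  have e : ∫ x in Ω, Φ x * k x = ∫ x in Ω, X x * k x :=
    integral_congr_ae (by filter_upwards [hXΦ] with x hx; rw [hx])
  rw [e]
  exact hw k hk

/-- Identification of a weak limit of approximate minimisers. -/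
theorem exists_isBend_of_weaklyConverges (S : JetProblem Ω H m M g₀ g₁ g₂)
    (hg₁ : IsWeakDeriv Ω g₀ g₁)
    (hg₂ : IsWeakDeriv Ω g₁ g₂) {f u : ℕ → ℝ → ℝ} (hf : ∀ j, IsBend Ω (f j))
    (hu : ∀ j, u j =ᵐ[volume.restrict Ω] fun x => g₀ x + prim (prim (f j)) x)
    {p : ℕ → ℝ} (hp : ∀ j, 1 ≤ p j) (hpt : Tendsto p atTop atTop) {K : ℝ} (hK : 0 < K)
    (hle : ∀ᶠ j in atTop, lpMean Ω M (p j) (jetDensity H g₀ g₁ g₂ (f j)) ≤ ENNReal.ofReal K)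
    {w : ℝ → ℝ} (hw : WeaklyConvergesW2 Ω u w) :
    ∃ Φ, IsBend Ω Φ ∧ (w =ᵐ[volume.restrict Ω] fun x => g₀ x + prim (prim Φ) x) ∧
      ∀ k, MemLp k 2 (volume.restrict Ω) →
        Tendsto (fun j => ∫ x in Ω, f j x * k x) atTop (𝓝 (∫ x in Ω, Φ x * k x)) := by
  have : IsFiniteMeasure (volume.restrict Ω) := ⟨by simpa using S.isBounded.measure_lt_top⟩
  obtain ⟨G, hG⟩ := S.bounded
  obtain ⟨-, hwm, hlim⟩ := hw 2 2 Real.HolderConjugate.two_two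
  have e2 : ENNReal.ofReal 2 = 2 := by simp
  rw [e2] at hwm hlim
  obtain ⟨w₁, w₂, d1, d2, m0, -, m2⟩ := hwm
  have mg : MemLp g₂ 2 (volume.restrict Ω) :=
    memLp_of_bounded S.isBounded 2 S.measurable₂.aestronglyMeasurable fun x => (hG x).2.2
  have hX : MemLp (fun x => w₂ x - g₂ x) 2 (volume.restrict Ω) := m2.sub mg
  have hm : ∀ j, MemLp (f j) 2 (volume.restrict Ω) := fun j => ((hf j).memLp S.isBounded _).2.2
  have cong : ∀ {a b : ℝ → ℝ} (k : ℝ → ℝ), a =ᵐ[volume.restrict Ω] b →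
      ∫ x in Ω, a x * k x = ∫ x in Ω, b x * k x := fun k h =>
    integral_congr_ae (by filter_upwards [h] with x hx; rw [hx])
  have hwX : ∀ k, MemLp k 2 (volume.restrict Ω) → Tendsto (fun j => ∫ x in Ω, f j x * k x) atTop
      (𝓝 (∫ x in Ω, (w₂ x - g₂ x) * k x)) := by
    intro k hk
    have h1 := (hlim k hk).2.2
    simp only [fun j => cong k (S.weakDeriv_ae_eq_of_bend hg₁ hg₂ (hf j) (hu j)).2,
      cong k (d1.weakDeriv2_ae_eq S.isOpen d2)] at h1
    have e3 : ∀ j, ∫ x in Ω, (g₂ x + f j x) * k x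
        = (∫ x in Ω, g₂ x * k x) + ∫ x in Ω, f j x * k x := fun j => by
      simp only [add_mul]
      exact integral_add (mg.integrable_mul hk) ((hm j).integrable_mul hk)
    have e4 : ∫ x in Ω, (w₂ x - g₂ x) * k x = (∫ x in Ω, w₂ x * k x) -
        ∫ x in Ω, g₂ x * k x := by
      simp only [sub_mul]
      exact integral_sub (m2.integrable_mul hk) (mg.integrable_mul hk)
    rw [e4]
    refine (h1.sub_const (∫ x in Ω, g₂ x * k x)).congr fun j => ?_
    rw [e3]; ring
  obtain ⟨Φ, hΦ, hXΦ⟩ := S.exists_isBend_limit hf hX hwX hp hpt hK hle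
  have hwΦ : ∀ k, MemLp k 2 (volume.restrict Ω) → Tendsto (fun j => ∫ x in Ω, f j x * k x) atTop
      (𝓝 (∫ x in Ω, Φ x * k x)) := by
    intro k hk
    rw [← cong k hXΦ]
    exact hwX k hk
  refine ⟨Φ, hΦ, ?_, hwΦ⟩
  -- The second derivative determines `w` only up to affine functions on each component; uniqueness
  -- of the weak limit of the functions themselves removes the ambiguity.
  have hlimΦ := (S.weaklyConvergesW2_of_bend hg₁ hg₂ hf hu hp hpt hK hle hΦ hwΦ 2 2
    Real.HolderConjugate.two_two).2.2
  rw [e2] at hlimΦ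
  have mΦ : MemLp (fun x => g₀ x + prim (prim Φ) x) 2 (volume.restrict Ω) :=
    (memLp_of_bounded S.isBounded 2 S.measurable₀.aestronglyMeasurable fun x => (hG x).1).add
      (hΦ.memLp S.isBounded 2).1
  refine Integrable.ae_eq_of_forall_setIntegral_eq _ _ (m0.integrable (by norm_num))
    (mΦ.integrable (by norm_num)) fun A hA _ => ?_
  have hk : MemLp (A.indicator (1 : ℝ → ℝ)) 2 (volume.restrict Ω) :=
    memLp_of_bounded S.isBounded 2 (measurable_const.indicator hA).aestronglyMeasurable (C := 1)
      fun x => by by_cases hx : x ∈ A <;> simp [hx]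
  have h1 := tendsto_nhds_unique (hlim _ hk).1 (hlimΦ _ hk).1
  have e : ∀ v : ℝ → ℝ, ∫ x in Ω, v x * A.indicator 1 x = ∫ x in A, v x ∂(volume.restrict Ω) := by
    intro v
    rw [← integral_indicator hA]
    congr 1; ext x
    by_cases hx : x ∈ A <;> simp [hx]
  rwa [e, e] at h1

end JetProblem

/-! ### Existence of approximate minimisers and minimality of weak limits -/

namespace JetProblem

variable {Ω : Set ℝ} {H : ℝ → ℝ → ℝ → ℝ → ℝ} {m M : ℝ} {g g₀ g₁ g₂ : ℝ → ℝ}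

theorem exists_of_memW2 (hΩ : IsOpen Ω) (hΩb : Bornology.IsBounded Ω)
    (hcont : ContinuousOn (fun z : ℝ × ℝ × ℝ × ℝ => H z.1 z.2.1 z.2.2.1 z.2.2.2)
      (Ω ×ˢ (univ : Set (ℝ × ℝ × ℝ))))
    (hm : 0 < m) (hM : m < M) (hlower : ∀ x ∈ Ω, ∀ η P X : ℝ, -m ≤ H x η P X)
    (hlevel : ∀ x ∈ Ω, ∀ η P c : ℝ, Convex ℝ {X : ℝ | H x η P X ≤ c})
    (hcoer : ∃ C₁ C₂ s t : ℝ, 0 < C₁ ∧ 0 < C₂ ∧ 0 ≤ s ∧ s < 1 ∧ 0 ≤ t ∧ t < 1 ∧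
      ∀ᵐ x ∂(volume.restrict Ω), ∀ η P X : ℝ,
        C₁ * |X| - C₂ * (1 + |η| ^ s + |P| ^ t) ≤ H x η P X)
    (hg : MemW2 Ω ∞ g) :
    ∃ g₀ g₁ g₂ : ℝ → ℝ, JetProblem Ω H m M g₀ g₁ g₂ ∧ g =ᵐ[volume.restrict Ω] g₀ ∧
      IsWeakDeriv Ω g₀ g₁ ∧ IsWeakDeriv Ω g₁ g₂ := by
  obtain ⟨u₁, u₂, d1, d2, m0, m1, m2⟩ := hg
  obtain ⟨g₀, k0, ⟨G₀, b0⟩, -, e0⟩ := exists_bounded_rep hΩ.measurableSet m0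
  obtain ⟨g₁, k1, ⟨G₁, b1⟩, -, e1⟩ := exists_bounded_rep hΩ.measurableSet m1
  obtain ⟨g₂, k2, ⟨G₂, b2⟩, -, e2⟩ := exists_bounded_rep hΩ.measurableSet m2
  refine ⟨g₀, g₁, g₂, ⟨hΩ, hΩb, hcont, hm, hM, hlower, hlevel, hcoer, k0, k1, k2,
    ⟨max G₀ (max G₁ G₂), fun x => ⟨(b0 x).trans (le_max_left _ _),
      (b1 x).trans ((le_max_left _ _).trans (le_max_right _ _)),
      (b2 x).trans ((le_max_right _ _).trans (le_max_right _ _))⟩⟩⟩, e0, d1.congr e0 e1,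
    d2.congr e1 e2⟩

theorem lpEnergy_eq_of_bend (S : JetProblem Ω H m M g₀ g₁ g₂) (hg₁ : IsWeakDeriv Ω g₀ g₁)
    (hg₂ : IsWeakDeriv Ω g₁ g₂) {u h : ℝ → ℝ} (hh : IsBend Ω h)
    (hu : u =ᵐ[volume.restrict Ω] fun x => g₀ x + prim (prim h) x) (p : ℝ) :
    lpEnergy H M p u Ω = (lpMean Ω M p (jetDensity H g₀ g₁ g₂ h) : EReal) - (M : EReal) :=
  lpEnergy_eq (S.alongJet_ae_eq_jetDensity hg₁ hg₂ hh hu S.isOpen subset_rfl)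

theorem exists_bend_ae_le (S : JetProblem Ω H m M g₀ g₁ g₂) (hg : g =ᵐ[volume.restrict Ω] g₀)
    (hg₁ : IsWeakDeriv Ω g₀ g₁) (hg₂ : IsWeakDeriv Ω g₁ g₂)
    (hfin : ∃ ψ ∈ dirichletClass Ω g, supEnergy H ψ Ω < ⊤) :
    ∃ h c, IsBend Ω h ∧ 0 ≤ c ∧ ∀ᵐ x ∂(volume.restrict Ω), jetDensity H g₀ g₁ g₂ h x ≤ c := by
  obtain ⟨ψ, hψ, hlt⟩ := hfin
  obtain ⟨h, hh, hψh⟩ := (S.mem_dirichletClass_iff hg).1 hψ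
  obtain ⟨c, h1, -⟩ := EReal.lt_iff_exists_real_btwn.1 hlt
  refine ⟨h, max c 0, hh, le_max_right _ _, ?_⟩
  filter_upwards [ae_lt_of_essSup_lt h1,
    S.alongJet_ae_eq_jetDensity hg₁ hg₂ hh hψh S.isOpen subset_rfl] with x h2 h3
  rw [← h3]
  exact le_max_of_le_left (by exact_mod_cast h2.le)

/-- The infimum is finite, at least `-M` and bounded above through the competitor `h`, so adding a
positive tolerance raises it strictly. -/
theorem exists_areApproxMinimisers (S : JetProblem Ω H m M g₀ g₁ g₂)
    (hg : g =ᵐ[volume.restrict Ω] g₀) (hg₁ : IsWeakDeriv Ω g₀ g₁) (hg₂ : IsWeakDeriv Ω g₁ g₂)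
    {h : ℝ → ℝ} {c : ℝ} (hh : IsBend Ω h)
    (hc : ∀ᵐ x ∂(volume.restrict Ω), jetDensity H g₀ g₁ g₂ h x ≤ c)
    {ε : ℝ → ℝ} (hε : ∀ p : ℝ, 1 < p → 0 < ε p) :
    ∃ u : ℝ → ℝ → ℝ, AreApproxMinimisers H M Ω g ε u := by
  have key : ∀ p : ℝ, ∃ v : ℝ → ℝ, 1 < p → v ∈ dirichletClass Ω g ∧
      lpEnergy H M p v Ω ≤ (ε p : EReal) + ⨅ v ∈ dirichletClass Ω g, lpEnergy H M p v Ω := by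
    intro p
    by_cases hp : 1 < p
    swap
    -- Arbitrary value for exponents where nothing is required.
    · exact ⟨0, fun h => absurd h hp⟩
    set I := ⨅ v ∈ dirichletClass Ω g, lpEnergy H M p v Ω with hI
    have hψ : (fun x => g₀ x + prim (prim h) x) ∈ dirichletClass Ω g :=
      (S.mem_dirichletClass_iff hg).2 ⟨h, hh, ae_eq_refl _⟩
    have htop : I ≠ ⊤ := by
      have h1 : I ≤ _ := iInf₂_le _ hψ
      rw [S.lpEnergy_eq_of_bend hg₁ hg₂ hh (ae_eq_refl _)] at h1
      have h2 := (lpMean_le_of_ae_le S.isBounded (M := M) (zero_lt_one.trans hp) hc).trans_lt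
        ENNReal.ofReal_lt_top
      lift lpMean Ω M p (jetDensity H g₀ g₁ g₂ h) to NNReal using h2.ne with a
      have e : ((a : ℝ≥0∞) : EReal) = ((a : ℝ) : EReal) := rfl
      rw [e, ← EReal.coe_sub] at h1
      exact (h1.trans_lt (EReal.coe_lt_top _)).ne
    have hbot : I ≠ ⊥ := by
      have h1 : ((-M : ℝ) : EReal) ≤ I := le_iInf₂ fun v _ => by
        rw [lpEnergy, EReal.coe_neg, ← zero_sub]
        exact EReal.sub_le_sub (EReal.coe_ennreal_nonneg _) le_rfl
      exact ((EReal.bot_lt_coe _).trans_le h1).ne'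
    have hlt : I < (ε p : EReal) + I := by
      lift I to ℝ using ⟨htop, hbot⟩ with r
      rw [← EReal.coe_add, EReal.coe_lt_coe_iff]
      linarith [hε p hp]
    nth_rewrite 1 [hI] at hlt
    obtain ⟨v, hv⟩ := iInf_lt_iff.1 hlt
    obtain ⟨hv1, hv2⟩ := iInf_lt_iff.1 hv
    exact ⟨v, fun _ => ⟨hv1, hv2.le⟩⟩
  choose u hu using key
  exact ⟨u, fun p hp => hu p hp⟩

/-- The variation has weak derivatives in `O` only, so those of `u` are restricted to `O` before
adding; its bend, extended by zero, is also a bend in Ω. -/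
theorem alongJet_add_ae_eq (S : JetProblem Ω H m M g₀ g₁ g₂) (hg₁ : IsWeakDeriv Ω g₀ g₁)
    (hg₂ : IsWeakDeriv Ω g₁ g₂) {u h : ℝ → ℝ} (hh : IsBend Ω h)
    (hu : u =ᵐ[volume.restrict Ω] fun x => g₀ x + prim (prim h) x) {O : Set ℝ} (hO : IsOpen O)
    (hOΩ : O ⊆ Ω) {φ k : ℝ → ℝ} (hk : IsBend O k)
    (hφ : φ =ᵐ[volume.restrict O] prim (prim k)) :
    alongJet H (fun x => u x + φ x) O =ᵐ[volume.restrict O]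
      jetDensity H g₀ g₁ g₂ (fun x => h x + k x) := by
  have hOb := S.isBounded.subset hOΩ
  obtain ⟨h1, h2⟩ := S.isWeakDeriv_of_bend hg₁ hg₂ hh hu
  obtain ⟨k1, k2⟩ := hk.isWeakDeriv hOb
  obtain ⟨e1, e0⟩ := prim_prim_add S.isBounded hh (hk.mono hOΩ)
  have hu' := ae_restrict_of_ae_restrict_of_subset hOΩ hu
  have d1 := ((h1.mono hOΩ).add (k1.congr hφ.symm (ae_eq_refl _)))
  refine (alongJet_ae_eq hO H (u₀ := fun x => g₀ x + prim (prim h) x + prim (prim k) x) ?_ d1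
    ((h2.mono hOΩ).add k2)).trans (Eventually.of_forall fun x => ?_)
  · filter_upwards [hu', hφ] with x a b
    rw [a, b]
  · simp only [jetDensity, congrFun e0 x, congrFun e1 x, add_assoc]

theorem neg_le_jetDensity (S : JetProblem Ω H m M g₀ g₁ g₂) {h : ℝ → ℝ} {x : ℝ} (hx : x ∈ Ω) :
    -m ≤ jetDensity H g₀ g₁ g₂ h x :=
  S.lower x hx _ _ _

theorem isGlobalMinimiser_of_weak_limit (S : JetProblem Ω H m M g₀ g₁ g₂)
    (hg : g =ᵐ[volume.restrict Ω] g₀) (hg₁ : IsWeakDeriv Ω g₀ g₁) (hg₂ : IsWeakDeriv Ω g₁ g₂)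
    {f : ℕ → ℝ → ℝ} (hf : ∀ j, IsBend Ω (f j)) {Φ u : ℝ → ℝ} (hΦ : IsBend Ω Φ)
    (hu : u =ᵐ[volume.restrict Ω] fun x => g₀ x + prim (prim Φ) x)
    (hw : ∀ k, MemLp k 2 (volume.restrict Ω) →
      Tendsto (fun j => ∫ x in Ω, f j x * k x) atTop (𝓝 (∫ x in Ω, Φ x * k x)))
    {p e : ℕ → ℝ} (hp : ∀ j, 1 ≤ p j) (hpt : Tendsto p atTop atTop) (he : ∀ j, 0 < e j)
    (het : Tendsto e atTop (𝓝 0)) {K : ℝ} (hK : 0 < K)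
    (hle : ∀ᶠ j in atTop, lpMean Ω M (p j) (jetDensity H g₀ g₁ g₂ (f j)) ≤ ENNReal.ofReal K)
    (hmin : ∀ j v, IsBend Ω v → lpMean Ω M (p j) (jetDensity H g₀ g₁ g₂ (f j))
      ≤ ENNReal.ofReal (e j) + lpMean Ω M (p j) (jetDensity H g₀ g₁ g₂ v)) :
    IsGlobalMinimiser H Ω g u := by
  refine ⟨(S.mem_dirichletClass_iff hg).2 ⟨Φ, hΦ, hu⟩, fun φ hφ => ?_⟩
  obtain ⟨k, hk, hφk⟩ := (memW2InftyZero_iff S.isOpen S.isBounded).1 hφ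
  refine supEnergy_le_supEnergy fun c hc => ?_
  have hc1 : ∀ᵐ x ∂(volume.restrict Ω), jetDensity H g₀ g₁ g₂ (fun x => Φ x + k x) x ≤ c := by
    filter_upwards [hc, S.alongJet_add_ae_eq hg₁ hg₂ hΦ hu S.isOpen subset_rfl hk hφk]
      with x h1 h2
    rwa [← h2]
  by_cases hcm : -m ≤ c
  · have h1 := (S.ae_le_of_weak hf (hΦ.memLp S.isBounded 2).2.2 hΦ.eq_zero hw hp hK hle
      S.isOpen.measurableSet subset_rfl fun c' hc' => S.tendsto_measure_global hf hp hpt he het hmin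
        (hΦ.add hk S.isBounded) hcm hc1 hc').1
    filter_upwards [h1, S.alongJet_ae_eq_jetDensity hg₁ hg₂ hΦ hu S.isOpen subset_rfl] with x h2 h3
    rwa [h3]
  -- A level below `-m` contradicts the lower bound at almost every point, so the claim is vacuous.
  · filter_upwards [hc1, ae_restrict_mem S.isOpen.measurableSet] with x h1 hx
    exact absurd ((S.neg_le_jetDensity hx).trans h1) hcm

theorem isAbsoluteMinimiser_of_weak_limit (S : JetProblem Ω H m M g₀ g₁ g₂)
    (hg₁ : IsWeakDeriv Ω g₀ g₁) (hg₂ : IsWeakDeriv Ω g₁ g₂)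
    {f : ℕ → ℝ → ℝ} (hf : ∀ j, IsBend Ω (f j)) {Φ u : ℝ → ℝ} (hΦ : IsBend Ω Φ)
    (hu : u =ᵐ[volume.restrict Ω] fun x => g₀ x + prim (prim Φ) x)
    (hw : ∀ k, MemLp k 2 (volume.restrict Ω) →
      Tendsto (fun j => ∫ x in Ω, f j x * k x) atTop (𝓝 (∫ x in Ω, Φ x * k x)))
    {p e : ℕ → ℝ} (hp : ∀ j, 1 ≤ p j) (hpt : Tendsto p atTop atTop) (he : ∀ j, 0 < e j)
    (he1 : ∀ᶠ j in atTop, e j ≤ 1) (het : Tendsto (fun j => e j ^ (1 / p j)) atTop (𝓝 0))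
    {K : ℝ} (hK : 0 < K)
    (hle : ∀ᶠ j in atTop, lpMean Ω M (p j) (jetDensity H g₀ g₁ g₂ (f j)) ≤ ENNReal.ofReal K)
    (hmin : ∀ j v, IsBend Ω v → lpMean Ω M (p j) (jetDensity H g₀ g₁ g₂ (f j))
      ≤ ENNReal.ofReal (e j) + lpMean Ω M (p j) (jetDensity H g₀ g₁ g₂ v)) :
    IsAbsoluteMinimiser H Ω u := by
  refine ⟨S.memW2_of_bend hg₁ hg₂ hΦ hu ∞, fun O hO _ hOΩ φ hφ => ?_⟩
  have hsub : O ⊆ Ω := subset_closure.trans hOΩ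
  have hOb := S.isBounded.subset hsub
  obtain ⟨k, hk, hφk⟩ := (memW2InftyZero_iff hO hOb).1 hφ
  refine supEnergy_le_supEnergy fun c hc => ?_
  have hc1 : ∀ᵐ x ∂(volume.restrict O), jetDensity H g₀ g₁ g₂ (fun x => Φ x + k x) x ≤ c := by
    filter_upwards [hc, S.alongJet_add_ae_eq hg₁ hg₂ hΦ hu hO hsub hk hφk] with x h1 h2
    rwa [← h2]
  by_cases hcm : -m ≤ c
  · have hloc : ∀ᵐ x ∂(volume.restrict O), jetDensity H g₀ g₁ g₂ Φ x ≤ c := by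
      rw [ae_restrict_iff' hO.measurableSet, ae_iff]
      -- Local nullity suffices, so each point is treated in its own component, without enumerating
      -- components.
      refine measure_null_of_locally_null _ fun x hx => ?_
      simp only [Classical.not_imp, mem_ofPred_eq] at hx
      obtain ⟨a, b, hxab, hab, ha, hb⟩ := exists_component hO hOb hx.1
      have hlt : a < b := hxab.1.trans hxab.2
      -- Compact inclusion keeps the end points inside Ω; being outside `O`, they are also zeros of
      -- both primitives of `k`.
      have hcl : Icc a b ⊆ Ω := by
        rw [← closure_Ioo hlt.ne]
        exact (closure_mono hab).trans hOΩ
      have h1 := (S.ae_le_of_weak hf (hΦ.memLp S.isBounded 2).2.2 hΦ.eq_zero hw hp hK hle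
        measurableSet_Ioo (hab.trans hsub) fun c' hc' => S.tendsto_measure_local hf hΦ
          (tendsto_prim_of_weak S.isBounded (fun j => (hf j).eq_zero) hΦ.eq_zero hw)
          (S.tendsto_prim_prim hf hΦ.eq_zero hw hp hK hle) hp hpt he he1 het hK hle hmin hlt hcl
          (hk.mono hsub) (hk.prim_eq_zero hOb a ha) (hk.prim_eq_zero hOb b hb)
          (hk.prim_prim_eq_zero hOb a ha) (hk.prim_prim_eq_zero hOb b hb) hcm
          (ae_restrict_of_ae_restrict_of_subset hab hc1) hc').1
      rw [ae_restrict_iff' measurableSet_Ioo, ae_iff] at h1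
      refine ⟨_ ∩ Ioo a b, inter_mem self_mem_nhdsWithin
        (mem_nhdsWithin_of_mem_nhds (Ioo_mem_nhds hxab.1 hxab.2)), measure_mono_null ?_ h1⟩
      rintro y ⟨hy1, hy2⟩ hy3
      exact hy1 fun _ => hy3 hy2
    filter_upwards [hloc, S.alongJet_ae_eq_jetDensity hg₁ hg₂ hΦ hu hO hsub] with x h2 h3
    rwa [h3]
  · filter_upwards [hc1, ae_restrict_mem hO.measurableSet] with x h1 hx
    exact absurd ((S.neg_le_jetDensity (hsub hx)).trans h1) hcm

end JetProblem

/-! ### Assembly of the theorem -/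

theorem mainTheorem4
    (Ω : Set ℝ) (hΩ : IsOpen Ω) (hΩb : Bornology.IsBounded Ω)
    (H : ℝ → ℝ → ℝ → ℝ → ℝ)
    -- continuity on Ω × ℝ × ℝ × ℝ
    (hcont : ContinuousOn (fun z : ℝ × ℝ × ℝ × ℝ => H z.1 z.2.1 z.2.2.1 z.2.2.2)
      (Ω ×ˢ (univ : Set (ℝ × ℝ × ℝ))))
    -- lower bound, and the shift used in the approximating functionals
    (m M : ℝ) (hm : 0 < m) (hM : m < M)
    (hlower : ∀ x ∈ Ω, ∀ η P X : ℝ, -m ≤ H x η P X)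
    -- level-convexity in the last argument
    (hlevel : ∀ x ∈ Ω, ∀ η P c : ℝ, Convex ℝ {X : ℝ | H x η P X ≤ c})
    -- coercivity
    (hcoer : ∃ C₁ C₂ s t : ℝ, 0 < C₁ ∧ 0 < C₂ ∧ 0 ≤ s ∧ s < 1 ∧ 0 ≤ t ∧ t < 1 ∧
      ∀ᵐ x ∂(volume.restrict Ω), ∀ η P X : ℝ,
        C₁ * |X| - C₂ * (1 + |η| ^ s + |P| ^ t) ≤ H x η P X)
    -- modulus of continuity in the lower-order arguments
    (hmod : ∀ R : ℝ, 0 < R → ∃ (l : ℝ) (μ : ℝ → ℝ), 1 < l ∧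
      ContinuousOn μ (Ici 0) ∧ MonotoneOn μ (Ici 0) ∧ μ 0 = 0 ∧
      ∀ᵐ x ∂(volume.restrict Ω), ∀ η₁ ∈ Ioo (-R) R, ∀ η₂ ∈ Ioo (-R) R,
        ∀ P₁ ∈ Ioo (-R) R, ∀ P₂ ∈ Ioo (-R) R, ∀ X : ℝ,
          |H x η₁ P₁ X - H x η₂ P₂ X| ≤ μ (|η₁ - η₂| + |P₁ - P₂|) * (1 + |X| ^ l))
    -- boundary data of finite energy
    (g : ℝ → ℝ) (hg : MemW2 Ω ∞ g)
    (hfin : ∃ ψ ∈ dirichletClass Ω g, supEnergy H ψ Ω < ⊤)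
    -- tolerances
    (ε : ℝ → ℝ) (hε : ∀ p : ℝ, 1 < p → 0 < ε p)
    (hεlim : Tendsto (fun p : ℝ => ε p ^ (1 / p)) atTop (𝓝 0)) :
    (∃ u : ℝ → ℝ → ℝ, AreApproxMinimisers H M Ω g ε u) ∧
    ∀ u : ℝ → ℝ → ℝ, AreApproxMinimisers H M Ω g ε u →
      ∀ p : ℕ → ℝ, (∀ j, 1 < p j) → Tendsto p atTop atTop →
        (∃ κ : ℕ → ℕ, StrictMono κ ∧ ∃ uInf : ℝ → ℝ,
          WeaklyConvergesW2 Ω (fun j => u (p (κ j))) uInf) ∧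
        ∀ uInf : ℝ → ℝ, WeaklyConvergesW2 Ω (fun j => u (p j)) uInf →
          IsGlobalMinimiser H Ω g uInf ∧ IsAbsoluteMinimiser H Ω uInf := by
 
  obtain ⟨g₀, g₁, g₂, S, hg₀, hg₁, hg₂⟩ :=
    JetProblem.exists_of_memW2 hΩ hΩb hcont hm hM hlower hlevel hcoer hg
  obtain ⟨h, c, hh, hc0, hc⟩ := S.exists_bend_ae_le hg₀ hg₁ hg₂ hfin
  refine ⟨S.exists_areApproxMinimisers hg₀ hg₁ hg₂ hh hc hε, fun u hu p hp hpt => ?_⟩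
  choose f hf huf using fun j => (S.mem_dirichletClass_iff hg₀).1 (hu (p j) (hp j)).1
  have hp1 : ∀ j, 1 ≤ p j := fun j => (hp j).le
  have he : ∀ j, 0 < ε (p j) := fun j => hε _ (hp j)
  have het : Tendsto (fun j => ε (p j) ^ (1 / p j)) atTop (𝓝 0) := hεlim.comp hpt
  have he0 : Tendsto (fun j => ε (p j)) atTop (𝓝 0) := tendsto_zero_of_rpow_inv he hpt het
  have he1 : ∀ᶠ j in atTop, ε (p j) ≤ 1 := he0.eventually_le_const one_pos
  have hmin : ∀ j v, IsBend Ω v → lpMean Ω M (p j) (jetDensity H g₀ g₁ g₂ (f j))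
      ≤ ENNReal.ofReal (ε (p j)) + lpMean Ω M (p j) (jetDensity H g₀ g₁ g₂ v) := by
    intro j v hv
    refine ennreal_le_of_ereal_sub_le (he j).le (M := M) ?_
    rw [← S.lpEnergy_eq_of_bend hg₁ hg₂ (hf j) (huf j),
      ← S.lpEnergy_eq_of_bend hg₁ hg₂ hv (ae_eq_refl _)]
    refine (hu (p j) (hp j)).2.trans (add_le_add_right (iInf₂_le _ ?_) _)
    exact (S.mem_dirichletClass_iff hg₀).2 ⟨v, hv, ae_eq_refl _⟩
  have hMc : 0 ≤ M + c := by linarith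
  -- The uniform energy bound: a tolerance eventually at most 1 plus the level of the given
  -- finite-energy competitor.
  have hK : 0 < 1 + (M + c) := by linarith
  have hle : ∀ᶠ j in atTop, lpMean Ω M (p j) (jetDensity H g₀ g₁ g₂ (f j))
      ≤ ENNReal.ofReal (1 + (M + c)) := by
    filter_upwards [he1] with j hj
    rw [ENNReal.ofReal_add zero_le_one hMc]
    exact (hmin j h hh).trans (add_le_add (ENNReal.ofReal_le_ofReal hj)
      (lpMean_le_of_ae_le hΩb (one_pos.trans (hp j)) hc))
  refine ⟨S.exists_weakly_convergent_subseq hg₁ hg₂ hf huf hp1 hpt hK hle, fun w hw => ?_⟩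
  obtain ⟨Φ, hΦ, hwΦ, hlim⟩ :=
    S.exists_isBend_of_weaklyConverges hg₁ hg₂ hf huf hp1 hpt hK hle hw
  exact ⟨S.isGlobalMinimiser_of_weak_limit hg₀ hg₁ hg₂ hf hΦ hwΦ hlim hp1 hpt he he0 hK hle hmin,
    S.isAbsoluteMinimiser_of_weak_limit hg₁ hg₂ hf hΦ hwΦ hlim hp1 hpt he he1 het hK hle hmin⟩
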